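/- **Models.** Fix an integer $q\ge 2$. A $q$-state Potts model $M=(G,\beta_G,h_G)$ on $n$ vertices consists of a simple graph $G=(V,E)$ with $V=\{1,\dots,n\}$, edge weights $\beta_G:E\to\mathbb R$ and an external field $h_G:V\times[q]\to\mathbb R$. Its Gibbs distribution on $[q]^V$ is $$\mu_M(\sigma)=\frac1{Z_M}\exp\Big(\sum_{\{u,v\}\in E}\beta_G(\{u,v\})\mathbf 1(\sigma(u)=\sigma(v))+\sum_{v\in V}h_G(v,\sigma(v))\Big).$$ $M$ is ferromagnetic if $\beta_G(e)>0$ for all $e\in E$. The field is $h$-vertex-monochromatic if $|h_G(v,i)|\le h$ for all $v,i$ and, for every $v$, $h_G(v,i)\ne0$ for at most one spin $i$. Let $\mathcal M_{\mathrm{Potts\text{-}Mono}}(n,d,\beta,h)$ be the family of $q$-state Potts models on $n$ vertices with maximum degree at most $d$, with $|\beta_G(e)|\le\beta$ for all $e\in E$, and with $h$-vertex-monochromatic field; let $\mathcal M_{\mathrm{Potts\text{-}Bip\text{-}Mono}}(n,d,\beta,h)$ be its subfamily of models on bipartite graphs; a superscript $+$ denotes the ferromagnetic models in a family. **Testing.**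 An algorithm is a program of a probabilistic real random access machine (unit-cost exact arithmetic and comparison of reals, real constants, fair coin flips, no rounding) with access to an oracle for samples. A $\mathrm{poly}(n)$-time $\varepsilon$-identity testing algorithm for families $\mathcal M(n)$, $n\ge n_0$, is a single algorithm which, for every $n\ge n_0$, given $M\in\mathcal M(n)$ and independent samples from $\mu_{M^*}$ for an unknown $M^*\in\mathcal M(n)$, halts with the right answer within a number of steps polynomial in $n$ with probability at least $3/4$; the right answer is "yes" if $\mu_M=\mu_{M^*}$ and "no" if $\|\mu_M-\mu_{M^*}\|_{\mathrm{TV}}\ge1-\varepsilon$. **Theorem.** Let $\rho\in(0,1)$, $\beta,h\ge0$ and $\varepsilon\in\mathbb R$ be constants. Suppose that there is no $\mathrm{poly}(n)$-time $\varepsilon$-identity testing algorithm for $\mathcal M_{\mathrm{Potts\text{-}Mono}}(n,n,\beta,h)$, $n\ge3$. Then there is a constant $c\in(0,1)$ such that for every constant $\hat\varepsilon>\varepsilon$, every $n_0$ and all functions $d=d(\hat n)\in\mathbb N$, $\hat\beta=\hat\beta(\hat n)\in\mathbb R$, $\hat h=\hat h(\hat n)\in\mathbb R$ with $$3\le d\le\hat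 n^{1-\rho}\ \text{ and }\ \hat h\ge h\,\hat n^{-c}\ \text{ for all }\hat n\ge n_0,\qquad \hat\beta d=\omega(\log\hat n)\ \big(\text{that is, }\hat\beta d/\log\hat n\to+\infty\big),$$ there is no $\mathrm{poly}(\hat n)$-time $\hat\varepsilon$-identity testing algorithm for $\mathcal M_{\mathrm{Potts\text{-}Bip\text{-}Mono}}(\hat n,d,\hat\beta,\hat h)$, $\hat n\ge n_0$. The statement remains true if both families are replaced by their ferromagnetic subfamilies $\mathcal M^+_{\mathrm{Potts\text{-}Mono}}$ and $\mathcal M^+_{\mathrm{Potts\text{-}Bip\text{-}Mono}}$. -/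

import Mathlib

open Filter
open scoped ENNReal

noncomputable section

/-! ### Potts models -/

/-- A `q`-state Potts model on the vertex set `Fin n`: a simple graph, real edge weights, and real
vertex weights (the external field). -/
structure PottsModel (n q : ℕ) where
  graph : SimpleGraph (Fin n)
  edgeWeight : graph.edgeSet → ℝ
  field : Fin n → Fin q → ℝ

namespace PottsModel

variable {n q : ℕ}

open Classical in
/-- The unnormalised weight of a configuration. The edge `e` is monochromatic under `σ` exactly when
its image `Sym2.map σ e` lies on the diagonal. -/
def weight (M : PottsModel n q) (σ : Fin n → Fin q) : ℝ :=
  Real.exp ((∑ e : M.graph.edgeSet, if (Sym2.map σ e.1).IsDiag then M.edgeWeight e else 0)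
    + ∑ v, M.field v (σ v))

/-- The partition function. -/
def partitionFunction (M : PottsModel n q) : ℝ := ∑ σ : Fin n → Fin q, M.weight σ

theorem weight_pos (M : PottsModel n q) (σ : Fin n → Fin q) : 0 < M.weight σ := Real.exp_pos _

theorem partitionFunction_pos [NeZero q] (M : PottsModel n q) : 0 < M.partitionFunction :=
  Finset.sum_pos (fun σ _ => M.weight_pos σ) Finset.univ_nonempty

theorem sum_gibbs [NeZero q] (M : PottsModel n q) :
    ∑ σ : Fin n → Fin q, ENNReal.ofReal (M.weight σ / M.partitionFunction) = 1 := by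
  rw [← ENNReal.ofReal_sum_of_nonneg
    (fun σ _ => div_nonneg (M.weight_pos σ).le M.partitionFunction_pos.le), ← Finset.sum_div]
  change ENNReal.ofReal (M.partitionFunction / M.partitionFunction) = 1
  rw [div_self M.partitionFunction_pos.ne', ENNReal.ofReal_one]

/-- The Gibbs distribution. -/
def gibbs [NeZero q] (M : PottsModel n q) : PMF (Fin n → Fin q) :=
  PMF.ofFintype (fun σ => ENNReal.ofReal (M.weight σ / M.partitionFunction)) M.sum_gibbs

/-- All edge weights are positive. -/
def IsFerromagnetic (M : PottsModel n q) : Prop := ∀ e, 0 < M.edgeWeight e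

/-- The external field is `h`-vertex-monochromatic: it is bounded by `h`, and at every vertex it is
non-zero for at most one spin. -/
def IsVertexMonochromatic (M : PottsModel n q) (h : ℝ) : Prop :=
  (∀ v i, |M.field v i| ≤ h) ∧ ∀ v, {i | M.field v i ≠ 0}.ncard ≤ 1

end PottsModel

/-- Potts models on `n`-vertex graphs of maximum degree at most `d`, with edge weights bounded by `β`
and vertex weights bounded by `h` in absolute value. -/
def pottsFamily (q n d : ℕ) (β h : ℝ) : Set (PottsModel n q) :=
  {M | (∀ v, (M.graph.neighborSet v).ncard ≤ d) ∧ (∀ e, |M.edgeWeight e| ≤ β) ∧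
    ∀ v i, |M.field v i| ≤ h}

/-- The subfamily with `h`-vertex-monochromatic external fields. -/
def pottsMono (q n d : ℕ) (β h : ℝ) : Set (PottsModel n q) :=
  {M ∈ pottsFamily q n d β h | M.IsVertexMonochromatic h}

/-- The subfamily on bipartite graphs with `h`-vertex-monochromatic external fields. -/
def pottsBipMono (q n d : ℕ) (β h : ℝ) : Set (PottsModel n q) :=
  {M ∈ pottsMono q n d β h | M.graph.IsBipartite}

/-- The ferromagnetic models of `pottsMono`. -/
def ferroPottsMono (q n d : ℕ) (β h : ℝ) : Set (PottsModel n q) :=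
  {M ∈ pottsMono q n d β h | M.IsFerromagnetic}

/-- The ferromagnetic models of `pottsBipMono`. -/
def ferroPottsBipMono (q n d : ℕ) (β h : ℝ) : Set (PottsModel n q) :=
  {M ∈ pottsBipMono q n d β h | M.IsFerromagnetic}

/-- The total variation distance of two distributions on a finite set. -/
def tvDist {α : Type*} [Fintype α] (μ ν : PMF α) : ℝ :=
  (1 / 2) * ∑ x, |(μ x).toReal - (ν x).toReal|

/-! ### Algorithms

The inputs contain arbitrary real numbers, so algorithms are programs for a probabilistic real RAM:
exact real arithmetic and comparisons at unit cost, real constants, no rounding and no conversion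
from reals to integers. Natural numbers, used for counting and for indirect addressing, can be added,
subtracted and compared. The memory consists of two-dimensional arrays of naturals and of reals. -/

namespace RealRAM

/-- `nat a i j` and `real a i j` are the cells `(i, j)` of the `a`-th array of naturals and of
reals. -/
structure Store where
  nat : ℕ → ℕ → ℕ → ℕ
  real : ℕ → ℕ → ℕ → ℝ

/-- Natural-number expressions (`sub` is truncated). -/
inductive NatExpr where
  | const (k : ℕ)
  | cell (a : ℕ) (i j : NatExpr)
  | add (x y : NatExpr)
  | sub (x y : NatExpr)

/-- Real expressions (division by zero returns zero). -/
inductive RealExpr where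
  | const (c : ℝ)
  | cell (a : ℕ) (i j : NatExpr)
  | add (x y : RealExpr)
  | sub (x y : RealExpr)
  | mul (x y : RealExpr)
  | div (x y : RealExpr)

/-- Comparisons. -/
inductive Test where
  | natLt (x y : NatExpr)
  | realLt (x y : RealExpr)

/-- Programs. `coin a i j` writes a fair random bit into a cell of the `a`-th array of naturals;
`sample a i` draws a fresh sample from the unknown distribution and writes its spins into row `i` of
the `a`-th array of naturals. -/
inductive Program where
  | setNat (a : ℕ) (i j x : NatExpr)
  | setReal (a : ℕ) (i j : NatExpr) (x : RealExpr)
  | coin (a : ℕ) (i j : NatExpr)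
  | sample (a : ℕ) (i : NatExpr)
  | seq (P Q : Program)
  | ite (b : Test) (P Q : Program)
  | loop (b : Test) (P : Program)

def NatExpr.eval (s : Store) : NatExpr → ℕ
  | const k => k
  | cell a i j => s.nat a (i.eval s) (j.eval s)
  | add x y => x.eval s + y.eval s
  | sub x y => x.eval s - y.eval s

def RealExpr.eval (s : Store) : RealExpr → ℝ
  | const c => c
  | cell a i j => s.real a (i.eval s) (j.eval s)
  | add x y => x.eval s + y.eval s
  | sub x y => x.eval s - y.eval s
  | mul x y => x.eval s * y.eval s
  | div x y => x.eval s / y.eval s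

def Test.Holds (s : Store) : Test → Prop
  | natLt x y => x.eval s < y.eval s
  | realLt x y => x.eval s < y.eval s

def Store.writeNat (s : Store) (a i j x : ℕ) : Store :=
  { s with nat := fun a' i' j' => if a' = a ∧ i' = i ∧ j' = j then x else s.nat a' i' j' }

def Store.writeReal (s : Store) (a i j : ℕ) (x : ℝ) : Store :=
  { s with real := fun a' i' j' => if a' = a ∧ i' = i ∧ j' = j then x else s.real a' i' j' }

/-- Write the spins of a configuration on `n` vertices into the first `n` cells of a row. -/
def Store.writeSpins {n q : ℕ} (s : Store) (a i : ℕ) (σ : Fin n → Fin q) : Store :=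
  { s with nat := fun a' i' j' =>
      if hj : a' = a ∧ i' = i ∧ j' < n then (σ ⟨j', hj.2.2⟩ : ℕ) else s.nat a' i' j' }

/-- A configuration of the machine: the programs that are still to be executed, in order, and the
contents of the memory. The machine has halted when nothing is left to execute. -/
structure Config where
  todo : List Program
  store : Store

open Classical in
/-- One step of the machine, with sample access to `μ`. -/
def step {n q : ℕ} (μ : PMF (Fin n → Fin q)) : Config → PMF Config
  | ⟨[], s⟩ => PMF.pure ⟨[], s⟩
  | ⟨.setNat a i j x :: k, s⟩ =>
      PMF.pure ⟨k, s.writeNat a (i.eval s) (j.eval s) (x.eval s)⟩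
  | ⟨.setReal a i j x :: k, s⟩ =>
      PMF.pure ⟨k, s.writeReal a (i.eval s) (j.eval s) (x.eval s)⟩
  | ⟨.coin a i j :: k, s⟩ =>
      (PMF.uniformOfFintype Bool).map fun b =>
        ⟨k, s.writeNat a (i.eval s) (j.eval s) b.toNat⟩
  | ⟨.sample a i :: k, s⟩ => μ.map fun σ => ⟨k, s.writeSpins a (i.eval s) σ⟩
  | ⟨.seq P Q :: k, s⟩ => PMF.pure ⟨P :: Q :: k, s⟩
  | ⟨.ite b P Q :: k, s⟩ => PMF.pure (if b.Holds s then ⟨P :: k, s⟩ else ⟨Q :: k, s⟩)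
  | ⟨.loop b P :: k, s⟩ => PMF.pure (if b.Holds s then ⟨P :: .loop b P :: k, s⟩ else ⟨k, s⟩)

/-- The distribution of the configuration after `t` steps. -/
def run {n q : ℕ} (μ : PMF (Fin n → Fin q)) (P : Program) (s : Store) : ℕ → PMF Config
  | 0 => PMF.pure ⟨[P], s⟩
  | t + 1 => (run μ P s t).bind (step μ)

open Classical in
/-- The memory on input `M`. Array `0` of the naturals holds the number of vertices in cell `(0, 0)`,
array `1` of the naturals is the adjacency matrix, arrays `0` and `1` of the reals hold the edge
weights and the external field, and every other cell is zero. -/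
def input {n q : ℕ} (M : PottsModel n q) : Store where
  nat := fun a i j =>
    if a = 0 ∧ i = 0 ∧ j = 0 then n
    else if a = 1 ∧ ∃ (hi : i < n) (hj : j < n), M.graph.Adj ⟨i, hi⟩ ⟨j, hj⟩ then 1
    else 0
  real := fun a i j =>
    if a = 0 then
      if he : ∃ (hi : i < n) (hj : j < n), M.graph.Adj ⟨i, hi⟩ ⟨j, hj⟩ then
        M.edgeWeight ⟨s(⟨i, he.1⟩, ⟨j, he.2.1⟩), he.2.2⟩
      else 0
    else if a = 1 then
      if hv : i < n ∧ j < q then M.field ⟨i, hv.1⟩ ⟨j, hv.2⟩ else 0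
    else 0

/-- The probability that `P`, given the model `M` and sample access to `μ`, halts within `t` steps
with answer `b` in cell `(0, 0)` of array `2` of the naturals (`1` for yes, `0` for no). -/
def answerProb {n q : ℕ} (P : Program) (M : PottsModel n q) (μ : PMF (Fin n → Fin q)) (t : ℕ)
    (b : Bool) : ℝ≥0∞ :=
  (run μ P (input M) t).toOuterMeasure {c | c.todo = [] ∧ c.store.nat 2 0 0 = b.toNat}

end RealRAM

/-- `P` solves the `ε`-identity testing problem for the family `𝓜` of models on `n` vertices within
`t` steps: given a model `M` of the family and samples from the Gibbs distribution of an unknown model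
`M'` of the family, with probability at least `3 / 4` it answers yes within `t` steps if the two Gibbs
distributions are equal, and no if their total variation distance is at least `1 - ε`. -/
def IsIdentityTester {n q : ℕ} [NeZero q] (P : RealRAM.Program) (ε : ℝ) (t : ℕ)
    (𝓜 : Set (PottsModel n q)) : Prop :=
  ∀ M ∈ 𝓜, ∀ M' ∈ 𝓜,
    (M.gibbs = M'.gibbs → 3 / 4 ≤ RealRAM.answerProb P M M'.gibbs t true) ∧
    (1 - ε ≤ tvDist M.gibbs M'.gibbs → 3 / 4 ≤ RealRAM.answerProb P M M'.gibbs t false)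

/-- There is one algorithm that solves the `ε`-identity testing problem for `𝓜 n`, for every `n ≥ n₀`,
in a number of steps that is polynomial in `n`. -/
def HasPolyTimeTester {q : ℕ} [NeZero q] (ε : ℝ) (n₀ : ℕ) (𝓜 : ∀ n, Set (PottsModel n q)) : Prop :=
  ∃ (P : RealRAM.Program) (p : Polynomial ℕ), ∀ n ≥ n₀, IsIdentityTester P ε (p.eval n) (𝓜 n)

end

/-!
A tester for bipartite models of small degree is turned into a tester for arbitrary models. Given
a model `M` on `n` vertices, every vertex is blown up to a block of `L` vertices on which a
bipartite graph of maximum degree at most `3 s`, the gadget, forces a common spin, where `3 s` is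
about `d (n L)`. Every edge of `M` is divided into `s` links between ports of the two blocks, and
every external field is divided among the ports of the block. In this way the degree is at most `3
s`, the edge weights are small, and the fields shrink by a factor of at least `(n L) ^ c`.

*The gadget.* The layers of the gadget are sets of `s` vertices, arranged in `R ≥ n` rows;
consecutive layers are completely joined, and every two rows are joined by a chord (`gadget`).
Port layers have no chords, which leaves room for one link per port vertex, and the layers
alternate between the two colours, so that both kinds of ports, one for each orientation of an
edge of `M`, are available. The gadget contains `s` spanning trees whose edges are distinct
ordered pairs, so that a configuration that violates few edges violates few edges of one of these
trees; this bounds the total weight of the non-constant configurations (`gadget_sum_nonconst_le`).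
The chords provide `s ^ 2` edges between any two rows, so that all but a number of ports
proportional to the number of violated edges have the same spin (`exists_spin_of_ports`). Half of
the energy lost in the gadgets hence pays for whatever the links gain from deviating ports, and
the other half makes the configurations that are not constant on blocks negligible: their relative
weight is at most `4 q² N² exp (-lam / 4)`, where `N = n L` and `lam` is the strength of the
gadgets (`blowUp_approximates`, `blowUp_error_le`). Since `β' d` grows faster than the logarithm,
this is smaller than the inverse of any polynomial (`exists_strength`).

*The tester.* The distribution of the blown-up model is thus close to that of `σ ∘ block`, where
`σ` is a sample of the original model. A tester for the blown-up models therefore answers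
correctly with probability at least `7 / 10` if it is run on such samples
(`haltProb_of_isIdentityTester`). In the case of equal distributions it is compared with its run
on the samples of the blown-up model of the *given* model only. Three runs and a majority vote
restore the probability `3 / 4`.

*The program.* The new tester writes down the blown-up model, and simulates the given program step
by step, since the runs have to be cut off after the time in which they succeed with the required
probability (`exists_simulating_program`). The parameters depend on the arbitrary functions `d`
and `β'` and need not be computable. They are read off from real constants: all tables that
describe the blow-up, for all `n`, are encoded in the digits of one real number each
(`exists_stream`). The blow-up is independent of the weights of `M`, and preserves positive
weights, whence the ferromagnetic case.

In the memory of the new tester, the arrays `0` to `2` hold the input and the answer, `3` to `6`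
the tables of the advice, `7` the number of positive votes, and `10` to `19` intermediate results,
with the program counter in `10` and the clock in `11` during a simulation. The arrays from `20`
on belong to the simulated machines.
-/

noncomputable section

namespace RealRAM

/-! ### Expected values of the machine -/

/-- The expected value of `f` under `p`. -/
def expect {α : Type*} (p : PMF α) (f : α → ℝ≥0∞) : ℝ≥0∞ := ∑' a, p a * f a

theorem expect_mono {α : Type*} (p : PMF α) {f g : α → ℝ≥0∞} (h : ∀ a, f a ≤ g a) :
    expect p f ≤ expect p g :=
  ENNReal.tsum_le_tsum fun a => mul_le_mul_right (h a) _

theorem expect_const {α : Type*} (p : PMF α) (x : ℝ≥0∞) : expect p (fun _ => x) = x := by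
  rw [expect, ENNReal.tsum_mul_right, p.tsum_coe, one_mul]

theorem expect_add {α : Type*} (p : PMF α) (f g : α → ℝ≥0∞) :
    expect p (fun a => f a + g a) = expect p f + expect p g := by
  simp only [expect, mul_add, ENNReal.tsum_add]

theorem expect_mul_const {α : Type*} (p : PMF α) (f : α → ℝ≥0∞) (x : ℝ≥0∞) :
    expect p (fun a => f a * x) = expect p f * x := by
  simp only [expect, ← mul_assoc, ENNReal.tsum_mul_right]

theorem expect_pure {α : Type*} (a : α) (f : α → ℝ≥0∞) : expect (PMF.pure a) f = f a := by
  rw [expect, tsum_eq_single a]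
  · simp
  · intro b hb; simp [hb]

theorem expect_bind {α γ : Type*} (p : PMF α) (k : α → PMF γ) (f : γ → ℝ≥0∞) :
    expect (p.bind k) f = expect p fun a => expect (k a) f := by
  simp only [expect, PMF.bind_apply, ← ENNReal.tsum_mul_right, ← ENNReal.tsum_mul_left]
  rw [ENNReal.tsum_comm]
  simp only [mul_assoc]

theorem expect_map {α γ : Type*} (p : PMF α) (g : α → γ) (f : γ → ℝ≥0∞) :
    expect (p.map g) f = expect p fun a => f (g a) := by
  rw [PMF.map, expect_bind]
  simp only [Function.comp, expect_pure]

section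

variable {n q : ℕ} (μ : PMF (Fin n → Fin q))

/-- The expected value of `G` at the configuration that is reached after `t` steps. -/
def iter (G : Config → ℝ≥0∞) : ℕ → Config → ℝ≥0∞
  | 0, c => G c
  | t + 1, c => expect (step μ c) (iter G t)

theorem expect_run (G : Config → ℝ≥0∞) (P : Program) (s : Store) (t k : ℕ) :
    expect (run μ P s t) (iter μ G k) = iter μ G (t + k) ⟨[P], s⟩ := by
  induction t generalizing k with
  | zero => rw [run, expect_pure, Nat.zero_add]
  | succ t ih =>
    rw [run, expect_bind, show t + 1 + k = t + (k + 1) by ring, ← ih (k + 1)]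
    rfl

theorem iter_mono {G G' : Config → ℝ≥0∞} (h : ∀ c, G c ≤ G' c) (t : ℕ) (c : Config) :
    iter μ G t c ≤ iter μ G' t c := by
  induction t generalizing c with
  | zero => exact h c
  | succ t ih => exact expect_mono _ ih

theorem iter_add_mul (G₁ G₂ : Config → ℝ≥0∞) (x y : ℝ≥0∞) (t : ℕ) (c : Config) :
    iter μ (fun c => G₁ c * x + G₂ c * y) t c = iter μ G₁ t c * x + iter μ G₂ t c * y := by
  induction t generalizing c with
  | zero => rfl
  | succ t ih =>
    simp only [iter, ← expect_mul_const, ← expect_add]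
    exact congrArg _ (funext ih)

theorem iter_const (x : ℝ≥0∞) (t : ℕ) (c : Config) : iter μ (fun _ => x) t c = x := by
  induction t generalizing c with
  | zero => rfl
  | succ t ih =>
    simp only [iter]
    rw [show iter μ (fun _ => x) t = fun _ => x from funext ih, expect_const]

open Classical in
/-- The probability that the machine halts within `t` steps with its memory in `A`. -/
def haltProb (A : Set Store) : ℕ → Config → ℝ≥0∞ :=
  iter μ fun c => if c.todo = [] ∧ c.store ∈ A then 1 else 0

theorem answerProb_eq (P : Program) (M : PottsModel n q) (t : ℕ) (b : Bool) :
    answerProb P M μ t b = haltProb μ {s | s.nat 2 0 0 = b.toNat} t ⟨[P], input M⟩ := by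
  rw [haltProb, ← Nat.add_zero t, ← expect_run, answerProb, PMF.toOuterMeasure_apply]
  refine tsum_congr fun c => ?_
  simp only [Set.indicator, iter, Set.mem_ofPred_eq]
  split_ifs <;> simp

variable (A : Set Store)

theorem haltProb_mono_succ (t : ℕ) (c : Config) :
    haltProb μ A t c ≤ haltProb μ A (t + 1) c := by
  induction t generalizing c with
  | zero =>
    rcases c with ⟨_ | ⟨P, k⟩, s⟩
    · exact le_of_eq (expect_pure _ _).symm
    · simp [haltProb, iter]
  | succ t ih => exact expect_mono _ ih

theorem haltProb_mono {t t' : ℕ} (h : t ≤ t') (c : Config) :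
    haltProb μ A t c ≤ haltProb μ A t' c :=
  monotone_nat_of_le_succ (f := fun t => haltProb μ A t c)
    (fun t => haltProb_mono_succ μ A t c) h

theorem haltProb_nil {s : Store} (hs : s ∈ A) (t : ℕ) : haltProb μ A t ⟨[], s⟩ = 1 := by
  induction t with
  | zero => simp [haltProb, iter, hs]
  | succ t ih => exact (expect_pure _ _).trans ih

theorem haltProb_coin (t : ℕ) (a : ℕ) (i j : NatExpr) (k : List Program) (s : Store) :
    haltProb μ A (t + 1) ⟨.coin a i j :: k, s⟩ =
      expect (PMF.uniformOfFintype Bool) fun b =>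
        haltProb μ A t ⟨k, s.writeNat a (i.eval s) (j.eval s) b.toNat⟩ :=
  expect_map _ _ _

theorem haltProb_sample (t : ℕ) (a : ℕ) (i : NatExpr) (k : List Program) (s : Store) :
    haltProb μ A (t + 1) ⟨.sample a i :: k, s⟩ =
      expect μ fun σ => haltProb μ A t ⟨k, s.writeSpins a (i.eval s) σ⟩ :=
  expect_map _ _ _

end

/-! ### Deterministic runs -/

/-- Started in memory `s`, the program `P` terminates within `T` steps in memory `s'`. This is
expressed through the halting probabilities of all continuations, so that it composes. -/
def Runs (T : ℕ) (P : Program) (s s' : Store) : Prop :=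
  ∀ (n q : ℕ) (μ : PMF (Fin n → Fin q)) (A : Set Store) (K : List Program) (t : ℕ),
    haltProb μ A t ⟨K, s'⟩ ≤ haltProb μ A (t + T) ⟨P :: K, s⟩

namespace Runs

variable {P Q : Program} {s s₁ s₂ : Store} {T T₁ T₂ : ℕ}

theorem mono (h : Runs T₁ P s s₁) (hT : T₁ ≤ T₂) : Runs T₂ P s s₁ := fun _ _ μ A K t =>
  (h _ _ μ A K t).trans (haltProb_mono μ A (by omega) _)

theorem setNat (a : ℕ) (i j x : NatExpr) (s : Store) :
    Runs 1 (.setNat a i j x) s (s.writeNat a (i.eval s) (j.eval s) (x.eval s)) :=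
  fun _ _ _ _ _ _ => le_of_eq (expect_pure _ _).symm

theorem setReal (a : ℕ) (i j : NatExpr) (x : RealExpr) (s : Store) :
    Runs 1 (.setReal a i j x) s (s.writeReal a (i.eval s) (j.eval s) (x.eval s)) :=
  fun _ _ _ _ _ _ => le_of_eq (expect_pure _ _).symm

theorem seq (h₁ : Runs T₁ P s s₁) (h₂ : Runs T₂ Q s₁ s₂) :
    Runs (T₁ + T₂ + 1) (.seq P Q) s s₂ := fun _ _ μ A K t =>
  (h₂ _ _ μ A K t).trans <| (h₁ _ _ μ A (Q :: K) (t + T₂)).trans <| by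
    rw [show t + (T₁ + T₂ + 1) = t + T₂ + T₁ + 1 by ring]
    exact le_of_eq (expect_pure _ _).symm

theorem ite_pos {b : Test} (hb : b.Holds s) (h : Runs T P s s₁) :
    Runs (T + 1) (.ite b P Q) s s₁ := fun _ _ μ A K t =>
  (h _ _ μ A K t).trans <| le_of_eq <| by
    have := expect_pure (⟨P :: K, s⟩ : Config) (haltProb μ A (t + T))
    rw [← this, ← add_assoc]
    simp [haltProb, iter, step, hb]

theorem ite_neg {b : Test} (hb : ¬ b.Holds s) (h : Runs T Q s s₁) :
    Runs (T + 1) (.ite b P Q) s s₁ := fun _ _ μ A K t =>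
  (h _ _ μ A K t).trans <| le_of_eq <| by
    have := expect_pure (⟨Q :: K, s⟩ : Config) (haltProb μ A (t + T))
    rw [← this, ← add_assoc]
    simp [haltProb, iter, step, hb]

theorem loop_neg {b : Test} (hb : ¬ b.Holds s) : Runs 1 (.loop b P) s s := fun _ _ μ A K t =>
  le_of_eq <| by
    have := expect_pure (⟨K, s⟩ : Config) (haltProb μ A t)
    rw [← this]
    simp [haltProb, iter, step, hb]

theorem loop_pos {b : Test} (hb : b.Holds s) (h₁ : Runs T₁ P s s₁)
    (h₂ : Runs T₂ (.loop b P) s₁ s₂) : Runs (T₁ + T₂ + 1) (.loop b P) s s₂ := fun _ _ μ A K t =>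
  (h₂ _ _ μ A K t).trans <| (h₁ _ _ μ A (.loop b P :: K) (t + T₂)).trans <| le_of_eq <| by
    have := expect_pure (⟨P :: .loop b P :: K, s⟩ : Config) (haltProb μ A (t + T₂ + T₁))
    rw [← this, show t + (T₁ + T₂ + 1) = t + T₂ + T₁ + 1 by ring]
    simp [haltProb, iter, step, hb]

end Runs

/-- From every memory satisfying `I`, the program `P` terminates within `T` steps in a memory
satisfying `J`. -/
def Triple (T : ℕ) (I : Store → Prop) (P : Program) (J : Store → Prop) : Prop :=
  ∀ s, I s → ∃ s', Runs T P s s' ∧ J s'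

/-! ### Memory access -/

theorem nat_writeNat (s : Store) (a i j x a' i' j' : ℕ) :
    (s.writeNat a i j x).nat a' i' j' =
      if a' = a ∧ i' = i ∧ j' = j then x else s.nat a' i' j' := rfl

@[simp] theorem nat_writeNat_self (s : Store) (a i j x : ℕ) :
    (s.writeNat a i j x).nat a i j = x := by simp [nat_writeNat]

theorem nat_writeNat_ne (s : Store) {a a' : ℕ} (i j x : ℕ) (h : a' ≠ a) :
    (s.writeNat a i j x).nat a' = s.nat a' := by
  funext i' j'; simp [nat_writeNat, h]

@[simp] theorem real_writeNat (s : Store) (a i j x : ℕ) : (s.writeNat a i j x).real = s.real := rfl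

@[simp] theorem nat_writeReal (s : Store) (a i j : ℕ) (x : ℝ) :
    (s.writeReal a i j x).nat = s.nat := rfl

theorem real_writeReal (s : Store) (a i j : ℕ) (x : ℝ) (a' i' j' : ℕ) :
    (s.writeReal a i j x).real a' i' j' =
      if a' = a ∧ i' = i ∧ j' = j then x else s.real a' i' j' := rfl

@[simp] theorem real_writeReal_self (s : Store) (a i j : ℕ) (x : ℝ) :
    (s.writeReal a i j x).real a i j = x := by simp [real_writeReal]

theorem real_writeReal_ne (s : Store) {a a' : ℕ} (i j : ℕ) (x : ℝ) (h : a' ≠ a) :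
    (s.writeReal a i j x).real a' = s.real a' := by
  funext i' j'; simp [real_writeReal, h]

theorem nat_writeSpins {n q : ℕ} (s : Store) (a i : ℕ) (σ : Fin n → Fin q) (a' i' j' : ℕ) :
    (s.writeSpins a i σ).nat a' i' j' =
      if hj : a' = a ∧ i' = i ∧ j' < n then (σ ⟨j', hj.2.2⟩ : ℕ) else s.nat a' i' j' := rfl

theorem nat_writeSpins_ne {n q : ℕ} (s : Store) {a a' : ℕ} (i : ℕ) (σ : Fin n → Fin q)
    (h : a' ≠ a) : (s.writeSpins a i σ).nat a' = s.nat a' := by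
  funext i' j'; simp [nat_writeSpins, h]

/-- The scalar variable held in cell `(0, 0)` of the `a`-th array of naturals. -/
def nvar (a : ℕ) : NatExpr := .cell a (.const 0) (.const 0)

@[simp] theorem eval_nvar (a : ℕ) (s : Store) : (nvar a).eval s = s.nat a 0 0 := rfl

/-- The scalar variable held in cell `(0, 0)` of the `a`-th array of reals. -/
def rvar (a : ℕ) : RealExpr := .cell a (.const 0) (.const 0)

@[simp] theorem eval_rvar (a : ℕ) (s : Store) : (rvar a).eval s = s.real a 0 0 := rfl

/-- Assignment to a scalar variable. -/
def setNvar (a : ℕ) (x : NatExpr) : Program := .setNat a (.const 0) (.const 0) x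

/-- Assignment to a real scalar variable. -/
def setRvar (a : ℕ) (x : RealExpr) : Program := .setReal a (.const 0) (.const 0) x

theorem Runs.setNvar (a : ℕ) (x : NatExpr) (s : Store) :
    Runs 1 (setNvar a x) s (s.writeNat a 0 0 (x.eval s)) := Runs.setNat a _ _ x s

theorem Runs.setRvar (a : ℕ) (x : RealExpr) (s : Store) :
    Runs 1 (setRvar a x) s (s.writeReal a 0 0 (x.eval s)) := Runs.setReal a _ _ x s

/-- Execute `P` for `v = 0, 1, …` as long as `v` is less than `b`. -/
def forLoop (v : ℕ) (b : NatExpr) (P : Program) : Program :=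
  .seq (setNvar v (.const 0))
    (.loop (.natLt (nvar v) b) (.seq P (setNvar v (.add (nvar v) (.const 1)))))

/-- The rule for counting loops. The invariant `I i` is about the memory before the `i`-th round,
with the counter already set to `i`. -/
theorem Triple.forLoop {v : ℕ} {b : NatExpr} {P : Program} {T m : ℕ} {I : ℕ → Store → Prop}
    {I₀ : Store → Prop}
    (h₀ : ∀ s, I₀ s → I 0 (s.writeNat v 0 0 0))
    (hb : ∀ i s, I i s → s.nat v 0 0 = i ∧ b.eval s = m)
    (hP : ∀ i < m, ∀ s, I i s → ∃ s', Runs T P s s' ∧ s'.nat v 0 0 = i ∧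
      I (i + 1) (s'.writeNat v 0 0 (i + 1))) :
    Triple (m * (T + 3) + 3) I₀ (forLoop v b P) (I m) := by
  have key : ∀ k i, i + k = m → Triple (k * (T + 3) + 1) (I i)
      (.loop (.natLt (nvar v) b) (.seq P (setNvar v (.add (nvar v) (.const 1))))) (I m) := by
    intro k
    induction k with
    | zero =>
      intro i hi s hs
      obtain ⟨h1, h2⟩ := hb i s hs
      obtain rfl : i = m := by omega
      refine ⟨s, ?_, hs⟩
      rw [Nat.zero_mul]
      exact Runs.loop_neg (by simp [Test.Holds, h1, h2])
    | succ k ih =>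
      intro i hi s hs
      obtain ⟨h1, h2⟩ := hb i s hs
      obtain ⟨s₁, r₁, hv, hs₁⟩ := hP i (by omega) s hs
      have r₂ := Runs.setNvar v (.add (nvar v) (.const 1)) s₁
      have e : (NatExpr.add (nvar v) (.const 1)).eval s₁ = i + 1 := by
        simp [NatExpr.eval, hv]
      rw [e] at r₂
      obtain ⟨s₂, r₃, hs₂⟩ := ih (i + 1) (by omega) _ hs₁
      refine ⟨s₂, (Runs.loop_pos ?_ (r₁.seq r₂) r₃).mono ?_, hs₂⟩
      · simp only [Test.Holds, eval_nvar, h1, h2]; omega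
      · ring_nf; omega
  intro s hs
  obtain ⟨s', r, hs'⟩ := key m 0 (by omega) _ (h₀ s hs)
  exact ⟨s', ((Runs.setNvar v (.const 0) s).seq r).mono (by omega), hs'⟩

/-! ### Real constants as advice -/

/-- A sequence of naturals can be packed into one real number: its terms are written in unary as
runs of the digit one, separated by zeros, in base four. Here `X t` is the number that remains when
the first `t` terms have been read, and `Y` runs through the remainders while term `t` is read. -/
theorem exists_stream (e : ℕ → ℕ) : ∃ X : ℕ → ℝ, ∀ t, ∃ Y : ℕ → ℝ, Y 0 = X t ∧
    (∀ i < e t, 1 / 2 < Y i ∧ Y (i + 1) = 4 * (Y i - 1)) ∧ Y (e t) ≤ 1 / 2 ∧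
    X (t + 1) = 4 * Y (e t) := by
  classical
  set S : ℕ → ℕ := fun n => ∑ m ∈ Finset.range n, (e m + 1) with hS
  have S_succ : ∀ n, S (n + 1) = S n + (e n + 1) := fun n => Finset.sum_range_succ _ _
  have S_mono : StrictMono S := strictMono_nat_of_lt_succ fun n => by rw [S_succ]; omega
  set f : ℕ → Bool := fun k => decide (∀ t, k + 1 ≠ S (t + 1)) with hf
  have f_true : ∀ t, ∀ i < e t, f (S t + i) = true := by
    intro t i hi
    simp only [hf, decide_eq_true_eq]
    intro t' h
    have h1 : S t < S (t' + 1) := by omega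
    have h2 : S (t' + 1) < S (t + 1) := by rw [S_succ t]; omega
    have := S_mono.lt_iff_lt.1 h1
    have := S_mono.lt_iff_lt.1 h2
    omega
  have f_false : ∀ t, f (S t + e t) = false := by
    intro t
    simp only [hf, decide_eq_false_iff_not, not_forall, not_not]
    exact ⟨t, by rw [S_succ]; omega⟩
  set Z : ℕ → ℝ := fun k => Cardinal.cantorFunction (1 / 4) fun i => f (k + i) with hZ
  have Z_succ : ∀ k, Z k = cond (f k) 1 0 + 1 / 4 * Z (k + 1) := by
    intro k
    have := Cardinal.cantorFunction_succ (c := 1 / 4) (fun i => f (k + i)) (by norm_num)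
      (by norm_num)
    simp only [hZ, this, Nat.add_zero]
    congr 3
    funext i
    congr 1
    omega
  have Z_le : ∀ k, Z k ≤ 4 / 3 := by
    intro k
    have h1 := Cardinal.cantorFunction_le (c := 1 / 4) (f := fun i => f (k + i))
      (g := fun _ => true) (by norm_num) (by norm_num) (by simp)
    have h2 := Cardinal.cantorFunction_succ (c := 1 / 4) (fun _ => true) (by norm_num)
      (by norm_num)
    simp only [cond_true] at h2
    simp only [hZ]
    linarith
  have Z_nonneg : ∀ k, 0 ≤ Z k := by
    intro k
    have h1 := Cardinal.cantorFunction_le (c := 1 / 4) (g := fun i => f (k + i))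
      (f := fun _ => false) (by norm_num) (by norm_num) (by simp)
    have h2 := Cardinal.cantorFunction_succ (c := 1 / 4) (fun _ => false) (by norm_num)
      (by norm_num)
    simp only [cond_false] at h2
    simp only [hZ]
    linarith
  refine ⟨fun t => Z (S t), fun t => ⟨fun i => Z (S t + i), rfl, fun i hi => ?_, ?_, ?_⟩⟩
  · have h := Z_succ (S t + i)
    rw [f_true t i hi, cond_true] at h
    have := Z_nonneg (S t + i + 1)
    refine ⟨by linarith, ?_⟩
    simp only [← add_assoc]
    linarith
  · have h := Z_succ (S t + e t)
    rw [f_false t, cond_false] at h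
    have := Z_le (S t + e t + 1)
    linarith
  · have h := Z_succ (S t + e t)
    rw [f_false t, cond_false] at h
    simp only [S_succ t, ← add_assoc]
    linarith

/-- Concatenation of finite sequences: `b m 0, …, b m (l m - 1)` for `m = 0, 1, …`. -/
theorem exists_concat (l : ℕ → ℕ) (b : ℕ → ℕ → ℕ) : ∃ e : ℕ → ℕ,
    ∀ m, ∀ t < l m, e ((∑ k ∈ Finset.range m, l k) + t) = b m t := by
  classical
  set S : ℕ → ℕ := fun m => ∑ k ∈ Finset.range m, l k with hS
  have S_succ : ∀ m, S (m + 1) = S m + l m := fun n => Finset.sum_range_succ _ _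
  have S_mono : Monotone S := monotone_nat_of_le_succ fun m => by rw [S_succ]; omega
  have key : ∀ m m' t t', t < l m → t' < l m' → S m + t = S m' + t' → m ≤ m' := by
    intro m m' t t' ht ht' h
    by_contra! hlt
    have := S_mono (show m' + 1 ≤ m by omega)
    rw [S_succ] at this
    omega
  refine ⟨fun k => if h : ∃ p : ℕ × ℕ, p.2 < l p.1 ∧ k = S p.1 + p.2 then
    b h.choose.1 h.choose.2 else 0, fun m t ht => ?_⟩
  have h : ∃ p : ℕ × ℕ, p.2 < l p.1 ∧ S m + t = S p.1 + p.2 := ⟨(m, t), ht, rfl⟩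
  obtain ⟨h1, h2⟩ := h.choose_spec
  have hm : m = h.choose.1 := le_antisymm (key _ _ _ _ ht h1 h2) (key _ _ _ _ h1 ht h2.symm)
  change (if h : ∃ p : ℕ × ℕ, p.2 < l p.1 ∧ S m + t = S p.1 + p.2 then
    b h.choose.1 h.choose.2 else 0) = _
  rw [dif_pos h, ← hm, show h.choose.2 = t by rw [← hm] at h2; omega]

/-- The memory `s'` differs from `s` at most in the arrays of naturals in `U` and in the arrays of
reals in `V`. -/
def Frame (U V : Set ℕ) (s s' : Store) : Prop :=
  (∀ a ∉ U, s'.nat a = s.nat a) ∧ ∀ a ∉ V, s'.real a = s.real a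

namespace Frame

variable {U V U' V' : Set ℕ} {s s' s'' : Store}

theorem refl (U V : Set ℕ) (s : Store) : Frame U V s s := ⟨fun _ _ => rfl, fun _ _ => rfl⟩

theorem trans (h : Frame U V s s') (h' : Frame U V s' s'') : Frame U V s s'' :=
  ⟨fun a ha => (h'.1 a ha).trans (h.1 a ha), fun a ha => (h'.2 a ha).trans (h.2 a ha)⟩

theorem mono (h : Frame U V s s') (hU : U ⊆ U') (hV : V ⊆ V') : Frame U' V' s s' :=
  ⟨fun a ha => h.1 a fun h' => ha (hU h'), fun a ha => h.2 a fun h' => ha (hV h')⟩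

theorem writeNat (h : Frame U V s s') {a : ℕ} (ha : a ∈ U) (i j x : ℕ) :
    Frame U V s (s'.writeNat a i j x) :=
  ⟨fun b hb => (nat_writeNat_ne s' _ _ _ (by rintro rfl; exact hb ha)).trans (h.1 b hb), h.2⟩

theorem writeReal (h : Frame U V s s') {a : ℕ} (ha : a ∈ V) (i j : ℕ) (x : ℝ) :
    Frame U V s (s'.writeReal a i j x) :=
  ⟨h.1, fun b hb => (real_writeReal_ne _ _ _ _ (by rintro rfl; exact hb ha)).trans (h.2 b hb)⟩

theorem writeSpins (h : Frame U V s s') {a : ℕ} (ha : a ∈ U) {n q : ℕ} (i : ℕ)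
    (σ : Fin n → Fin q) : Frame U V s (s'.writeSpins a i σ) :=
  ⟨fun b hb => (nat_writeSpins_ne _ _ _ (by rintro rfl; exact hb ha)).trans (h.1 b hb), h.2⟩

end Frame

/-- Read the next natural number off the real number in `rvar 10`; it is delivered both as a natural
number in `nvar 10` and as a real number in `rvar 11`. -/
def readNat : Program :=
  .seq (setNvar 10 (.const 0)) <| .seq (setRvar 11 (.const 0)) <|
  .seq (.loop (.realLt (.const (1 / 2)) (rvar 10)) <|
    .seq (setRvar 10 (.mul (.const 4) (.sub (rvar 10) (.const 1)))) <|
    .seq (setNvar 10 (.add (nvar 10) (.const 1))) (setRvar 11 (.add (rvar 11) (.const 1))))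
  (setRvar 10 (.mul (.const 4) (rvar 10)))

theorem readNat_spec {Y : ℕ → ℝ} {m : ℕ} (hY : ∀ i < m, 1 / 2 < Y i ∧ Y (i + 1) = 4 * (Y i - 1))
    (hm : Y m ≤ 1 / 2) {s : Store} (hs : s.real 10 0 0 = Y 0) :
    ∃ s', Runs (6 * m + 7) readNat s s' ∧ Frame {10} {10, 11} s s' ∧ s'.nat 10 0 0 = m ∧
      s'.real 11 0 0 = m ∧ s'.real 10 0 0 = 4 * Y m := by
  have key : ∀ k i, i + k = m → ∀ s₁, Frame {10} {10, 11} s s₁ → s₁.real 10 0 0 = Y i →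
      s₁.nat 10 0 0 = i → s₁.real 11 0 0 = i → ∃ s₂,
      Runs (6 * k + 1) (.loop (.realLt (.const (1 / 2)) (rvar 10)) <|
        .seq (setRvar 10 (.mul (.const 4) (.sub (rvar 10) (.const 1)))) <|
        .seq (setNvar 10 (.add (nvar 10) (.const 1))) (setRvar 11 (.add (rvar 11) (.const 1))))
      s₁ s₂ ∧ Frame {10} {10, 11} s s₂ ∧ s₂.real 10 0 0 = Y m ∧ s₂.nat 10 0 0 = m ∧
        s₂.real 11 0 0 = m := by
    intro k
    induction k with
    | zero =>
      intro i hi s₁ hf h1 h2 h3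
      obtain rfl : i = m := by omega
      refine ⟨s₁, Runs.loop_neg ?_, hf, h1, h2, h3⟩
      simp only [Test.Holds, RealExpr.eval, eval_rvar, h1]
      exact not_lt.2 hm
    | succ k ih =>
      intro i hi s₁ hf h1 h2 h3
      obtain ⟨hY1, hY2⟩ := hY i (by omega)
      have r₁ := Runs.setRvar 10 (.mul (.const 4) (.sub (rvar 10) (.const 1))) s₁
      set s₂ := s₁.writeReal 10 0 0 _ with hs₂
      have r₂ := Runs.setNvar 10 (.add (nvar 10) (.const 1)) s₂
      set s₃ := s₂.writeNat 10 0 0 _ with hs₃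
      have r₃ := Runs.setRvar 11 (.add (rvar 11) (.const 1)) s₃
      set s₄ := s₃.writeReal 11 0 0 _ with hs₄
      obtain ⟨s₅, r, hf', h⟩ := ih (i + 1) (by omega) s₄
        (((hf.writeReal (by simp) _ _ _).writeNat (by simp) _ _ _).writeReal (by simp) _ _ _)
        (by simp [hs₄, hs₃, hs₂, real_writeReal, RealExpr.eval, h1, hY2])
        (by simp [hs₄, hs₃, hs₂, NatExpr.eval, h2])
        (by simp [hs₄, hs₃, hs₂, real_writeReal, RealExpr.eval, h3])
      refine ⟨s₅, (Runs.loop_pos ?_ (r₁.seq (r₂.seq r₃)) r).mono (by ring_nf; omega), hf', h⟩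
      simp only [Test.Holds, RealExpr.eval, eval_rvar, h1]
      exact hY1
  have r₁ := Runs.setNvar 10 (.const 0) s
  have r₂ := Runs.setRvar 11 (.const 0) (s.writeNat 10 0 0 0)
  obtain ⟨s₁, r₃, hf, h1, h2, h3⟩ := key m 0 (by omega) ((s.writeNat 10 0 0 0).writeReal 11 0 0 0)
    (((Frame.refl _ _ s).writeNat (by simp) _ _ _).writeReal (by simp) _ _ _)
    (by simp [real_writeReal, hs]) (by simp) (by simp)
  have r₄ := Runs.setRvar 10 (.mul (.const 4) (rvar 10)) s₁
  refine ⟨_, (r₁.seq (r₂.seq (r₃.seq r₄))).mono (by ring_nf; omega),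
    hf.writeReal (by simp) _ _ _, ?_, ?_, ?_⟩
  · simp [h2]
  · simp [real_writeReal, h3]
  · simp [RealExpr.eval, h1]

/-- Load a square table of naturals, and a copy of it with real entries, from the advice `γ` into
the arrays numbered `tab`. The advice holds one table for each `m`, preceded by its size; the tables
for `m = 0, …, n` overwrite each other, where `n` is the size of the input. -/
def loader (γ : ℝ) (tab : ℕ) : Program :=
  .seq (setRvar 10 (.const γ)) <|
  forLoop 11 (.add (nvar 0) (.const 1)) <|
    .seq readNat <| .seq (setNvar 14 (nvar 10)) <|
    forLoop 12 (nvar 14) <| forLoop 13 (nvar 14) <|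
      .seq readNat <| .seq (.setNat tab (nvar 12) (nvar 13) (nvar 10))
        (.setReal tab (nvar 12) (nvar 13) (rvar 11))

/-- The arrays for intermediate results. -/
def scratch : Set ℕ := Set.Ico 10 20

/-- The arrays numbered `tab` hold the table `a` of size `D`. -/
def Holds (tab D : ℕ) (a : ℕ → ℕ → ℕ) (s : Store) : Prop :=
  ∀ i < D, ∀ j < D, s.nat tab i j = a i j ∧ s.real tab i j = a i j

/-- Tables of polynomial size with polynomial entries can be loaded in polynomial time. -/
theorem exists_loader (D : ℕ → ℕ) (a : ℕ → ℕ → ℕ → ℕ) {tab : ℕ} (htab : tab ∈ Set.Ico 3 10) :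
    ∃ γ : ℝ, ∀ n d B, (∀ m ≤ n, D m ≤ d) → (∀ m ≤ n, ∀ i < D m, ∀ j < D m, a m i j ≤ B) →
      ∀ s, s.nat 0 0 0 = n → ∃ s',
        Runs ((n + 1) * (6 * d + d * (d * (6 * B + 20) + 20) + 50) + 50) (loader γ tab) s s' ∧
        Frame (insert tab scratch) (insert tab scratch) s s' ∧ Holds tab (D n) (a n) s' := by
  obtain ⟨ht3, ht10⟩ := htab
  obtain ⟨e, he⟩ := exists_concat (fun m => 1 + D m * D m)
    (fun m t => if t = 0 then D m else a m ((t - 1) / D m) ((t - 1) % D m))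
  obtain ⟨X, hX⟩ := exists_stream e
  set S : ℕ → ℕ := fun m => ∑ k ∈ Finset.range m, (1 + D k * D k) with hS
  have S_succ : ∀ m, S (m + 1) = S m + 1 + D m * D m := fun m =>
    (Finset.sum_range_succ _ _).trans (add_assoc _ _ _).symm
  have e_size : ∀ m, e (S m) = D m := fun m => by simpa using he m 0 (by simp)
  have e_entry : ∀ m, ∀ i < D m, ∀ j < D m, e (S m + 1 + (i * D m + j)) = a m i j := by
    intro m i hi j hj
    have hlt : i * D m + j < D m * D m := by nlinarith
    have := he m (1 + (i * D m + j)) (by omega)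
    rw [← add_assoc] at this
    rw [this, if_neg (by omega), Nat.add_sub_cancel_left, Nat.add_comm (i * D m),
      Nat.add_mul_div_right _ _ (by omega), Nat.add_mul_mod_self_right, Nat.div_eq_of_lt hj,
      Nat.mod_eq_of_lt hj, Nat.zero_add]
  refine ⟨X 0, fun n d B hd hB s hs => ?_⟩
  set W : Set ℕ := insert tab scratch with hW
  have hscr : ∀ k, 10 ≤ k → k < 20 → k ∈ W := fun k h1 h2 => Or.inr ⟨h1, h2⟩
  have h0W : (0 : ℕ) ∉ W := by
    simp only [hW, scratch, Set.mem_insert_iff, Set.mem_Ico]; omega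
  have hread : ∀ t s₁, s₁.real 10 0 0 = X t → ∃ s₂, Runs (6 * e t + 7) readNat s₁ s₂ ∧
      Frame {10} {10, 11} s₁ s₂ ∧ s₂.nat 10 0 0 = e t ∧ s₂.real 11 0 0 = e t ∧
      s₂.real 10 0 0 = X (t + 1) := by
    intro t s₁ h
    obtain ⟨Y, hY0, hY1, hY2, hY3⟩ := hX t
    obtain ⟨s₂, r, hf, h1, h2, h3⟩ := readNat_spec hY1 hY2 (h.trans hY0.symm)
    exact ⟨s₂, r, hf, h1, h2, h3.trans hY3.symm⟩
  have hsub : ∀ {s₁ s₂}, Frame {10} {10, 11} s₁ s₂ → Frame W W s₁ s₂ := fun h =>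
    h.mono (by rintro _ rfl; exact hscr _ le_rfl (by norm_num))
      (by rintro _ (rfl | rfl) <;> exact hscr _ (by norm_num) (by norm_num))
  -- `I m p` holds when the first `p` entries of table `m` have been read
  let I : ℕ → ℕ → Store → Prop := fun m p s₁ => Frame W W s s₁ ∧ s₁.nat 11 0 0 = m ∧
    s₁.nat 14 0 0 = D m ∧ s₁.real 10 0 0 = X (S m + 1 + p) ∧
    ∀ i < D m, ∀ j < D m, i * D m + j < p → s₁.nat tab i j = a m i j ∧ s₁.real tab i j = a m i j
  have hI : ∀ {m p s₁} k, I m p s₁ → k = 12 ∨ k = 13 → ∀ x, I m p (s₁.writeNat k 0 0 x) := by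
    rintro m p s₁ k ⟨hf, h1, h2, h3, h4⟩ hk x
    refine ⟨hf.writeNat (hscr _ (by omega) (by omega)) _ _ _, ?_, ?_, h3, ?_⟩
    · rw [nat_writeNat_ne _ _ _ _ (by omega), h1]
    · rw [nat_writeNat_ne _ _ _ _ (by omega), h2]
    · rwa [nat_writeNat_ne _ _ _ _ (by omega)]
  have inner : ∀ m ≤ n, ∀ i < D m, Triple (D m * (6 * B + 7 + 1 + 1 + 1 + 1 + 3) + 3)
      (fun s₁ => I m (i * D m) s₁ ∧ s₁.nat 12 0 0 = i)
      (forLoop 13 (nvar 14) <| .seq readNat <| .seq (.setNat tab (nvar 12) (nvar 13) (nvar 10))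
        (.setReal tab (nvar 12) (nvar 13) (rvar 11)))
      (fun s₁ => I m (i * D m + D m) s₁ ∧ s₁.nat 12 0 0 = i ∧ s₁.nat 13 0 0 = D m) := by
    intro m hm i hi
    refine Triple.forLoop (I := fun j s₁ => I m (i * D m + j) s₁ ∧ s₁.nat 12 0 0 = i ∧
      s₁.nat 13 0 0 = j) ?_ ?_ ?_
    · rintro s₁ ⟨h, h'⟩
      exact ⟨hI 13 h (by simp) 0, by rwa [nat_writeNat_ne _ _ _ _ (by omega)], by simp⟩
    · rintro j s₁ ⟨h, h', h''⟩
      exact ⟨h'', h.2.2.1⟩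
    · rintro j hj s₁ ⟨⟨hf, h1, h2, h3, h4⟩, h', h''⟩
      obtain ⟨s₂, r₁, hf₂, g1, g2, g3⟩ := hread _ _ h3
      rw [e_entry m i hi j hj] at r₁ g1 g2
      have r₂ := Runs.setNat tab (nvar 12) (nvar 13) (nvar 10) s₂
      have e1 : s₂.nat 12 0 0 = i := by rw [hf₂.1 12 (by simp), h']
      have e2 : s₂.nat 13 0 0 = j := by rw [hf₂.1 13 (by simp), h'']
      simp only [eval_nvar, e1, e2, g1] at r₂
      have r₃ := Runs.setReal tab (nvar 12) (nvar 13) (rvar 11) (s₂.writeNat tab i j (a m i j))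
      have n12 : (12 : ℕ) ≠ tab := by omega
      have n13 : (13 : ℕ) ≠ tab := by omega
      simp only [eval_nvar, nat_writeNat_ne _ _ _ _ n12, nat_writeNat_ne _ _ _ _ n13, e1, e2,
        eval_rvar, real_writeNat, g2] at r₃
      have hBm := hB m hm i hi j hj
      refine ⟨_, (r₁.seq (r₂.seq r₃)).mono (by omega), ?_, hI 13 ⟨?_, ?_, ?_, ?_, ?_⟩ (by simp) _,
        ?_, by simp⟩
      · simp only [nat_writeReal, nat_writeNat_ne _ _ _ _ n13, e2]
      · exact ((hf.trans (hsub hf₂)).writeNat (by simp [hW]) _ _ _).writeReal (by simp [hW]) _ _ _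
      · rw [nat_writeReal, nat_writeNat_ne _ _ _ _ (by omega), hf₂.1 11 (by simp), h1]
      · rw [nat_writeReal, nat_writeNat_ne _ _ _ _ (by omega), hf₂.1 14 (by simp), h2]
      · rw [real_writeReal_ne _ _ _ _ (by omega), real_writeNat, g3]
        rfl
      · intro i' hi' j' hj' hlt
        by_cases hij : i' = i ∧ j' = j
        · obtain ⟨rfl, rfl⟩ := hij
          simp
        · have : i' * D m + j' < i * D m + j := by
            refine lt_of_le_of_ne (by omega) fun heq => hij ?_
            have := congrArg (· / D m) heq
            simp only [Nat.add_comm (_ * D m), Nat.add_mul_div_right _ _ (show 0 < D m by omega),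
              Nat.div_eq_of_lt hj, Nat.div_eq_of_lt hj', Nat.zero_add] at this
            subst this
            exact ⟨rfl, by omega⟩
          have h5 := h4 i' hi' j' hj' this
          simp only [nat_writeReal, real_writeReal, real_writeNat, nat_writeNat, true_and, hij,
            if_false]
          rwa [hf₂.1 tab (by simp; omega), hf₂.2 tab (by simp; omega)]
      · simp only [nat_writeReal, nat_writeNat_ne _ _ _ _ (show (12 : ℕ) ≠ 13 by omega),
          nat_writeNat_ne _ _ _ _ n12, e1]
  have mid : ∀ m ≤ n, Triple (D m * ((D m * (6 * B + 7 + 1 + 1 + 1 + 1 + 3) + 3) + 3) + 3)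
      (I m 0)
      (forLoop 12 (nvar 14) <| forLoop 13 (nvar 14) <|
        .seq readNat <| .seq (.setNat tab (nvar 12) (nvar 13) (nvar 10))
        (.setReal tab (nvar 12) (nvar 13) (rvar 11)))
      (fun s₁ => I m (D m * D m) s₁ ∧ s₁.nat 12 0 0 = D m) := by
    intro m hm
    refine Triple.forLoop (I := fun i s₁ => I m (i * D m) s₁ ∧ s₁.nat 12 0 0 = i) ?_ ?_ ?_
    · intro s₁ h
      rw [Nat.zero_mul]
      exact ⟨hI 12 h (by simp) 0, by simp⟩
    · rintro i s₁ ⟨h, h'⟩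
      exact ⟨h', h.2.2.1⟩
    · rintro i hi s₁ h
      obtain ⟨s₂, r, h1, h2, h3⟩ := inner m hm i hi s₁ h
      refine ⟨s₂, r, h2, ?_, by simp⟩
      rw [Nat.succ_mul]
      exact hI 12 h1 (by simp) _
  have r₀ := Runs.setRvar 10 (.const (X 0)) s
  obtain ⟨s', r, hs'⟩ := Triple.forLoop (v := 11) (b := .add (nvar 0) (.const 1)) (m := n + 1)
    (T := 6 * d + d * (d * (6 * B + 20) + 20) + 20)
    (P := .seq readNat <| .seq (setNvar 14 (nvar 10)) <|
      forLoop 12 (nvar 14) <| forLoop 13 (nvar 14) <|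
      .seq readNat <| .seq (.setNat tab (nvar 12) (nvar 13) (nvar 10))
        (.setReal tab (nvar 12) (nvar 13) (rvar 11)))
    (I₀ := fun s₁ => s₁ = s.writeReal 10 0 0 (X 0))
    (I := fun m s₁ => Frame W W s s₁ ∧ s₁.nat 11 0 0 = m ∧ s₁.real 10 0 0 = X (S m) ∧
      ∀ m', m = m' + 1 → Holds tab (D m') (a m') s₁)
    (by
      rintro s₁ rfl
      refine ⟨((Frame.refl _ _ s).writeReal (hscr _ ?_ ?_) _ _ _).writeNat (hscr _ ?_ ?_) _ _ _,
        by simp, by simp [hS], by simp⟩ <;> norm_num)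
    (by
      rintro m s₁ ⟨hf, h1, -, -⟩
      exact ⟨h1, by simp [NatExpr.eval, hf.1 0 h0W, hs]⟩)
    (by
      rintro m hm s₁ ⟨hf, h1, h2, -⟩
      have hm' : m ≤ n := by omega
      obtain ⟨s₂, r₁, hf₂, g1, g2, g3⟩ := hread _ _ h2
      rw [e_size] at r₁ g1
      have r₂ := Runs.setNvar 14 (nvar 10) s₂
      rw [eval_nvar, g1] at r₂
      obtain ⟨s₃, r₃, ⟨hf₃, k1, k2, k3, k4⟩, -⟩ := mid m hm' (s₂.writeNat 14 0 0 (D m))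
        ⟨(hf.trans (hsub hf₂)).writeNat (hscr _ (by norm_num) (by norm_num)) _ _ _, by
          rw [nat_writeNat_ne _ _ _ _ (by omega), hf₂.1 11 (by simp), h1], by simp, by
          rw [real_writeNat, g3], by simp⟩
      have hd' := hd m hm'
      refine ⟨s₃, (r₁.seq (r₂.seq r₃)).mono ?_, k1,
        hf₃.writeNat (hscr _ (by norm_num) (by norm_num)) _ _ _, by simp, ?_, ?_⟩
      · have h1 : D m * (6 * B + 7 + 1 + 1 + 1 + 1 + 3) ≤ d * (6 * B + 20) :=
          Nat.mul_le_mul hd' (by omega)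
        have h2 : D m * ((D m * (6 * B + 7 + 1 + 1 + 1 + 1 + 3) + 3) + 3) ≤
          d * (d * (6 * B + 20) + 20) := Nat.mul_le_mul hd' (by omega)
        omega
      · rw [real_writeNat, k3, S_succ]
      · rintro m' hmm
        obtain rfl : m = m' := by omega
        intro i hi j hj
        rw [nat_writeNat_ne _ _ _ _ (by omega), real_writeNat]
        exact k4 i hi j hj (by nlinarith))
    _ rfl
  refine ⟨s', (r₀.seq r).mono ?_, hs'.1, hs'.2.2.2 n rfl⟩
  ring_nf
  omega

/-! ### Copies of a machine inside the memory of another one -/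

/-- The array that plays the part of array `a` in the `j`-th copy. -/
def sh (j a : ℕ) : ℕ := 20 + 3 * a + j

/-- Natural-number expressions over the arrays of the `j`-th copy. -/
def NatExpr.ren (j : ℕ) : NatExpr → NatExpr
  | const k => const k
  | cell a i k => cell (sh j a) (i.ren j) (k.ren j)
  | add x y => add (x.ren j) (y.ren j)
  | sub x y => sub (x.ren j) (y.ren j)

/-- Real expressions over the arrays of the `j`-th copy. -/
def RealExpr.ren (j : ℕ) : RealExpr → RealExpr
  | const c => const c
  | cell a i k => cell (sh j a) (i.ren j) (k.ren j)
  | add x y => add (x.ren j) (y.ren j)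
  | sub x y => sub (x.ren j) (y.ren j)
  | mul x y => mul (x.ren j) (y.ren j)
  | div x y => div (x.ren j) (y.ren j)

/-- Comparisons over the arrays of the `j`-th copy. -/
def Test.ren (j : ℕ) : Test → Test
  | natLt x y => natLt (x.ren j) (y.ren j)
  | realLt x y => realLt (x.ren j) (y.ren j)

/-- The memory of the `j`-th copy. -/
def dec (j : ℕ) (S : Store) : Store where
  nat a := S.nat (sh j a)
  real a := S.real (sh j a)

theorem NatExpr.eval_ren (j : ℕ) (S : Store) (x : NatExpr) :
    (x.ren j).eval S = x.eval (dec j S) := by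
  induction x with
  | const k => rfl
  | cell a i k hi hk => simp [ren, eval, hi, hk, dec]
  | add x y hx hy => simp [ren, eval, hx, hy]
  | sub x y hx hy => simp [ren, eval, hx, hy]

theorem RealExpr.eval_ren (j : ℕ) (S : Store) (x : RealExpr) :
    (x.ren j).eval S = x.eval (dec j S) := by
  induction x with
  | const k => rfl
  | cell a i k => simp [ren, eval, NatExpr.eval_ren, dec]
  | add x y hx hy => simp [ren, eval, hx, hy]
  | sub x y hx hy => simp [ren, eval, hx, hy]
  | mul x y hx hy => simp [ren, eval, hx, hy]
  | div x y hx hy => simp [ren, eval, hx, hy]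

theorem Test.holds_ren (j : ℕ) (S : Store) (b : Test) :
    (b.ren j).Holds S ↔ b.Holds (dec j S) := by
  cases b <;> simp [ren, Holds, NatExpr.eval_ren, RealExpr.eval_ren]

theorem sh_inj {j a b : ℕ} : sh j a = sh j b ↔ a = b := by simp [sh]

theorem dec_writeNat (j : ℕ) (S : Store) (a i k x : ℕ) :
    dec j (S.writeNat (sh j a) i k x) = (dec j S).writeNat a i k x := by
  simp [dec, Store.writeNat, sh_inj]

theorem dec_writeReal (j : ℕ) (S : Store) (a i k : ℕ) (x : ℝ) :
    dec j (S.writeReal (sh j a) i k x) = (dec j S).writeReal a i k x := by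
  simp [dec, Store.writeReal, sh_inj]

theorem dec_eq_of_frame {U V : Set ℕ} {S S' : Store} (h : Frame U V S S') {j : ℕ}
    (hU : ∀ a, sh j a ∉ U) (hV : ∀ a, sh j a ∉ V) : dec j S' = dec j S := by
  simp only [dec, Store.mk.injEq]
  exact ⟨funext fun a => h.1 _ (hU a), funext fun a => h.2 _ (hV a)⟩

theorem dec_writeNat_of_lt (j : ℕ) (S : Store) {a : ℕ} (ha : a < 20) (i k x : ℕ) :
    dec j (S.writeNat a i k x) = dec j S :=
  dec_eq_of_frame ((Frame.refl {a} ∅ S).writeNat rfl i k x)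
    (fun b hb => by simp [sh] at hb; omega) (fun b hb => hb)

/-! ### Control flow by a program counter -/

/-- The control states that can follow a control state. -/
def succs : List Program → List (List Program)
  | [] => [[]]
  | .seq P Q :: k => [P :: Q :: k]
  | .ite _ P Q :: k => [P :: k, Q :: k]
  | .loop b P :: k => [P :: .loop b P :: k, k]
  | _ :: k => [k]

/-- The control states that are met while `P` is executed in front of `k`. -/
def reach : Program → List Program → List (List Program)
  | .seq P Q, k => (.seq P Q :: k) :: (reach P (Q :: k) ++ reach Q k)
  | .ite b P Q, k => (.ite b P Q :: k) :: (reach P k ++ reach Q k)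
  | .loop b P, k => (.loop b P :: k) :: reach P (.loop b P :: k)
  | P, k => [P :: k]

theorem mem_reach (P : Program) (k : List Program) : P :: k ∈ reach P k := by
  cases P <;> simp [reach]

theorem reach_closed (P : Program) (k : List Program) :
    ∀ x ∈ reach P k, ∀ y ∈ succs x, y ∈ reach P k ∨ y = k := by
  induction P generalizing k with
  | seq P Q hP hQ =>
    intro x hx y hy
    simp only [reach, List.mem_cons, List.mem_append] at hx ⊢
    rcases hx with rfl | hx | hx
    · simp only [succs, List.mem_singleton] at hy
      subst hy
      exact Or.inl (Or.inr (Or.inl (mem_reach _ _)))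
    · rcases hP _ x hx y hy with h | rfl
      · exact Or.inl (Or.inr (Or.inl h))
      · exact Or.inl (Or.inr (Or.inr (mem_reach _ _)))
    · rcases hQ _ x hx y hy with h | rfl
      · exact Or.inl (Or.inr (Or.inr h))
      · exact Or.inr rfl
  | ite b P Q hP hQ =>
    intro x hx y hy
    simp only [reach, List.mem_cons, List.mem_append] at hx ⊢
    rcases hx with rfl | hx | hx
    · simp only [succs, List.mem_cons, List.not_mem_nil, or_false] at hy
      rcases hy with rfl | rfl
      · exact Or.inl (Or.inr (Or.inl (mem_reach _ _)))
      · exact Or.inl (Or.inr (Or.inr (mem_reach _ _)))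
    · rcases hP _ x hx y hy with h | rfl
      · exact Or.inl (Or.inr (Or.inl h))
      · exact Or.inr rfl
    · rcases hQ _ x hx y hy with h | rfl
      · exact Or.inl (Or.inr (Or.inr h))
      · exact Or.inr rfl
  | loop b P hP =>
    intro x hx y hy
    simp only [reach, List.mem_cons] at hx ⊢
    rcases hx with rfl | hx
    · simp only [succs, List.mem_cons, List.not_mem_nil, or_false] at hy
      rcases hy with rfl | rfl
      · exact Or.inl (Or.inr (mem_reach _ _))
      · exact Or.inr rfl
    · rcases hP _ x hx y hy with h | rfl
      · exact Or.inl (Or.inr h)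
      · exact Or.inl (Or.inl rfl)
  | setNat | setReal | coin | sample =>
    intro x hx y hy
    simp only [reach, List.mem_singleton] at hx
    subst hx
    simp only [succs, List.mem_singleton] at hy
    exact Or.inr hy

/-- All control states of an execution of `P`. -/
def states (P : Program) : List (List Program) := [] :: reach P []

theorem states_closed (P : Program) : ∀ x ∈ states P, ∀ y ∈ succs x, y ∈ states P := by
  intro x hx y hy
  simp only [states, List.mem_cons] at hx ⊢
  rcases hx with rfl | hx
  · simp only [succs, List.mem_singleton] at hy
    exact Or.inl hy
  · exact (reach_closed P [] x hx y hy).symm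

open Classical in
/-- Set the program counter to control state `k`. -/
def goto (l : List (List Program)) (k : List Program) : Program :=
  setNvar 10 (.const (l.idxOf k))

/-- The entry `(i, k)` of the table of rows. -/
def rowEntry (i k : ℕ) : NatExpr := .cell 6 (.const i) (.const k)

/-- Draw a sample and write the configuration that is constant on blocks into row `i` of the
`a`-th array of the `j`-th copy. The table of rows holds the block of every vertex in row `0` and
the number of vertices in cell `(2, 0)`. The index is evaluated first, since it may refer to cells
that are about to change. -/
def drawBlockwise (j a : ℕ) (i : NatExpr) : Program :=
  .seq (setNvar 12 (i.ren j)) <| .seq (.sample 14 (.const 0)) <|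
  forLoop 13 (rowEntry 2 0) <|
    .setNat (sh j a) (nvar 12) (nvar 13)
      (.cell 14 (.const 0) (.cell 6 (.const 0) (nvar 13)))

/-- One step of the `j`-th copy in control state `k`. -/
def stepCode (l : List (List Program)) (j : ℕ) : List Program → Program
  | [] => goto l []
  | .setNat a i i' x :: k => .seq (.setNat (sh j a) (i.ren j) (i'.ren j) (x.ren j)) (goto l k)
  | .setReal a i i' x :: k => .seq (.setReal (sh j a) (i.ren j) (i'.ren j) (x.ren j)) (goto l k)
  | .coin a i i' :: k => .seq (.coin (sh j a) (i.ren j) (i'.ren j)) (goto l k)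
  | .sample a i :: k => .seq (drawBlockwise j a i) (goto l k)
  | .seq P Q :: k => goto l (P :: Q :: k)
  | .ite b P Q :: k => .ite (b.ren j) (goto l (P :: k)) (goto l (Q :: k))
  | .loop b P :: k => .ite (b.ren j) (goto l (P :: .loop b P :: k)) (goto l k)

/-- Execute the program of the list `codes` whose number is in the program counter, where the
programs are numbered from `m` on. -/
def dispatch : List Program → ℕ → Program
  | [], _ => setNvar 10 (.const 0)
  | P :: codes, m => .ite (.natLt (nvar 10) (.const (m + 1))) P (dispatch codes (m + 1))

section

variable {n q : ℕ} (μ : PMF (Fin n → Fin q)) (A : Set Store)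

theorem haltProb_seq (t : ℕ) (P Q : Program) (K : List Program) (s : Store) :
    haltProb μ A (t + 1) ⟨.seq P Q :: K, s⟩ = haltProb μ A t ⟨P :: Q :: K, s⟩ :=
  expect_pure _ _

theorem haltProb_ite_pos {b : Test} {s : Store} (hb : b.Holds s) (t : ℕ) (P Q : Program)
    (K : List Program) :
    haltProb μ A (t + 1) ⟨.ite b P Q :: K, s⟩ = haltProb μ A t ⟨P :: K, s⟩ := by
  refine Eq.trans ?_ (expect_pure (⟨P :: K, s⟩ : Config) (haltProb μ A t))
  simp [haltProb, iter, step, hb]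

theorem haltProb_ite_neg {b : Test} {s : Store} (hb : ¬ b.Holds s) (t : ℕ) (P Q : Program)
    (K : List Program) :
    haltProb μ A (t + 1) ⟨.ite b P Q :: K, s⟩ = haltProb μ A t ⟨Q :: K, s⟩ := by
  refine Eq.trans ?_ (expect_pure (⟨Q :: K, s⟩ : Config) (haltProb μ A t))
  simp [haltProb, iter, step, hb]

theorem haltProb_loop_pos {b : Test} {s : Store} (hb : b.Holds s) (t : ℕ) (P : Program)
    (K : List Program) :
    haltProb μ A (t + 1) ⟨.loop b P :: K, s⟩ = haltProb μ A t ⟨P :: .loop b P :: K, s⟩ := by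
  refine Eq.trans ?_ (expect_pure (⟨P :: .loop b P :: K, s⟩ : Config) (haltProb μ A t))
  simp [haltProb, iter, step, hb]

theorem haltProb_dispatch (codes : List Program) (m i : ℕ) (hi : i < codes.length) (t : ℕ)
    (K : List Program) (s : Store) (hs : s.nat 10 0 0 = m + i) :
    haltProb μ A t ⟨codes[i] :: K, s⟩ ≤
      haltProb μ A (t + codes.length) ⟨dispatch codes m :: K, s⟩ := by
  induction codes generalizing m i with
  | nil => simp at hi
  | cons P codes ih =>
    rw [List.length_cons, ← add_assoc, dispatch]
    cases i with
    | zero =>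
      rw [haltProb_ite_pos _ _ (by simp [Test.Holds, NatExpr.eval, hs])]
      exact haltProb_mono _ _ (by omega) _
    | succ i =>
      rw [haltProb_ite_neg _ _ (by simp [Test.Holds, NatExpr.eval, hs])]
      exact ih (m + 1) i (by simpa using hi) (by omega)

end

/-- What a copy may change. -/
def copyNat (j : ℕ) : Set ℕ := scratch ∪ Set.range (sh j)

theorem sh_mem_copyNat (j a : ℕ) : sh j a ∈ copyNat j := Or.inr ⟨a, rfl⟩

theorem mem_copyNat {j a : ℕ} (h : 10 ≤ a) (h' : a < 20) : a ∈ copyNat j := Or.inl ⟨h, h'⟩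

theorem notMem_copyNat {j a : ℕ} (h : a < 10) : a ∉ copyNat j := by
  rintro (h' | ⟨b, rfl⟩)
  · exact absurd h'.1 (by omega)
  · simp only [sh] at h; omega

/-- What one step of a copy may change: everything except for the clock. -/
def stepNat (j : ℕ) : Set ℕ := copyNat j \ {11}

theorem sh_mem_stepNat (j a : ℕ) : sh j a ∈ stepNat j :=
  ⟨sh_mem_copyNat j a, by simp [sh]; omega⟩

theorem drawBlockwise_spec {n q N : ℕ} (μ : PMF (Fin n → Fin q)) (A : Set Store)
    (u : Fin N → Fin n) (j a : ℕ) (i : NatExpr) (S : Store)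
    (hN : S.nat 6 2 0 = N) (hu : ∀ x : Fin N, S.nat 6 0 x = u x)
    (F : (Fin n → Fin q) → ℝ≥0∞) (K : List Program) (t : ℕ)
    (hF : ∀ σ S', Frame (stepNat j) (Set.range (sh j)) S S' →
      dec j S' = (dec j S).writeSpins a (i.eval (dec j S)) (fun x => σ (u x)) →
      F σ ≤ haltProb μ A t ⟨K, S'⟩) :
    expect μ F ≤ haltProb μ A (t + (4 * N + 10)) ⟨drawBlockwise j a i :: K, S⟩ := by
  set row := i.eval (dec j S) with hrow
  have r₁ := Runs.setNvar 12 (i.ren j) S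
  rw [NatExpr.eval_ren, ← hrow] at r₁
  set S₁ := S.writeNat 12 0 0 row with hS₁
  rw [drawBlockwise, show t + (4 * N + 10) = t + (4 * N + 3) + 1 + 1 + 4 + 1 by ring, haltProb_seq]
  refine le_trans ?_ (haltProb_mono μ A (show t + (4 * N + 3) + 1 + 1 + 1 ≤ _ by omega) _)
  refine le_trans ?_ (r₁ _ _ μ A _ _)
  rw [haltProb_seq, haltProb_sample]
  refine expect_mono _ fun σ => ?_
  simp only [NatExpr.eval]
  have hm : ∀ k, 10 ≤ k → k < 20 → k ≠ 11 → k ∈ stepNat j := fun k h1 h2 h3 =>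
    ⟨mem_copyNat h1 h2, h3⟩
  have h6 : (6 : ℕ) ∉ stepNat j := fun h => notMem_copyNat (by norm_num) h.1
  set S₂ := S₁.writeSpins 14 0 σ with hS₂
  have hf₂ : Frame (stepNat j) (Set.range (sh j)) S S₂ :=
    ((Frame.refl _ _ S).writeNat (hm 12 (by norm_num) (by norm_num) (by norm_num)) _ _ _).writeSpins
      (hm 14 (by norm_num) (by norm_num) (by norm_num)) _ _
  have hd₂ : dec j S₂ = dec j S :=
    (dec_eq_of_frame ((Frame.refl {14} ∅ S₁).writeSpins rfl 0 σ)
      (fun b hb => by simp [sh] at hb; omega) (fun b hb => hb)).trans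
      (dec_writeNat_of_lt _ _ (by norm_num) _ _ _)
  obtain ⟨S', r, hS', -, -, -, hd⟩ := Triple.forLoop (v := 13) (b := rowEntry 2 0) (m := N) (T := 1)
    (P := .setNat (sh j a) (nvar 12) (nvar 13)
      (.cell 14 (.const 0) (.cell 6 (.const 0) (nvar 13))))
    (I₀ := fun s => s = S₂)
    (I := fun x s => Frame (stepNat j) (Set.range (sh j)) S s ∧ s.nat 13 0 0 = x ∧
      s.nat 12 0 0 = row ∧ s.nat 14 = S₂.nat 14 ∧
      dec j s = ⟨fun a' i' k => if a' = a ∧ i' = row ∧ k < x then S₂.nat 14 0 (S.nat 6 0 k)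
        else (dec j S).nat a' i' k, (dec j S).real⟩)
    (by
      rintro s rfl
      refine ⟨hf₂.writeNat (hm 13 (by norm_num) (by norm_num) (by norm_num)) _ _ _, by simp, ?_, ?_,
        ?_⟩
      · rw [nat_writeNat_ne _ _ _ _ (by norm_num), hS₂, nat_writeSpins_ne _ _ _ (by norm_num), hS₁]
        simp
      · rw [nat_writeNat_ne _ _ _ _ (by norm_num)]
      · rw [dec_writeNat_of_lt _ _ (by norm_num), hd₂]
        simp)
    (by
      rintro x s ⟨hf, h1, -⟩
      exact ⟨h1, by simp only [rowEntry, NatExpr.eval, hf.1 6 h6, hN]⟩)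
    (by
      rintro x hx s ⟨hf, h1, h2, h3, h4⟩
      refine ⟨_, Runs.setNat _ _ _ _ s, ?_, ?_⟩
      · rw [nat_writeNat_ne _ _ _ _ (by simp [sh]; omega), h1]
      · simp only [NatExpr.eval, eval_nvar, h1, h2, hf.1 6 h6, h3]
        refine ⟨(hf.writeNat (sh_mem_stepNat j a) _ _ _).writeNat
          (hm 13 (by norm_num) (by norm_num) (by norm_num)) _ _ _, by simp, ?_, ?_, ?_⟩
        · rw [nat_writeNat_ne _ _ _ _ (by norm_num), nat_writeNat_ne _ _ _ _ (by simp [sh]; omega),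
            h2]
        · rw [nat_writeNat_ne _ _ _ _ (by norm_num), nat_writeNat_ne _ _ _ _ (by simp [sh]; omega),
            h3]
        · rw [dec_writeNat_of_lt _ _ (by norm_num), dec_writeNat, h4]
          simp only [Store.writeNat, Store.mk.injEq, and_true]
          funext a' i' k
          by_cases hai : a' = a ∧ i' = row
          · obtain ⟨rfl, rfl⟩ := hai
            by_cases hk : k = x
            · simp [hk]
            · simp [hk, show k < x + 1 ↔ k < x by omega]
          · have h5 : ∀ p : Prop, ¬ (a' = a ∧ i' = row ∧ p) := fun p hp => hai ⟨hp.1, hp.2.1⟩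
            simp only [h5, if_false])
    S₂ rfl
  refine (hF σ S' hS' ?_).trans ((r _ _ μ A K t).trans (haltProb_mono μ A (by omega) _))
  rw [hd]
  simp only [Store.writeSpins, Store.mk.injEq, and_true]
  funext a' i' k
  by_cases h : a' = a ∧ i' = row ∧ k < N
  · obtain ⟨rfl, rfl, hk⟩ := h
    simp only [hk, and_self, if_true, dif_pos, hS₂, nat_writeSpins, hu ⟨k, hk⟩, Fin.is_lt,
      Fin.eta]
  · simp only [h, if_false, dif_neg, not_false_eq_true]

/-- One step of a copy simulates exactly one step of the copied machine, with access to blockwise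
constant samples. -/
theorem stepCode_spec {n q N : ℕ} (μ : PMF (Fin n → Fin q)) (A : Set Store)
    (u : Fin N → Fin n) (l : List (List Program)) (j : ℕ) (S : Store)
    (hN : S.nat 6 2 0 = N) (hu : ∀ x : Fin N, S.nat 6 0 x = u x)
    (k : List Program) (F : Config → ℝ≥0∞) (K : List Program) (t : ℕ)
    (hF : ∀ c S', c.todo ∈ succs k → Frame (stepNat j) (Set.range (sh j)) S S' →
      dec j S' = c.store → (open Classical in S'.nat 10 0 0 = l.idxOf c.todo) →
      F c ≤ haltProb μ A t ⟨K, S'⟩) :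
    expect (step (μ.map fun σ x => σ (u x)) ⟨k, dec j S⟩) F ≤
      haltProb μ A (t + (4 * N + 20)) ⟨stepCode l j k :: K, S⟩ := by
  classical
  have h10 : (10 : ℕ) ∈ stepNat j := ⟨mem_copyNat le_rfl (by norm_num), by simp⟩
  have hgoto : ∀ k' ∈ succs k, ∀ S₁, Frame (stepNat j) (Set.range (sh j)) S S₁ →
      F ⟨k', dec j S₁⟩ ≤ haltProb μ A (t + 1) ⟨goto l k' :: K, S₁⟩ := by
    intro k' hk' S₁ hf
    refine (hF ⟨k', dec j S₁⟩ (S₁.writeNat 10 0 0 (l.idxOf k')) hk' (hf.writeNat h10 _ _ _)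
      (dec_writeNat_of_lt _ _ (by norm_num) _ _ _) ?_).trans (Runs.setNvar 10 _ S₁ _ _ μ A K t)
    simp only [nat_writeNat_self]
  have hrefl := Frame.refl (stepNat j) (Set.range (sh j)) S
  rcases k with _ | ⟨P, k⟩
  · rw [step, expect_pure, stepCode]
    exact (hgoto [] (by simp [succs]) S hrefl).trans (haltProb_mono _ _ (by omega) _)
  cases P with
  | setNat a i i' x =>
    rw [step, expect_pure, stepCode, show t + (4 * N + 20) = t + (4 * N + 19) + 1 by ring,
      haltProb_seq]
    have := hgoto k (by simp [succs]) _ (hrefl.writeNat (sh_mem_stepNat j a) ((i.ren j).eval S)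
      ((i'.ren j).eval S) ((x.ren j).eval S))
    rw [dec_writeNat] at this
    simp only [NatExpr.eval_ren] at this
    refine this.trans (le_trans ?_ (haltProb_mono _ _ (show t + 1 + 1 ≤ _ by omega) _))
    have := Runs.setNat (sh j a) (i.ren j) (i'.ren j) (x.ren j) S _ _ μ A (goto l k :: K) (t + 1)
    simpa only [NatExpr.eval_ren] using this
  | setReal a i i' x =>
    rw [step, expect_pure, stepCode, show t + (4 * N + 20) = t + (4 * N + 19) + 1 by ring,
      haltProb_seq]
    have := hgoto k (by simp [succs]) _ (hrefl.writeReal (Set.mem_range_self a) ((i.ren j).eval S)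
      ((i'.ren j).eval S) ((x.ren j).eval S))
    rw [dec_writeReal] at this
    simp only [NatExpr.eval_ren, RealExpr.eval_ren] at this
    refine this.trans (le_trans ?_ (haltProb_mono _ _ (show t + 1 + 1 ≤ _ by omega) _))
    have := Runs.setReal (sh j a) (i.ren j) (i'.ren j) (x.ren j) S _ _ μ A (goto l k :: K) (t + 1)
    simpa only [NatExpr.eval_ren, RealExpr.eval_ren] using this
  | coin a i i' =>
    rw [step, expect_map, stepCode, show t + (4 * N + 20) = t + (4 * N + 18) + 1 + 1 by ring,
      haltProb_seq, haltProb_coin]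
    refine expect_mono _ fun b => ?_
    have := hgoto k (by simp [succs]) _ (hrefl.writeNat (sh_mem_stepNat j a) ((i.ren j).eval S)
      ((i'.ren j).eval S) b.toNat)
    rw [dec_writeNat] at this
    simp only [NatExpr.eval_ren] at this ⊢
    exact this.trans (haltProb_mono _ _ (by omega) _)
  | sample a i =>
    rw [step, expect_map, expect_map, stepCode,
      show t + (4 * N + 20) = t + (4 * N + 19) + 1 by ring, haltProb_seq]
    refine le_trans (drawBlockwise_spec μ A u j a i S hN hu _ _ (t + 1) ?_)
      (haltProb_mono _ _ (by omega) _)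
    intro σ S' hf hd
    rw [← hd]
    exact hgoto k (by simp [succs]) S' hf
  | seq P Q =>
    rw [step, expect_pure, stepCode]
    exact (hgoto _ (by simp [succs]) S hrefl).trans (haltProb_mono _ _ (by omega) _)
  | ite b P Q =>
    rw [step, expect_pure, stepCode, show t + (4 * N + 20) = t + (4 * N + 19) + 1 by ring]
    by_cases hb : b.Holds (dec j S)
    · rw [if_pos hb, haltProb_ite_pos _ _ ((Test.holds_ren _ _ _).2 hb)]
      exact (hgoto _ (by simp [succs]) S hrefl).trans (haltProb_mono _ _ (by omega) _)
    · rw [if_neg hb, haltProb_ite_neg _ _ (fun h => hb ((Test.holds_ren _ _ _).1 h))]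
      exact (hgoto _ (by simp [succs]) S hrefl).trans (haltProb_mono _ _ (by omega) _)
  | loop b P =>
    rw [step, expect_pure, stepCode, show t + (4 * N + 20) = t + (4 * N + 19) + 1 by ring]
    by_cases hb : b.Holds (dec j S)
    · rw [if_pos hb, haltProb_ite_pos _ _ ((Test.holds_ren _ _ _).2 hb)]
      exact (hgoto _ (by simp [succs]) S hrefl).trans (haltProb_mono _ _ (by omega) _)
    · rw [if_neg hb, haltProb_ite_neg _ _ (fun h => hb ((Test.holds_ren _ _ _).1 h))]
      exact (hgoto _ (by simp [succs]) S hrefl).trans (haltProb_mono _ _ (by omega) _)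

/-- A round of the simulation. -/
def stepAll (P : Program) (j : ℕ) : Program :=
  dispatch ((states P).map (stepCode (states P) j)) 0

/-- As many rounds as cell `(2, 4)` of the table of rows says. -/
def simulation (P : Program) (j : ℕ) : Program :=
  .loop (.natLt (nvar 11) (rowEntry 2 4)) <|
    .seq (stepAll P j) (setNvar 11 (.add (nvar 11) (.const 1)))

/-- The rounds that are left simulate the same number of steps of the copied machine. -/
theorem simulation_spec {n q N T : ℕ} (μ : PMF (Fin n → Fin q)) (A : Set Store)
    (u : Fin N → Fin n) (P : Program) (j : ℕ) (S₀ : Store)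
    (hN : S₀.nat 6 2 0 = N) (hT : S₀.nat 6 2 4 = T) (hu : ∀ x : Fin N, S₀.nat 6 0 x = u x)
    (G : Config → ℝ≥0∞) (K : List Program) (t : ℕ)
    (hG : ∀ c S', Frame (copyNat j) (Set.range (sh j)) S₀ S' → dec j S' = c.store →
      G c ≤ haltProb μ A t ⟨K, S'⟩) (r : ℕ) :
    ∀ c S, c.todo ∈ states P → Frame (copyNat j) (Set.range (sh j)) S₀ S → dec j S = c.store →
      (open Classical in S.nat 10 0 0 = (states P).idxOf c.todo) → S.nat 11 0 0 + r = T →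
      iter (μ.map fun σ x => σ (u x)) G r c ≤
        haltProb μ A (t + r * (4 * N + 30 + (states P).length) + 1) ⟨simulation P j :: K, S⟩ := by
  classical
  have h6 : (6 : ℕ) ∉ copyNat j := notMem_copyNat (by norm_num)
  induction r with
  | zero =>
    intro c S hc hf hd hpc hr
    refine (hG c S hf hd).trans ?_
    rw [Nat.zero_mul]
    refine Runs.loop_neg ?_ _ _ μ A K t
    simp only [Test.Holds, rowEntry, NatExpr.eval, eval_nvar, hf.1 6 h6, hT]
    omega
  | succ r ih =>
    intro c S hc hf hd hpc hr
    set X := 4 * N + 30 + (states P).length with hX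
    rw [show t + (r + 1) * X + 1 = t + r * X + 1 + 1 + (4 * N + 20) + (states P).length + 7 + 1 + 1
      by rw [Nat.succ_mul]; omega]
    rw [simulation, haltProb_loop_pos, haltProb_seq]
    swap
    · simp only [Test.Holds, rowEntry, NatExpr.eval, eval_nvar, hf.1 6 h6, hT]
      omega
    refine le_trans ?_ (haltProb_mono _ _ (Nat.le_add_right _ 7) _)
    have hi : (states P).idxOf c.todo < (states P).length := List.idxOf_lt_length_iff.2 hc
    have := haltProb_dispatch μ A ((states P).map (stepCode (states P) j)) 0
      ((states P).idxOf c.todo) (by simpa using hi) (t + r * X + 1 + 1 + (4 * N + 20))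
      (setNvar 11 (.add (nvar 11) (.const 1)) :: simulation P j :: K) S
      (by rw [hpc, Nat.zero_add])
    simp only [List.length_map, List.getElem_map, List.getElem_idxOf] at this
    refine le_trans ?_ this
    have hc' : c = ⟨c.todo, dec j S⟩ := by rw [hd]
    rw [iter, hc']
    refine stepCode_spec μ A u (states P) j S (by rw [hf.1 6 h6, hN])
      (fun x => by rw [hf.1 6 h6, hu]) _ _ _ _ fun c' S' hc' hf' hd' hpc' => ?_
    have e11 : S'.nat 11 = S.nat 11 := hf'.1 11 (by simp [stepNat])
    refine le_trans ?_ (Runs.setNvar 11 _ S' _ _ μ A _ _)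
    refine ih c' _ (states_closed P _ hc _ hc')
      ((hf.trans (hf'.mono Set.sdiff_subset subset_rfl)).writeNat
        (mem_copyNat (by norm_num) (by norm_num)) _ _ _) ?_ ?_ ?_
    · rw [dec_writeNat_of_lt _ _ (by norm_num), hd']
    · rw [nat_writeNat_ne _ _ _ _ (by norm_num), hpc']
    · simp only [nat_writeNat_self, NatExpr.eval, eval_nvar, e11]
      omega

/-! ### Writing down the input of a copy -/

/-- What a program has to know in order to run another program on a blown-up model: the number
`size` of vertices, which pairs of them are joined inside a block (`inner`, with values `0` and
`1`), which pairs are joined across blocks, and for which blocks (`left` and `right`, with value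
`0` for all other pairs), the block of each vertex, which vertices carry a field (`flag`, with
values `0` and `1`), the `width` by which weights are divided, the `strength` of a block, the
number `spread` of vertices of a block that carry a field, and the number `time` of steps to be
simulated. -/
structure Advice where
  size : ℕ
  inner : ℕ → ℕ → ℕ
  left : ℕ → ℕ → ℕ
  right : ℕ → ℕ → ℕ
  block : ℕ → ℕ
  flag : ℕ → ℕ
  width : ℕ
  strength : ℕ
  spread : ℕ
  time : ℕ

/-- The one-dimensional data and the scalars of the advice, as one table. -/
def Advice.rows (a : Advice) (i k : ℕ) : ℕ :=
  if i = 0 then a.block k else if i = 1 then a.flag k else if i = 2 then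
    if k = 0 then a.size else if k = 1 then a.width else if k = 2 then a.strength
    else if k = 3 then a.spread else if k = 4 then a.time else 0
  else 0

/-- The memory that holds the blown-up model, if `s` holds the original model. -/
def Advice.expand (a : Advice) (s : Store) : Store where
  nat b i k :=
    if b = 0 ∧ i = 0 ∧ k = 0 then a.size
    else if b = 1 ∧ i < a.size ∧ k < a.size then
      a.inner i k + s.nat 1 (a.left i k) (a.right i k)
    else 0
  real b i k :=
    if b = 0 ∧ i < a.size ∧ k < a.size then
      a.inner i k * a.strength / a.width + s.real 0 (a.left i k) (a.right i k) / a.width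
    else if b = 1 ∧ i < a.size ∧ k < a.size then
      a.flag i * s.real 1 (a.block i) k / a.spread
    else 0

/-- The memory `S` holds the advice `a` and the model held by `s₀`. -/
structure Ready (a : Advice) (s₀ S : Store) : Prop where
  inner : Holds 3 a.size a.inner S
  left : Holds 4 a.size a.left S
  right : Holds 5 a.size a.right S
  rows : Holds 6 a.size a.rows S
  adj : S.nat 1 = s₀.nat 1
  weight : S.real 0 = s₀.real 0
  field : S.real 1 = s₀.real 1

theorem Holds.frame {tab D : ℕ} {b : ℕ → ℕ → ℕ} {S S' : Store} {U V : Set ℕ}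
    (h : Holds tab D b S) (hf : Frame U V S S') (hU : tab ∉ U) (hV : tab ∉ V) :
    Holds tab D b S' := by
  intro i hi k hk
  rw [hf.1 tab hU, hf.2 tab hV]
  exact h i hi k hk

theorem Ready.frame {a : Advice} {s₀ S S' : Store} {U V : Set ℕ} (h : Ready a s₀ S)
    (hf : Frame U V S S') (hU : ∀ b < 7, b ∉ U) (hV : ∀ b < 7, b ∉ V) : Ready a s₀ S' where
  inner := h.inner.frame hf (hU _ (by norm_num)) (hV _ (by norm_num))
  left := h.left.frame hf (hU _ (by norm_num)) (hV _ (by norm_num))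
  right := h.right.frame hf (hU _ (by norm_num)) (hV _ (by norm_num))
  rows := h.rows.frame hf (hU _ (by norm_num)) (hV _ (by norm_num))
  adj := (hf.1 1 (hU _ (by norm_num))).trans h.adj
  weight := (hf.2 0 (hV _ (by norm_num))).trans h.weight
  field := (hf.2 1 (hV _ (by norm_num))).trans h.field

theorem range_sh_lt {j b : ℕ} (h : b < 7) : b ∉ Set.range (sh j) := by
  rintro ⟨c, rfl⟩
  simp only [sh] at h
  omega

/-- The real scalar in cell `(2, k)` of the table of rows. -/
def rowReal (k : ℕ) : RealExpr := .cell 6 (.const 2) (.const k)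

/-- Write entry `(i, k)` of the adjacency matrix, the weights and the fields of the blown-up model,
where `i` and `k` are held in `nvar 12` and `nvar 13`. -/
def buildEntry (j : ℕ) : Program :=
  .seq (.setNat (sh j 1) (nvar 12) (nvar 13) (.add (.cell 3 (nvar 12) (nvar 13))
    (.cell 1 (.cell 4 (nvar 12) (nvar 13)) (.cell 5 (nvar 12) (nvar 13))))) <|
  .seq (.setReal (sh j 0) (nvar 12) (nvar 13) (.add
    (.div (.mul (.cell 3 (nvar 12) (nvar 13)) (rowReal 2)) (rowReal 1))
    (.div (.cell 0 (.cell 4 (nvar 12) (nvar 13)) (.cell 5 (nvar 12) (nvar 13))) (rowReal 1))))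
  (.setReal (sh j 1) (nvar 12) (nvar 13)
    (.div (.mul (.cell 6 (.const 1) (nvar 12))
      (.cell 1 (.cell 6 (.const 0) (nvar 12)) (nvar 13))) (rowReal 3)))

/-- Write the input of the `j`-th copy and set the program counter to the start of `P`. -/
def build (P : Program) (j : ℕ) : Program :=
  .seq (forLoop 12 (rowEntry 2 0) <| forLoop 13 (rowEntry 2 0) <| buildEntry j) <|
  .seq (.setNat (sh j 0) (.const 0) (.const 0) (rowEntry 2 0)) <|
  .seq (goto (states P) [P]) (setNvar 11 (.const 0))

open Classical in
/-- The part of the blown-up model that concerns the entries in `D`. -/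
def Advice.part (a : Advice) (s : Store) (D : ℕ → ℕ → Prop) : Store where
  nat b i k := if b = 1 ∧ D i k then a.inner i k + s.nat 1 (a.left i k) (a.right i k) else 0
  real b i k :=
    if b = 0 ∧ D i k then
      a.inner i k * a.strength / a.width + s.real 0 (a.left i k) (a.right i k) / a.width
    else if b = 1 ∧ D i k then a.flag i * s.real 1 (a.block i) k / a.spread
    else 0

theorem Advice.part_congr (a : Advice) (s : Store) {D D' : ℕ → ℕ → Prop}
    (h : ∀ i k, D i k ↔ D' i k) : a.part s D = a.part s D' := by
  rw [show D = D' from funext fun i => funext fun k => propext (h i k)]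

theorem buildEntry_spec {a : Advice} {s₀ S : Store} (hS : Ready a s₀ S) (h5 : 5 ≤ a.size) (j : ℕ)
    {i k : ℕ} (hi : i < a.size) (hk : k < a.size) (h12 : S.nat 12 0 0 = i) (h13 : S.nat 13 0 0 = k)
    {D : ℕ → ℕ → Prop} (hd : dec j S = a.part s₀ D) :
    ∃ S', Runs 5 (buildEntry j) S S' ∧ Frame (Set.range (sh j)) (Set.range (sh j)) S S' ∧
      dec j S' = a.part s₀ (fun i' k' => D i' k' ∨ (i' = i ∧ k' = k)) := by
  have r₁ := Runs.setNat (sh j 1) (nvar 12) (nvar 13) (.add (.cell 3 (nvar 12) (nvar 13))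
    (.cell 1 (.cell 4 (nvar 12) (nvar 13)) (.cell 5 (nvar 12) (nvar 13)))) S
  simp only [eval_nvar, h12, h13, NatExpr.eval, (hS.inner i hi k hk).1, (hS.left i hi k hk).1,
    (hS.right i hi k hk).1, hS.adj] at r₁
  set v := a.inner i k + s₀.nat 1 (a.left i k) (a.right i k) with hv
  set S₁ := S.writeNat (sh j 1) i k v with hS₁
  have hf₁ : Frame (Set.range (sh j)) (Set.range (sh j)) S S₁ :=
    (Frame.refl _ _ S).writeNat (Set.mem_range_self 1) _ _ _
  have hne : ∀ b, b < 20 → b ∉ Set.range (sh j) := by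
    rintro b hb ⟨c, rfl⟩
    simp only [sh] at hb
    omega
  have h2 : (2 : ℕ) < a.size := by omega
  have rowsR : ∀ {S'}, Ready a s₀ S' → ∀ c < 5, S'.real 6 2 c = a.rows 2 c := fun h c hc =>
    (h.rows 2 h2 c (by omega)).2
  have hS₁' : Ready a s₀ S₁ :=
    hS.frame hf₁ (fun b hb => range_sh_lt hb) (fun b hb => range_sh_lt hb)
  have r₂ := Runs.setReal (sh j 0) (nvar 12) (nvar 13) (.add
    (.div (.mul (.cell 3 (nvar 12) (nvar 13)) (rowReal 2)) (rowReal 1))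
    (.div (.cell 0 (.cell 4 (nvar 12) (nvar 13)) (.cell 5 (nvar 12) (nvar 13))) (rowReal 1))) S₁
  have g12 : S₁.nat 12 0 0 = i := by rw [hf₁.1 12 (hne _ (by norm_num)), h12]
  have g13 : S₁.nat 13 0 0 = k := by rw [hf₁.1 13 (hne _ (by norm_num)), h13]
  simp only [eval_nvar, g12, g13, NatExpr.eval, RealExpr.eval, rowReal, (hS₁'.inner i hi k hk).2,
    (hS₁'.left i hi k hk).1, (hS₁'.right i hi k hk).1, hS₁'.weight, rowsR hS₁' 2 (by norm_num),
    rowsR hS₁' 1 (by norm_num)] at r₂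
  set S₂ := S₁.writeReal (sh j 0) i k _ with hS₂
  have hf₂ : Frame (Set.range (sh j)) (Set.range (sh j)) S S₂ := hf₁.writeReal ⟨0, rfl⟩ _ _ _
  have hS₂' : Ready a s₀ S₂ :=
    hS.frame hf₂ (fun b hb => range_sh_lt hb) (fun b hb => range_sh_lt hb)
  have r₃ := Runs.setReal (sh j 1) (nvar 12) (nvar 13)
    (.div (.mul (.cell 6 (.const 1) (nvar 12))
      (.cell 1 (.cell 6 (.const 0) (nvar 12)) (nvar 13))) (rowReal 3)) S₂
  have k12 : S₂.nat 12 0 0 = i := g12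
  have k13 : S₂.nat 13 0 0 = k := g13
  simp only [eval_nvar, k12, k13, NatExpr.eval, RealExpr.eval, rowReal,
    (hS₂'.rows 1 (by omega) i hi).2, (hS₂'.rows 0 (by omega) i hi).1, hS₂'.field,
    rowsR hS₂' 3 (by norm_num)] at r₃
  refine ⟨_, r₁.seq (r₂.seq r₃), hf₂.writeReal ⟨1, rfl⟩ _ _ _, ?_⟩
  rw [dec_writeReal, hS₂, dec_writeReal, hS₁, dec_writeNat, hd]
  simp only [Advice.part, Store.writeNat, Store.writeReal, Advice.rows, Store.mk.injEq]
  constructor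
  · funext b i' k'
    by_cases h : i' = i ∧ k' = k
    · obtain ⟨rfl, rfl⟩ := h
      by_cases hb : b = 1 <;> simp [hb, hv]
    · by_cases hD : D i' k' <;> simp [h, hD]
  · funext b i' k'
    by_cases h : i' = i ∧ k' = k
    · obtain ⟨rfl, rfl⟩ := h
      by_cases hb : b = 1
      · simp [hb]
      · by_cases hb' : b = 0 <;> simp [hb, hb']
    · by_cases hD : D i' k' <;> simp [h, hD]

theorem build_spec {a : Advice} {s₀ S : Store} (hS : Ready a s₀ S) (h5 : 5 ≤ a.size) (P : Program)
    (j : ℕ) (hd : dec j S = ⟨fun _ _ _ => 0, fun _ _ _ => 0⟩) :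
    ∃ S', Runs (a.size * (a.size * 8 + 6) + 9) (build P j) S S' ∧
      Frame (copyNat j) (Set.range (sh j)) S S' ∧ dec j S' = a.expand s₀ ∧
      (open Classical in S'.nat 10 0 0 = (states P).idxOf [P]) ∧ S'.nat 11 0 0 = 0 := by
  classical
  set N := a.size with hN
  have hcopy : ∀ {S'}, Frame (copyNat j) (Set.range (sh j)) S S' → Ready a s₀ S' := fun hf =>
    hS.frame hf (fun b hb => notMem_copyNat (by omega)) (fun b hb => range_sh_lt hb)
  have hsize : ∀ {S'}, Ready a s₀ S' → S'.nat 6 2 0 = N := fun h => by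
    rw [(h.rows 2 (by omega) 0 (by omega)).1]
    simp [Advice.rows, hN]
  have hm : ∀ b, 10 ≤ b → b < 20 → b ∈ copyNat j := fun b h1 h2 => mem_copyNat h1 h2
  obtain ⟨S₁, r, hf₁, -, hd₁⟩ := Triple.forLoop (v := 12) (b := rowEntry 2 0) (m := N)
    (T := N * (5 + 3) + 3) (P := forLoop 13 (rowEntry 2 0) <| buildEntry j) (I₀ := fun s => s = S)
    (I := fun x s => Frame (copyNat j) (Set.range (sh j)) S s ∧ s.nat 12 0 0 = x ∧
      dec j s = a.part s₀ fun i k => i < x ∧ k < N)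
    (by
      rintro s rfl
      refine ⟨(Frame.refl _ _ s).writeNat (hm 12 (by norm_num) (by norm_num)) _ _ _, by simp, ?_⟩
      rw [dec_writeNat_of_lt _ _ (by norm_num), hd]
      simp [Advice.part])
    (by
      rintro x s ⟨hf, h1, -⟩
      exact ⟨h1, hsize (hcopy hf)⟩)
    (by
      rintro x hx s ⟨hf, h1, h2⟩
      obtain ⟨s', r, hf', h3, -, h5⟩ := Triple.forLoop (v := 13) (b := rowEntry 2 0) (m := N)
        (T := 5) (P := buildEntry j) (I₀ := fun s' => s' = s)
        (I := fun y s => Frame (copyNat j) (Set.range (sh j)) S s ∧ s.nat 12 0 0 = x ∧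
          s.nat 13 0 0 = y ∧ dec j s = a.part s₀ fun i k => k < N ∧ (i < x ∨ (i = x ∧ k < y)))
        (by
          rintro s' rfl
          refine ⟨hf.writeNat (hm 13 (by norm_num) (by norm_num)) _ _ _, by
            rwa [nat_writeNat_ne _ _ _ _ (by norm_num)], by simp, ?_⟩
          rw [dec_writeNat_of_lt _ _ (by norm_num), h2]
          exact a.part_congr s₀ fun i k => by omega)
        (by
          rintro y s ⟨hf, -, h1, -⟩
          exact ⟨h1, hsize (hcopy hf)⟩)
        (by
          rintro y hy s ⟨hf, h1, h2, h3⟩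
          obtain ⟨s', r, hf', hd'⟩ := buildEntry_spec (hcopy hf) h5 j hx hy h1 h2 h3
          have hne : ∀ b, b < 20 → b ∉ Set.range (sh j) := by
            rintro b hb ⟨c, rfl⟩
            simp only [sh] at hb
            omega
          refine ⟨s', r, by rw [hf'.1 13 (hne _ (by norm_num)), h2],
            (hf.trans (hf'.mono Set.subset_union_right subset_rfl)).writeNat
              (hm 13 (by norm_num) (by norm_num)) _ _ _, ?_, by simp, ?_⟩
          · rw [nat_writeNat_ne _ _ _ _ (by norm_num), hf'.1 12 (hne _ (by norm_num)), h1]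
          · rw [dec_writeNat_of_lt _ _ (by norm_num), hd']
            exact a.part_congr s₀ fun i k => by omega)
        s rfl
      refine ⟨s', r, h3, hf'.writeNat (hm 12 (by norm_num) (by norm_num)) _ _ _, by simp, ?_⟩
      rw [dec_writeNat_of_lt _ _ (by norm_num), h5]
      exact a.part_congr s₀ fun i k => by omega)
    S rfl
  have r₂ := Runs.setNat (sh j 0) (.const 0) (.const 0) (rowEntry 2 0) S₁
  rw [show (rowEntry 2 0).eval S₁ = N from hsize (hcopy hf₁)] at r₂
  simp only [NatExpr.eval] at r₂
  set S₂ := S₁.writeNat (sh j 0) 0 0 N with hS₂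
  have r₃ := Runs.setNvar 10 (.const ((states P).idxOf [P])) S₂
  set S₃ := S₂.writeNat 10 0 0 _ with hS₃
  have r₄ := Runs.setNvar 11 (.const 0) S₃
  refine ⟨_, (r.seq (r₂.seq (r₃.seq r₄))).mono
    (by rw [show N * (5 + 3) + 3 + 3 = N * 8 + 6 by ring]),
    ((hf₁.writeNat (sh_mem_copyNat j 0) _ _ _).writeNat (hm 10 (by norm_num) (by norm_num)) _ _
      _).writeNat (hm 11 (by norm_num) (by norm_num)) _ _ _, ?_, ?_, by simp [NatExpr.eval]⟩
  · rw [dec_writeNat_of_lt _ _ (by norm_num), hS₃, dec_writeNat_of_lt _ _ (by norm_num), hS₂,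
      dec_writeNat, hd₁]
    simp only [Advice.part, Advice.expand, Store.writeNat, Store.mk.injEq, ← hN]
    constructor
    · funext b i k
      by_cases hb : b = 0 <;> simp [hb]
    · funext b i k
      split_ifs <;> rfl
  · rw [nat_writeNat_ne _ _ _ _ (by norm_num), hS₃]
    simp [NatExpr.eval]

/-! ### Majority of three copies -/

/-- Increase the counter `nvar 7` if the answer of the `j`-th copy is yes. -/
def count (j : ℕ) : Program :=
  .ite (.natLt (.const 0) (nvar (sh j 2)))
    (.ite (.natLt (nvar (sh j 2)) (.const 2)) (setNvar 7 (.add (nvar 7) (.const 1)))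
      (setNvar 10 (.const 0)))
    (setNvar 10 (.const 0))

/-- Build the input of the `j`-th copy of `P`, run it, and count its answer. -/
def copyRun (P : Program) (j : ℕ) : Program :=
  .seq (build P j) (.seq (simulation P j) (count j))

/-- The probability that the answer cell contains yes after `T` steps. -/
def yesProb {n q : ℕ} (μ : PMF (Fin n → Fin q)) (T : ℕ) (c : Config) : ℝ≥0∞ :=
  iter μ (fun c => if c.store.nat 2 0 0 = 1 then 1 else 0) T c

/-- The probability that the answer cell does not contain yes after `T` steps. -/
def noProb {n q : ℕ} (μ : PMF (Fin n → Fin q)) (T : ℕ) (c : Config) : ℝ≥0∞ :=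
  iter μ (fun c => if c.store.nat 2 0 0 = 1 then 0 else 1) T c

theorem yesProb_add_noProb {n q : ℕ} (μ : PMF (Fin n → Fin q)) (T : ℕ) (c : Config) :
    yesProb μ T c + noProb μ T c = 1 := by
  have := iter_add_mul μ (fun c => if c.store.nat 2 0 0 = 1 then 1 else 0)
    (fun c => if c.store.nat 2 0 0 = 1 then 0 else 1) 1 1 T c
  simp only [mul_one] at this
  rw [yesProb, noProb, ← this]
  refine Eq.trans ?_ (iter_const μ 1 T c)
  congr 1
  funext c
  split_ifs <;> simp

/-- What running a copy may change. -/
def runNat (j : ℕ) : Set ℕ := insert 7 (copyNat j)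

theorem count_spec (j : ℕ) (S : Store) :
    ∃ S', Runs 3 (count j) S S' ∧ Frame (runNat j) (Set.range (sh j)) S S' ∧
      S'.nat 7 0 0 = S.nat 7 0 0 + if (dec j S).nat 2 0 0 = 1 then 1 else 0 := by
  have h10 : (10 : ℕ) ∈ runNat j := Or.inr (mem_copyNat le_rfl (by norm_num))
  have hr := Frame.refl (runNat j) (Set.range (sh j)) S
  by_cases h0 : 0 < S.nat (sh j 2) 0 0
  · by_cases h2 : S.nat (sh j 2) 0 0 < 2
    · refine ⟨_, (Runs.ite_pos h0 (Runs.ite_pos h2 (Runs.setNvar 7 _ S))),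
        hr.writeNat (Or.inl rfl) _ _ _, ?_⟩
      have : (dec j S).nat 2 0 0 = 1 := by simp only [dec]; omega
      simp [this, NatExpr.eval]
    · refine ⟨_, (Runs.ite_pos h0 (Runs.ite_neg h2 (Runs.setNvar 10 _ S))),
        hr.writeNat h10 _ _ _, ?_⟩
      have : (dec j S).nat 2 0 0 ≠ 1 := by simp only [dec]; omega
      rw [if_neg this, nat_writeNat_ne _ _ _ _ (by norm_num), add_zero]
  · refine ⟨_, (Runs.ite_neg (b := .natLt (.const 0) (nvar (sh j 2))) h0
        (Runs.setNvar 10 _ S)).mono (by norm_num),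
      hr.writeNat h10 _ _ _, ?_⟩
    have : (dec j S).nat 2 0 0 ≠ 1 := by simp only [dec]; omega
    rw [if_neg this, nat_writeNat_ne _ _ _ _ (by norm_num), add_zero]

/-- The number of steps of the run of a copy. -/
def runTime (P : Program) (a : Advice) : ℕ :=
  a.size * (a.size * 8 + 6) + a.time * (4 * a.size + 30 + (states P).length) + 20

/-- The run of a copy splits the execution according to its answer, with the probabilities of the
copied machine. -/
theorem copyRun_spec {n q : ℕ} (μ : PMF (Fin n → Fin q)) (A : Set Store) (a : Advice)
    (u : Fin a.size → Fin n) (hu : ∀ x : Fin a.size, a.block x = u x) (h5 : 5 ≤ a.size)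
    {s₀ S : Store}
    (hS : Ready a s₀ S) (P : Program) (j : ℕ)
    (hd : dec j S = ⟨fun _ _ _ => 0, fun _ _ _ => 0⟩) (K : List Program) (t : ℕ) (x₁ x₀ : ℝ≥0∞)
    (h₁ : ∀ S', Frame (runNat j) (Set.range (sh j)) S S' → S'.nat 7 0 0 = S.nat 7 0 0 + 1 →
      x₁ ≤ haltProb μ A t ⟨K, S'⟩)
    (h₀ : ∀ S', Frame (runNat j) (Set.range (sh j)) S S' → S'.nat 7 0 0 = S.nat 7 0 0 →
      x₀ ≤ haltProb μ A t ⟨K, S'⟩) :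
    yesProb (μ.map fun σ x => σ (u x)) a.time ⟨[P], a.expand s₀⟩ * x₁ +
      noProb (μ.map fun σ x => σ (u x)) a.time ⟨[P], a.expand s₀⟩ * x₀ ≤
      haltProb μ A (t + runTime P a) ⟨copyRun P j :: K, S⟩ := by
  obtain ⟨S₁, r₁, hf₁, hd₁, hpc, hclock⟩ := build_spec hS h5 P j hd
  have hS₁ : Ready a s₀ S₁ :=
    hS.frame hf₁ (fun b hb => notMem_copyNat (by omega)) (fun b hb => range_sh_lt hb)
  have hsub : ∀ {S S'}, Frame (copyNat j) (Set.range (sh j)) S S' →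
      Frame (runNat j) (Set.range (sh j)) S S' := fun h => h.mono (Set.subset_insert _ _) subset_rfl
  have h7 : (7 : ℕ) ∉ copyNat j := notMem_copyNat (by norm_num)
  rw [yesProb, noProb, ← iter_add_mul, copyRun,
    show t + runTime P a = t + 3 + a.time * (4 * a.size + 30 + (states P).length) + 1 + 1 +
      (a.size * (a.size * 8 + 6) + 9) + 5 + 1 by rw [runTime]; ring, haltProb_seq]
  refine le_trans ?_ (haltProb_mono μ A (Nat.le_add_right _ 5) _)
  refine le_trans ?_ (r₁ _ _ μ A _ _)
  rw [haltProb_seq]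
  refine simulation_spec (T := a.time) μ A u P j S₁ ?_ ?_ ?_ _ _ _ ?_ a.time ⟨[P], a.expand s₀⟩ S₁
    (List.mem_cons_of_mem _ (mem_reach P [])) (Frame.refl _ _ _) hd₁ hpc
    (by rw [hclock, Nat.zero_add])
  · rw [(hS₁.rows 2 (by omega) 0 (by omega)).1]
    simp [Advice.rows]
  · rw [(hS₁.rows 2 (by omega) 4 (by omega)).1]
    simp [Advice.rows]
  · intro x
    rw [(hS₁.rows 0 (by omega) x x.2).1]
    simp [Advice.rows, hu]
  · intro c S₂ hf₂ hd₂
    obtain ⟨S₃, r₃, hf₃, h⟩ := count_spec j S₂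
    have hf : Frame (runNat j) (Set.range (sh j)) S S₃ := (hsub (hf₁.trans hf₂)).trans hf₃
    rw [hd₂, hf₂.1 7 h7, hf₁.1 7 h7] at h
    refine le_trans ?_ (r₃ _ _ μ A K t)
    by_cases hc : c.store.nat 2 0 0 = 1
    · simp only [hc, if_true, one_mul, zero_mul, add_zero] at h ⊢
      exact h₁ S₃ hf h
    · simp only [hc, if_false, one_mul, zero_mul, zero_add, add_zero] at h ⊢
      exact h₀ S₃ hf h

/-- Three copies, and the majority of their answers. -/
def majority (P : Program) : Program :=
  .seq (copyRun P 0) <| .seq (copyRun P 1) <| .seq (copyRun P 2) <|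
  .ite (.natLt (.const 1) (nvar 7)) (setNvar 2 (.const 1)) (setNvar 2 (.const 0))

/-- Two of three independent events of probability at least `7 / 10` occur with probability at least
`3 / 4`. -/
theorem majority_bound {x y : ℝ≥0∞} (h : x + y = 1) (hx : 7 / 10 ≤ x) :
    3 / 4 ≤ x * (x * (x * 1 + y * 1) + y * (x * 1 + y * 0)) +
      y * (x * (x * 1 + y * 0) + y * (x * 0 + y * 0)) := by
  have hx1 : x ≠ ⊤ := ne_top_of_le_ne_top ENNReal.one_ne_top (h ▸ le_self_add)
  have hy1 : y ≠ ⊤ := ne_top_of_le_ne_top ENNReal.one_ne_top (h ▸ le_add_self)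
  lift x to NNReal using hx1
  lift y to NNReal using hy1
  have h' : x + y = 1 := by exact_mod_cast h
  have hx' : (7 / 10 : NNReal) ≤ x := by
    refine ENNReal.coe_le_coe.1 ?_
    rw [ENNReal.coe_div (by norm_num)]
    push_cast
    exact hx
  have key : (3 / 4 : NNReal) ≤ x * (x * (x * 1 + y * 1) + y * (x * 1 + y * 0)) +
      y * (x * (x * 1 + y * 0) + y * (x * 0 + y * 0)) := by
    rw [← NNReal.coe_le_coe] at hx' ⊢
    have h'' : (y : ℝ) = 1 - x := by
      have := congrArg NNReal.toReal h'
      push_cast at this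
      linarith
    have hx2 : (x : ℝ) ≤ 1 := by
      have := y.2
      change 0 ≤ (y : ℝ) at this
      linarith
    push_cast at hx' ⊢
    rw [h'']
    nlinarith [mul_nonneg (sub_nonneg.2 hx') (sub_nonneg.2 hx2),
      mul_nonneg (mul_nonneg (sub_nonneg.2 hx') (sub_nonneg.2 hx2)) x.2]
  have := ENNReal.coe_le_coe.2 key
  rw [ENNReal.coe_div (by norm_num)] at this
  push_cast at this
  exact this

/-- The three copies are independent, since each of them draws its own samples and coins. -/
theorem majority_spec {n q : ℕ} (μ : PMF (Fin n → Fin q)) (a : Advice)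
    (u : Fin a.size → Fin n) (hu : ∀ x : Fin a.size, a.block x = u x) (h5 : 5 ≤ a.size)
    {s₀ S : Store}
    (hS : Ready a s₀ S) (P : Program) (h7 : S.nat 7 0 0 = 0)
    (hd : ∀ j < 3, dec j S = ⟨fun _ _ _ => 0, fun _ _ _ => 0⟩) (b : Bool)
    (h : 7 / 10 ≤ haltProb (μ.map fun σ x => σ (u x)) {s | s.nat 2 0 0 = b.toNat} a.time
      ⟨[P], a.expand s₀⟩) :
    3 / 4 ≤ haltProb μ {s | s.nat 2 0 0 = b.toNat} (3 * runTime P a + 10) ⟨[majority P], S⟩ := by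
  set A : Set Store := {s | s.nat 2 0 0 = b.toNat} with hA
  set ν := μ.map fun σ x => σ (u x) with hν
  set y₁ := yesProb ν a.time ⟨[P], a.expand s₀⟩ with hy₁
  set y₀ := noProb ν a.time ⟨[P], a.expand s₀⟩ with hy₀
  set v : ℕ → ℝ≥0∞ := fun k => if (1 < k ↔ b = true) then 1 else 0 with hv
  have hsum : y₁ + y₀ = 1 := yesProb_add_noProb _ _ _
  have final : ∀ k S', S'.nat 7 0 0 = k → v k ≤ haltProb μ A 3
      ⟨[.ite (.natLt (.const 1) (nvar 7)) (setNvar 2 (.const 1)) (setNvar 2 (.const 0))], S'⟩ := by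
    intro k S' hk
    by_cases hk' : 1 < k
    · have r := Runs.ite_pos (Q := setNvar 2 (.const 0))
        (show (Test.natLt (.const 1) (nvar 7)).Holds S' by
          simpa [Test.Holds, NatExpr.eval, hk] using hk') (Runs.setNvar 2 (.const 1) S')
      refine le_trans ?_ (r _ _ μ A [] 1)
      simp only [hv, hk', true_iff]
      split_ifs with hb
      · rw [haltProb_nil _ _ (by simp [hA, hb, NatExpr.eval])]
      · exact zero_le
    · have r := Runs.ite_neg (P := setNvar 2 (.const 1))
        (show ¬ (Test.natLt (.const 1) (nvar 7)).Holds S' by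
          simpa [Test.Holds, NatExpr.eval, hk] using hk') (Runs.setNvar 2 (.const 0) S')
      refine le_trans ?_ (r _ _ μ A [] 1)
      simp only [hv, hk', false_iff, Bool.not_eq_true]
      split_ifs with hb
      · rw [haltProb_nil _ _ (by simp [hA, hb, NatExpr.eval])]
      · exact zero_le
  have hrun : ∀ {j S S'}, Frame (runNat j) (Set.range (sh j)) S S' → Ready a s₀ S → Ready a s₀ S' :=
    fun hf hS => hS.frame hf (fun b hb => by
      rintro (rfl | h')
      · omega
      · exact notMem_copyNat (by omega) h') (fun b hb => range_sh_lt hb)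
  have hdec : ∀ {j j' S S'}, Frame (runNat j) (Set.range (sh j)) S S' → j < 3 → j' < 3 → j' ≠ j →
      dec j' S' = dec j' S := by
    intro j j' S S' hf h1 h2 h3
    refine dec_eq_of_frame hf (fun c => ?_) (fun c => ?_)
    · rintro (h' | h' | ⟨d, h'⟩)
      · simp only [sh] at h'; omega
      · have := h'.2; simp only [sh] at this; omega
      · simp only [sh] at h'; omega
    · rintro ⟨d, h'⟩
      simp only [sh] at h'; omega
  have third : ∀ k S', Ready a s₀ S' → dec 2 S' = ⟨fun _ _ _ => 0, fun _ _ _ => 0⟩ →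
      S'.nat 7 0 0 = k → y₁ * v (k + 1) + y₀ * v k ≤ haltProb μ A (3 + runTime P a + 1)
      ⟨[.seq (copyRun P 2) <|
        .ite (.natLt (.const 1) (nvar 7)) (setNvar 2 (.const 1)) (setNvar 2 (.const 0))], S'⟩ := by
    intro k S' hS' hd' hk
    rw [haltProb_seq]
    exact copyRun_spec μ A a u hu h5 hS' P 2 hd' _ _ _ _
      (fun S'' _ h' => final _ _ (by rw [h', hk])) (fun S'' _ h' => final _ _ (by rw [h', hk]))
  have second : ∀ k S', Ready a s₀ S' → (∀ j < 3, 0 < j →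
      dec j S' = ⟨fun _ _ _ => 0, fun _ _ _ => 0⟩) →
      S'.nat 7 0 0 = k → y₁ * (y₁ * v (k + 1 + 1) + y₀ * v (k + 1)) +
        y₀ * (y₁ * v (k + 1) + y₀ * v k) ≤
      haltProb μ A (3 + runTime P a + 1 + runTime P a + 1)
      ⟨[.seq (copyRun P 1) <| .seq (copyRun P 2) <|
        .ite (.natLt (.const 1) (nvar 7)) (setNvar 2 (.const 1)) (setNvar 2 (.const 0))], S'⟩ := by
    intro k S' hS' hd' hk
    rw [haltProb_seq]
    have hd2 : ∀ {S''}, Frame (runNat 1) (Set.range (sh 1)) S' S'' →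
        dec 2 S'' = ⟨fun _ _ _ => 0, fun _ _ _ => 0⟩ := fun hf => by
      rw [hdec hf (by norm_num) (by norm_num) (by norm_num), hd' 2 (by norm_num) (by norm_num)]
    exact copyRun_spec μ A a u hu h5 hS' P 1 (hd' 1 (by norm_num) (by norm_num)) _ _ _ _
      (fun S'' hf h' => third _ _ (hrun hf hS') (hd2 hf) (by rw [h', hk]))
      (fun S'' hf h' => third _ _ (hrun hf hS') (hd2 hf) (by rw [h', hk]))
  have first : y₁ * (y₁ * (y₁ * v 3 + y₀ * v 2) + y₀ * (y₁ * v 2 + y₀ * v 1)) +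
      y₀ * (y₁ * (y₁ * v 2 + y₀ * v 1) + y₀ * (y₁ * v 1 + y₀ * v 0)) ≤
      haltProb μ A (3 + runTime P a + 1 + runTime P a + 1 + runTime P a + 1)
        ⟨[majority P], S⟩ := by
    rw [majority, haltProb_seq]
    have hd2 : ∀ {S''}, Frame (runNat 0) (Set.range (sh 0)) S S'' → ∀ j < 3, 0 < j →
        dec j S'' = ⟨fun _ _ _ => 0, fun _ _ _ => 0⟩ := fun hf j hj hj' => by
      rw [hdec hf (by norm_num) hj (by omega), hd j hj]
    exact copyRun_spec μ A a u hu h5 hS P 0 (hd 0 (by norm_num)) _ _ _ _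
      (fun S'' hf h' => second 1 _ (hrun hf hS) (hd2 hf) (by rw [h', h7]))
      (fun S'' hf h' => second 0 _ (hrun hf hS) (hd2 hf) (by rw [h', h7]))
  refine le_trans ?_ (haltProb_mono μ A
    (show 3 + runTime P a + 1 + runTime P a + 1 + runTime P a + 1 ≤ 3 * runTime P a + 10 by
      omega) _)
  refine le_trans ?_ first
  cases b with
  | true =>
    have hx : 7 / 10 ≤ y₁ := h.trans (iter_mono _ (fun c => by
      by_cases hc : c.store.nat 2 0 0 = 1 <;> simp [hA, hc]
      split_ifs <;> simp) _ _)
    have := majority_bound hsum hx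
    simpa [hv] using this
  | false =>
    have hx : 7 / 10 ≤ y₀ := h.trans (iter_mono _ (fun c => by
      by_cases hc : c.store.nat 2 0 0 = 1 <;> simp [hA, hc]
      split_ifs <;> simp) _ _)
    have := majority_bound (x := y₀) (y := y₁) (by rw [add_comm, hsum]) hx
    simp only [hv]
    norm_num
    refine this.trans (le_of_eq ?_)
    ring

/-! ### The simulating program -/

theorem eval_le_eval (p : Polynomial ℕ) {m n : ℕ} (h : m ≤ n) : p.eval m ≤ p.eval n := by
  simp only [Polynomial.eval_eq_sum, Polynomial.sum]
  exact Finset.sum_le_sum fun i _ => Nat.mul_le_mul_left _ (Nat.pow_le_pow_left h i)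

/-- If a program `P` gives the answer `b` on blown-up models with probability at least `7 / 10`,
when it has access to blockwise constant samples, then there is a program that gives this answer
on the original models with probability at least `3 / 4`. The advice on how to blow up a model may
be an arbitrary, even uncomputable, function of the number of vertices, but has to be of
polynomial size. -/
theorem exists_simulating_program (P : Program) (adv : ℕ → Advice) (B : Polynomial ℕ)
    (hsize : ∀ m, (adv m).size ≤ B.eval m) (htime : ∀ m, (adv m).time ≤ B.eval m)
    (hadv : ∀ m, ∀ i < (adv m).size, ∀ k < (adv m).size, (adv m).inner i k ≤ B.eval m ∧
      (adv m).left i k ≤ B.eval m ∧ (adv m).right i k ≤ B.eval m ∧ (adv m).rows i k ≤ B.eval m) :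
    ∃ (Q : Program) (p : Polynomial ℕ), ∀ (n q : ℕ) (M : PottsModel n q) (μ : PMF (Fin n → Fin q))
      (u : Fin (adv n).size → Fin n), (∀ x : Fin (adv n).size, (adv n).block x = u x) →
      5 ≤ (adv n).size → ∀ b : Bool,
      7 / 10 ≤ haltProb (μ.map fun σ x => σ (u x)) {s | s.nat 2 0 0 = b.toNat} (adv n).time
        ⟨[P], (adv n).expand (input M)⟩ →
      3 / 4 ≤ answerProb Q M μ (p.eval n) b := by
  obtain ⟨γ₃, h₃⟩ := exists_loader (fun m => (adv m).size) (fun m => (adv m).inner)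
    (tab := 3) (by simp)
  obtain ⟨γ₄, h₄⟩ := exists_loader (fun m => (adv m).size) (fun m => (adv m).left)
    (tab := 4) (by simp)
  obtain ⟨γ₅, h₅⟩ := exists_loader (fun m => (adv m).size) (fun m => (adv m).right)
    (tab := 5) (by simp)
  obtain ⟨γ₆, h₆⟩ := exists_loader (fun m => (adv m).size) (fun m => (adv m).rows)
    (tab := 6) (by simp)
  refine ⟨.seq (loader γ₃ 3) <| .seq (loader γ₄ 4) <| .seq (loader γ₅ 5) <| .seq (loader γ₆ 6) <|
    majority P, 4 * ((Polynomial.X + 1) * (6 * B + B * (B * (6 * B + 20) + 20) + 50) + 50) +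
    3 * (B * (B * 8 + 6) + B * (4 * B + 30 + ((states P).length : Polynomial ℕ)) + 20) + 20,
    fun n q M μ u hu h5 b hb => ?_⟩
  set d := B.eval n with hd
  have hB : ∀ m ≤ n, B.eval m ≤ d := fun m hm => eval_le_eval B hm
  set T := (n + 1) * (6 * d + d * (d * (6 * d + 20) + 20) + 50) + 50 with hT
  have hsz : ∀ m ≤ n, (adv m).size ≤ d := fun m hm => (hsize m).trans (hB m hm)
  have hW : ∀ {tab : ℕ} {b : ℕ}, b < 10 → b ≠ tab → b ∉ insert tab scratch := by
    rintro tab b h1 h2 (h | h)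
    · exact h2 h
    · exact absurd h.1 (by omega)
  have hsh : ∀ {tab j a : ℕ}, tab < 10 → sh j a ∉ insert tab scratch := by
    rintro tab j a h1 (h | h)
    · simp only [sh] at h; omega
    · have := h.2; simp only [sh] at this; omega
  obtain ⟨S₃, r₃, f₃, t₃⟩ := h₃ n d d hsz
    (fun m hm i hi k hk => (hadv m i hi k hk).1.trans (hB m hm)) (input M) (by simp [input])
  obtain ⟨S₄, r₄, f₄, t₄⟩ := h₄ n d d hsz
    (fun m hm i hi k hk => (hadv m i hi k hk).2.1.trans (hB m hm)) S₃
    (by rw [f₃.1 0 (hW (by norm_num) (by norm_num))]; simp [input])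
  obtain ⟨S₅, r₅, f₅, t₅⟩ := h₅ n d d hsz
    (fun m hm i hi k hk => (hadv m i hi k hk).2.2.1.trans (hB m hm)) S₄
    (by rw [f₄.1 0 (hW (by norm_num) (by norm_num)), f₃.1 0 (hW (by norm_num) (by norm_num))]
        simp [input])
  obtain ⟨S₆, r₆, f₆, t₆⟩ := h₆ n d d hsz
    (fun m hm i hi k hk => (hadv m i hi k hk).2.2.2.trans (hB m hm)) S₅
    (by rw [f₅.1 0 (hW (by norm_num) (by norm_num)), f₄.1 0 (hW (by norm_num) (by norm_num)),
          f₃.1 0 (hW (by norm_num) (by norm_num))]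
        simp [input])
  have hnat : ∀ b < 10, b ≠ 3 → b ≠ 4 → b ≠ 5 → b ≠ 6 → S₆.nat b = (input M).nat b := by
    intro b h0 h1 h2 h3 h4
    rw [f₆.1 b (hW h0 h4), f₅.1 b (hW h0 h3), f₄.1 b (hW h0 h2), f₃.1 b (hW h0 h1)]
  have hreal : ∀ b < 10, b ≠ 3 → b ≠ 4 → b ≠ 5 → b ≠ 6 → S₆.real b = (input M).real b := by
    intro b h0 h1 h2 h3 h4
    rw [f₆.2 b (hW h0 h4), f₅.2 b (hW h0 h3), f₄.2 b (hW h0 h2), f₃.2 b (hW h0 h1)]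
  have hready : Ready (adv n) (input M) S₆ :=
    { inner := ((t₃.frame f₄
        (hW (by norm_num) (by norm_num)) (hW (by norm_num) (by norm_num))).frame f₅
        (hW (by norm_num) (by norm_num)) (hW (by norm_num) (by norm_num))).frame f₆
        (hW (by norm_num) (by norm_num)) (hW (by norm_num) (by norm_num))
      left := (t₄.frame f₅ (hW (by norm_num) (by norm_num)) (hW (by norm_num) (by norm_num))).frame
        f₆ (hW (by norm_num) (by norm_num)) (hW (by norm_num) (by norm_num))
      right := t₅.frame f₆ (hW (by norm_num) (by norm_num)) (hW (by norm_num) (by norm_num))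
      rows := t₆
      adj := hnat 1 (by norm_num) (by norm_num) (by norm_num) (by norm_num) (by norm_num)
      weight := hreal 0 (by norm_num) (by norm_num) (by norm_num) (by norm_num) (by norm_num)
      field := hreal 1 (by norm_num) (by norm_num) (by norm_num) (by norm_num) (by norm_num) }
  have hdec : ∀ j < 3, dec j S₆ = ⟨fun _ _ _ => 0, fun _ _ _ => 0⟩ := by
    intro j _
    rw [dec_eq_of_frame f₆ (fun a => hsh (by norm_num)) (fun a => hsh (by norm_num)),
      dec_eq_of_frame f₅ (fun a => hsh (by norm_num)) (fun a => hsh (by norm_num)),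
      dec_eq_of_frame f₄ (fun a => hsh (by norm_num)) (fun a => hsh (by norm_num)),
      dec_eq_of_frame f₃ (fun a => hsh (by norm_num)) (fun a => hsh (by norm_num))]
    have e : ∀ a, sh j a ≠ 0 ∧ sh j a ≠ 1 := fun a => by simp only [sh]; omega
    simp [dec, input, e]
  have hm := majority_spec μ (adv n) u hu h5 hready P
    (by rw [hnat 7 (by norm_num) (by norm_num) (by norm_num) (by norm_num) (by norm_num)]
        simp [input]) hdec b hb
  set A : Set Store := {s | s.nat 2 0 0 = b.toNat} with hA
  rw [answerProb_eq]
  refine le_trans ?_ (haltProb_mono μ A (t := 3 * runTime P (adv n) + 10 + T + 1 + T + 1 + T + 1 +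
    T + 1) ?_ _)
  · rw [haltProb_seq]
    refine le_trans ?_ (r₃ _ _ μ A _ _)
    rw [haltProb_seq]
    refine le_trans ?_ (r₄ _ _ μ A _ _)
    rw [haltProb_seq]
    refine le_trans ?_ (r₅ _ _ μ A _ _)
    rw [haltProb_seq]
    exact hm.trans (r₆ _ _ μ A _ _)
  · have h1 : runTime P (adv n) ≤ d * (d * 8 + 6) + d * (4 * d + 30 + (states P).length) + 20 := by
      have hs := hsize n
      have ht := htime n
      rw [runTime]
      gcongr
    simp only [Polynomial.eval_add, Polynomial.eval_mul, Polynomial.eval_X, Polynomial.eval_one,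
      Polynomial.eval_natCast, Polynomial.eval_ofNat, Nat.cast_id, ← hd]
    simp only [hT] at *
    omega

/-! ### Perturbation of the samples -/

/-- If two distributions are close then so are the probabilities of all answers within `t` steps. -/
theorem haltProb_le_add {n q : ℕ} (μ ν : PMF (Fin n → Fin q)) {δ : ℝ≥0∞}
    (h : ∑ σ, (μ σ - ν σ) ≤ δ) (A : Set Store) (t : ℕ) (c : Config) :
    haltProb μ A t c ≤ haltProb ν A t c + t * δ := by
  classical
  have hle1 : ∀ t c, haltProb μ A t c ≤ 1 := fun t c =>
    (iter_mono μ (G' := fun _ => 1) (fun c => by split_ifs <;> simp) t c).trans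
      (iter_const μ 1 t c).le
  induction t generalizing c with
  | zero => simp [haltProb, iter]
  | succ t ih =>
    have key : ∀ (p : PMF Config), expect p (haltProb μ A t) ≤
        expect p (haltProb ν A t) + (t + 1 : ℕ) * δ := by
      intro p
      refine (expect_mono p ih).trans ?_
      rw [expect_add, expect_const]
      gcongr
      simp
    rcases c with ⟨_ | ⟨P, k⟩, s⟩
    · exact key _
    · cases P with
      | sample a i =>
        rw [haltProb_sample, haltProb_sample]
        have h1 : ∀ σ, μ σ * haltProb μ A t ⟨k, s.writeSpins a (i.eval s) σ⟩ ≤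
            ν σ * haltProb ν A t ⟨k, s.writeSpins a (i.eval s) σ⟩ + ν σ * (t * δ) +
              (μ σ - ν σ) := by
          intro σ
          calc μ σ * haltProb μ A t ⟨k, s.writeSpins a (i.eval s) σ⟩
              ≤ (ν σ + (μ σ - ν σ)) * haltProb μ A t ⟨k, s.writeSpins a (i.eval s) σ⟩ := by
                gcongr
                exact le_add_tsub
            _ ≤ _ := by
                rw [add_mul]
                gcongr
                · rw [← mul_add]
                  gcongr
                  exact ih _
                · exact mul_le_of_le_one_right' (hle1 _ _)
        calc expect μ _ ≤ ∑' σ, (ν σ * haltProb ν A t ⟨k, s.writeSpins a (i.eval s) σ⟩ +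
                ν σ * (t * δ) + (μ σ - ν σ)) := ENNReal.tsum_le_tsum h1
          _ = expect ν (fun σ => haltProb ν A t ⟨k, s.writeSpins a (i.eval s) σ⟩) + t * δ +
                ∑ σ, (μ σ - ν σ) := by
              rw [ENNReal.tsum_add, ENNReal.tsum_add, ENNReal.tsum_mul_right, ν.tsum_coe, one_mul,
                tsum_fintype (fun σ => μ σ - ν σ)]
              rfl
          _ ≤ _ := by
              push_cast
              rw [add_mul, one_mul, add_assoc]
              gcongr
      | _ => exact key _

end RealRAM

namespace PottsModel

variable {n q : ℕ}

/-! ### Couplings -/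

open Classical in
/-- The weight of the edge between `u` and `v`, or zero if there is no such edge. -/
def coup (M : PottsModel n q) (u v : Fin n) : ℝ :=
  if h : M.graph.Adj u v then M.edgeWeight ⟨s(u, v), h⟩ else 0

theorem coup_comm (M : PottsModel n q) (u v : Fin n) : M.coup u v = M.coup v u := by
  by_cases h : M.graph.Adj u v
  · rw [coup, coup, dif_pos h, dif_pos h.symm]
    congr 2
    exact Sym2.eq_swap
  · rw [coup, coup, dif_neg h, dif_neg fun h' => h h'.symm]

theorem coup_self (M : PottsModel n q) (u : Fin n) : M.coup u u = 0 :=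
  dif_neg M.graph.irrefl

/-- The exponent of the weight, as a sum over ordered pairs of vertices. -/
def energy (M : PottsModel n q) (σ : Fin n → Fin q) : ℝ :=
  1 / 2 * (∑ u, ∑ v, if σ u = σ v then M.coup u v else 0) + ∑ v, M.field v (σ v)

theorem sum_sym2_nondiag (g : Sym2 (Fin n) → ℝ) (hg : ∀ e, e.IsDiag → g e = 0) :
    ∑ e, g e = 1 / 2 * ∑ u, ∑ v, g s(u, v) := by
  have h1 : ∑ e, g e = ∑ e ∈ Finset.univ.sym2 with ¬ e.IsDiag, g e := by
    rw [Finset.sum_filter, Finset.sym2_univ]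
    refine Finset.sum_congr rfl fun e _ => ?_
    by_cases h : e.IsDiag
    · simp [h, hg e h]
    · simp [h]
  rw [h1, Finset.sum_sym2_filter_not_isDiag, ← Finset.sum_product', Finset.univ_product_univ]
  have h2 : ∑ x : Fin n × Fin n, g s(x.1, x.2) =
      ∑ x : Fin n × Fin n, (if x.1 < x.2 then g s(x.1, x.2) else 0) +
      ∑ x : Fin n × Fin n, (if x.1 < x.2 then g s(x.1, x.2) else 0) := by
    conv_rhs =>
      enter [2]
      rw [← (Equiv.prodComm (Fin n) (Fin n)).sum_comp]
    rw [← Finset.sum_add_distrib]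
    refine Finset.sum_congr rfl fun x _ => ?_
    simp only [Equiv.prodComm_apply, Prod.fst_swap, Prod.snd_swap]
    rcases lt_trichotomy x.1 x.2 with h | h | h
    · simp [h, h.not_gt]
    · simp [h, hg]
    · simp [h, h.not_gt, Sym2.eq_swap]
  have h3 : ∑ x ∈ Finset.univ.offDiag with x.1 < x.2, g s(x.1, x.2) =
      ∑ x : Fin n × Fin n, (if x.1 < x.2 then g s(x.1, x.2) else 0) := by
    rw [← Finset.sum_filter]
    refine Finset.sum_congr ?_ fun _ _ => rfl
    ext x
    simp only [Finset.mem_filter, Finset.mem_offDiag, Finset.mem_univ, true_and]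
    exact ⟨fun h => h.2, fun h => ⟨h.ne, h⟩⟩
  rw [h2, h3]
  ring

theorem weight_eq_exp_energy (M : PottsModel n q) (σ : Fin n → Fin q) :
    M.weight σ = Real.exp (M.energy σ) := by
  classical
  rw [weight, energy]
  congr 2
  set g : Sym2 (Fin n) → ℝ := fun e =>
    if h : e ∈ M.graph.edgeSet then if (Sym2.map σ e).IsDiag then M.edgeWeight ⟨e, h⟩ else 0
    else 0 with hg
  have h1 : (∑ e : M.graph.edgeSet, if (Sym2.map σ e.1).IsDiag then M.edgeWeight e else 0) =
      ∑ e, g e := by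
    rw [← Finset.sum_subset (Finset.subset_univ M.graph.edgeSet.toFinset)
      (fun e _ he => by simp only [Set.mem_toFinset] at he; simp [hg, he]), ← Finset.sum_set_coe]
    refine Finset.sum_congr rfl fun e _ => ?_
    simp [hg, e.2]
  have h2 := sum_sym2_nondiag g (fun e he => by
    simp only [hg]
    rw [dif_neg fun h => M.graph.not_isDiag_of_mem_edgeSet h he])
  refine Eq.trans (by convert h1) (h2.trans ?_)
  congr 1
  refine Finset.sum_congr rfl fun u _ => Finset.sum_congr rfl fun v _ => ?_
  simp only [hg, coup, Sym2.map_mk, Sym2.mk_isDiag_iff, SimpleGraph.mem_edgeSet]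
  by_cases h : M.graph.Adj u v <;> simp [h]

end PottsModel

/-! ### Gadgets -/

section

variable {Γ : Type*} [Fintype Γ] {q : ℕ}

open Classical in
/-- The number of ordered adjacent pairs on which `τ` is not constant. -/
def viol (H : SimpleGraph Γ) (τ : Γ → Fin q) : ℕ :=
  (Finset.univ.filter fun p : Γ × Γ => H.Adj p.1 p.2 ∧ τ p.1 ≠ τ p.2).card

theorem card_le_viol {H : SimpleGraph Γ} {τ : Γ → Fin q} {ι : Type*} (s : Finset ι)
    (f : ι → Γ × Γ) (hf : ∀ x ∈ s, H.Adj (f x).1 (f x).2 ∧ τ (f x).1 ≠ τ (f x).2)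
    (hinj : ∀ x ∈ s, ∀ y ∈ s, f x = f y → x = y) : s.card ≤ viol H τ := by
  classical
  exact Finset.card_le_card_of_injOn f (fun x hx => by simpa using hf x hx)
    (fun x hx y hy h => hinj x hx y hy h)

/-- A tree penalizes non-constant configurations: if every vertex but the root has a parent of
smaller rank, and each vertex that differs from its parent costs a factor `e`, then the non-constant
configurations have total weight at most `q ((1 + q e) ^ |Γ| - 1)`. -/
theorem sum_tree_le [NeZero q] (root : Γ) (par : Γ → Γ) (rank : Γ → ℕ)
    (hpar : ∀ x, x ≠ root → rank (par x) < rank x) {e : ℝ} (he : 0 ≤ e)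
    (F : Finset (Γ → Fin q)) (hF : ∀ τ ∈ F, ∃ x, τ x ≠ τ root) :
    (∑ τ ∈ F, ∏ x, if τ x = τ (par x) then 1 else e) ≤
      q * ((1 + q * e) ^ Fintype.card Γ - 1) := by
  classical
  set D : (Γ → Fin q) → Fin q × (Γ → Fin q) := fun τ => (τ root, fun x => τ x - τ (par x)) with hD
  set g : (Γ → Fin q) → ℝ := fun δ => ∏ x, if δ x = 0 then 1 else e with hg
  have hconst : ∀ τ : Γ → Fin q, (∀ x, τ x = τ (par x)) → ∀ x, τ x = τ root := by
    intro τ h x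
    induction hr : rank x using Nat.strong_induction_on generalizing x with
    | _ r ih =>
      by_cases hx : x = root
      · rw [hx]
      · rw [h x]
        exact ih _ (hr ▸ hpar x hx) _ rfl
  have hinj : Function.Injective D := by
    intro τ τ' h
    simp only [hD, Prod.mk.injEq] at h
    obtain ⟨h1, h2⟩ := h
    funext x
    induction hr : rank x using Nat.strong_induction_on generalizing x with
    | _ r ih =>
      by_cases hx : x = root
      · rw [hx, h1]
      · have h3 := congrFun h2 x
        rw [ih _ (hr ▸ hpar x hx) (par x) rfl] at h3
        exact sub_left_injective h3
  have hgnn : ∀ δ, 0 ≤ g δ := fun δ => Finset.prod_nonneg fun x _ => by split_ifs <;> linarith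
  have hterm : ∀ τ : Γ → Fin q, (∏ x, if τ x = τ (par x) then 1 else e) = g (D τ).2 := by
    intro τ
    refine Finset.prod_congr rfl fun x _ => ?_
    simp [hD, sub_eq_zero]
  have hsum : ∑ δ : Γ → Fin q, g δ ≤ (1 + q * e) ^ Fintype.card Γ := by
    have h1 : ∑ δ : Γ → Fin q, g δ = ∏ _x : Γ, ∑ c : Fin q, (if c = 0 then 1 else e) := by
      rw [Finset.prod_univ_sum, Fintype.piFinset_univ]
    have h2 : ∑ c : Fin q, (if c = 0 then 1 else e) ≤ 1 + q * e := by
      calc ∑ c : Fin q, (if c = 0 then 1 else e) ≤ ∑ c : Fin q, ((if c = 0 then 1 else 0) + e) :=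
            Finset.sum_le_sum fun c _ => by split_ifs <;> linarith
        _ = 1 + q * e := by simp [Finset.sum_add_distrib]
    rw [h1, Finset.prod_const, Finset.card_univ]
    exact pow_le_pow_left₀ (Finset.sum_nonneg fun c _ => by split_ifs <;> linarith) h2 _
  calc (∑ τ ∈ F, ∏ x, if τ x = τ (par x) then 1 else e)
      = ∑ τ ∈ F, g (D τ).2 := Finset.sum_congr rfl fun τ _ => hterm τ
    _ = ∑ p ∈ F.image D, g p.2 := by
        rw [Finset.sum_image hinj.injOn]
    _ ≤ ∑ p ∈ (Finset.univ : Finset (Fin q)) ×ˢ (Finset.univ.filter fun δ : Γ → Fin q => δ ≠ 0),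
          g p.2 := by
        refine Finset.sum_le_sum_of_subset_of_nonneg ?_ fun _ _ _ => hgnn _
        intro p hp
        obtain ⟨τ, hτ, rfl⟩ := Finset.mem_image.1 hp
        obtain ⟨x, hx⟩ := hF τ hτ
        simp only [Finset.mem_product, Finset.mem_univ, Finset.mem_filter, true_and]
        intro h0
        refine hx (hconst τ (fun y => ?_) x)
        exact sub_eq_zero.1 (congrFun h0 y)
    _ = q * (∑ δ : Γ → Fin q, g δ - 1) := by
        rw [Finset.sum_product]
        simp only [Finset.sum_const, Finset.card_univ, Fintype.card_fin, nsmul_eq_mul]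
        congr 1
        rw [eq_sub_iff_add_eq, ← Finset.sum_filter_add_sum_filter_not Finset.univ (fun δ => δ ≠ 0)]
        congr 1
        rw [Finset.sum_eq_single 0] <;> simp [hg]
    _ ≤ _ := by gcongr

/-- Averaging over a family of trees: if the tree edges of all trees together are distinct ordered
pairs of adjacent vertices, then each configuration violates on one of the trees at most the average
number of edges. -/
theorem sum_nonconst_le [NeZero q] {s : ℕ} (hs : 0 < s) (H : SimpleGraph Γ) (root : Fin s → Γ)
    (par : Fin s → Γ → Γ) (rank : Fin s → Γ → ℕ) (hroot : ∀ j, par j (root j) = root j)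
    (hpar : ∀ j x, x ≠ root j → rank j (par j x) < rank j x ∧ H.Adj (par j x) x)
    (hinj : ∀ j j' x, x ≠ root j → x ≠ root j' → par j x = par j' x → j = j')
    {w : ℝ} (hw : 0 ≤ w) (F : Finset (Γ → Fin q)) (hF : ∀ τ ∈ F, ∃ x y, τ x ≠ τ y) :
    ∑ τ ∈ F, Real.exp (-w * viol H τ) ≤
      s * (q * ((1 + q * Real.exp (-w * s)) ^ Fintype.card Γ - 1)) := by
  classical
  set V : Fin s → (Γ → Fin q) → ℕ := fun j τ =>
    (Finset.univ.filter fun x => τ x ≠ τ (par j x)).card with hV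
  have hVsum : ∀ τ, ∑ j, V j τ ≤ viol H τ := by
    intro τ
    rw [← Finset.card_sigma]
    refine card_le_viol _ (fun p => (par p.1 p.2, p.2)) ?_ ?_
    · rintro ⟨j, x⟩ h
      simp only [Finset.mem_sigma, Finset.mem_univ, Finset.mem_filter, true_and] at h
      have hx : x ≠ root j := by
        rintro rfl
        exact h (by rw [hroot])
      exact ⟨(hpar j x hx).2, h.symm⟩
    · rintro ⟨j, x⟩ h ⟨j', x'⟩ h' heq
      simp only [Finset.mem_sigma, Finset.mem_univ, Finset.mem_filter, true_and] at h h'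
      simp only [Prod.mk.injEq] at heq
      obtain ⟨h1, rfl⟩ := heq
      have hx : x ≠ root j := by
        rintro rfl
        exact h (by rw [hroot])
      have hx' : x ≠ root j' := by
        rintro rfl
        exact h' (by rw [hroot])
      obtain rfl := hinj j j' x hx hx' h1
      rfl
  have hprod : ∀ j (τ : Γ → Fin q), (∏ x, if τ x = τ (par j x) then 1 else Real.exp (-w * s)) =
      Real.exp (-w * s * V j τ) := by
    intro j τ
    have : ∀ x, (if τ x = τ (par j x) then 1 else Real.exp (-w * s)) =
        Real.exp (if τ x ≠ τ (par j x) then -w * s else 0) := by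
      intro x
      by_cases h : τ x = τ (par j x) <;> simp [h]
    simp only [this]
    rw [← Real.exp_sum, ← Finset.sum_filter, Finset.sum_const, nsmul_eq_mul, mul_comm]
  have hone : ∀ τ : Γ → Fin q, Real.exp (-w * viol H τ) ≤
      ∑ j, ∏ x, if τ x = τ (par j x) then 1 else Real.exp (-w * s) := by
    intro τ
    obtain ⟨j, -, hj⟩ : ∃ j ∈ (Finset.univ : Finset (Fin s)),
        (V j τ : ℝ) ≤ viol H τ / s := by
      refine Finset.exists_le_of_sum_le ⟨⟨0, hs⟩, Finset.mem_univ _⟩ ?_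
      rw [Finset.sum_const, Finset.card_univ, Fintype.card_fin, nsmul_eq_mul,
        mul_div_cancel₀ _ (by positivity)]
      exact_mod_cast hVsum τ
    refine le_trans ?_ (Finset.single_le_sum (f := fun j => ∏ x, if τ x = τ (par j x) then 1
      else Real.exp (-w * s)) (fun j _ => Finset.prod_nonneg fun x _ => by
        split_ifs <;> positivity) (Finset.mem_univ j))
    rw [hprod, Real.exp_le_exp]
    rw [le_div_iff₀ (by positivity)] at hj
    nlinarith
  calc ∑ τ ∈ F, Real.exp (-w * viol H τ)
      ≤ ∑ τ ∈ F, ∑ j, ∏ x, (if τ x = τ (par j x) then 1 else Real.exp (-w * s)) :=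
        Finset.sum_le_sum fun τ _ => hone τ
    _ = ∑ j, ∑ τ ∈ F, ∏ x, (if τ x = τ (par j x) then 1 else Real.exp (-w * s)) :=
        Finset.sum_comm
    _ ≤ ∑ _j : Fin s, q * ((1 + q * Real.exp (-w * s)) ^ Fintype.card Γ - 1) :=
        Finset.sum_le_sum fun j _ => by
          refine sum_tree_le (root j) (par j) (rank j) (fun x hx => (hpar j x hx).1)
            (Real.exp_pos (-w * s)).le F fun τ hτ => ?_
          obtain ⟨x, y, h⟩ := hF τ hτ
          by_contra! h'
          exact h ((h' x).trans (h' y).symm)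
    _ = _ := by simp

end

/-! ### The layered gadget -/

/-- Layers come in `R` rows of `2 R`. For `r < c`, the chord between row `r` and row `c` joins layer
`2 c` of row `r` to layer `2 r + 1` of row `c`. -/
def LayerChord (R a b : ℕ) : Prop :=
  ∃ r c, r < c ∧ c < R ∧ a = 2 * (R * r + c) ∧ b = 2 * (R * c + r) + 1

/-- Layers are adjacent if they are consecutive or joined by a chord. -/
def LayerAdj (R a b : ℕ) : Prop := a + 1 = b ∨ b + 1 = a ∨ LayerChord R a b ∨ LayerChord R b a

theorem LayerAdj.symm {R a b : ℕ} (h : LayerAdj R a b) : LayerAdj R b a := by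
  rcases h with h | h | h | h
  · exact Or.inr (Or.inl h)
  · exact Or.inl h
  · exact Or.inr (Or.inr (Or.inr h))
  · exact Or.inr (Or.inr (Or.inl h))

theorem LayerAdj.parity {R a b : ℕ} (h : LayerAdj R a b) : a % 2 ≠ b % 2 := by
  rcases h with h | h | ⟨r, c, -, -, h1, h2⟩ | ⟨r, c, -, -, h1, h2⟩ <;> omega

/-- Every layer has at most three neighbours; the third one exchanges row and position. -/
theorem LayerAdj.eq_or {R a b : ℕ} (h : LayerAdj R a b) :
    b = a + 1 ∨ b = a - 1 ∨ b = 2 * (R * (a / 2 % R) + a / 2 / R) + (1 - a % 2) := by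
  rcases h with h | h | ⟨r, c, h0, hc, rfl, rfl⟩ | ⟨r, c, h0, hc, rfl, rfl⟩
  · omega
  · omega
  · right; right
    rw [show 2 * (R * r + c) / 2 = c + R * r by omega, Nat.add_mul_mod_self_left,
      Nat.add_mul_div_left _ _ (by omega), Nat.mod_eq_of_lt hc, Nat.div_eq_of_lt hc]
    omega
  · right; right
    have hr : r < R := h0.trans hc
    rw [show (2 * (R * c + r) + 1) / 2 = r + R * c by omega, Nat.add_mul_mod_self_left,
      Nat.add_mul_div_left _ _ (by omega), Nat.mod_eq_of_lt hr, Nat.div_eq_of_lt hr]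
    omega

/-- The layer in row `r` that serves the port to block `r`, in block `u`. The two layers in the
middle of a row are not used by chords. -/
def portLayer (R u r : ℕ) : ℕ := 2 * (R * r + r) + if r < u then 1 else 0

theorem LayerAdj.eq_or_of_port {R u r b : ℕ} (hr : r < R) (h : LayerAdj R (portLayer R u r) b) :
    b = portLayer R u r + 1 ∨ b = portLayer R u r - 1 := by
  have key : ∀ r' c', r' < R → c' < R → R * r + r = R * r' + c' → r' = c' := by
    intro r' c' h1 h2 h3
    have e1 := congrArg (· / R) h3
    have e2 := congrArg (· % R) h3
    simp only [Nat.add_comm (R * _), Nat.add_mul_div_left _ _ (show 0 < R by omega),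
      Nat.add_mul_mod_self_left, Nat.mod_eq_of_lt hr, Nat.mod_eq_of_lt h2, Nat.div_eq_of_lt hr,
      Nat.div_eq_of_lt h2, Nat.zero_add] at e1 e2
    omega
  rw [portLayer] at h ⊢
  rcases h with h | h | ⟨r', c, h0, hc, h1, h2⟩ | ⟨r', c, h0, hc, h1, h2⟩
  · omega
  · omega
  · have := key r' c (by omega) hc (by split_ifs at h1 <;> omega)
    omega
  · have := key c r' hc (by omega) (by split_ifs at h2 <;> omega)
    omega

/-- The graph on `L` vertices in which consecutive sets of `s` vertices form the layers and adjacent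
layers are completely joined. -/
def gadget (R s L : ℕ) : SimpleGraph (Fin L) where
  Adj i j := LayerAdj R (i / s) (j / s)
  symm := ⟨fun _ _ h => h.symm⟩
  loopless := ⟨fun _ h => h.parity rfl⟩

/-- Vertex `k` of layer `a`. -/
def slot (s a k : ℕ) : ℕ := a * s + k

theorem slot_div {s a k : ℕ} (hk : k < s) : slot s a k / s = a := by
  rw [slot, Nat.add_comm, Nat.add_mul_div_right _ _ (by omega), Nat.div_eq_of_lt hk, Nat.zero_add]

theorem slot_mod {s a k : ℕ} (hk : k < s) : slot s a k % s = k := by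
  rw [slot, Nat.add_comm, Nat.add_mul_mod_self_right, Nat.mod_eq_of_lt hk]

theorem slot_inj {s a b k l : ℕ} (hk : k < s) (hl : l < s) (h : slot s a k = slot s b l) :
    a = b ∧ k = l :=
  ⟨by rw [← slot_div (a := a) hk, h, slot_div hl], by rw [← slot_mod (a := a) hk, h, slot_mod hl]⟩

theorem slot_lt {R s L a k : ℕ} (hL : 2 * R * R * s ≤ L) (ha : a < 2 * R * R) (hk : k < s) :
    slot s a k < L := by
  have : (a + 1) * s ≤ 2 * R * R * s := Nat.mul_le_mul_right s ha
  rw [slot]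
  rw [Nat.succ_mul] at this
  omega

theorem row_lt {R r p : ℕ} (hr : r < R) (hp : p < 2 * R) : 2 * R * r + p < 2 * R * R := by
  have : 2 * R * (r + 1) ≤ 2 * R * R := Nat.mul_le_mul_left _ hr
  rw [Nat.mul_succ] at this
  omega

theorem row_inj {R r r' p p' : ℕ} (hp : p < 2 * R) (hp' : p' < 2 * R)
    (h : 2 * R * r + p = 2 * R * r' + p') : r = r' ∧ p = p' := by
  have e1 := congrArg (· / (2 * R)) h
  have e2 := congrArg (· % (2 * R)) h
  simp only [Nat.add_comm (2 * R * _), Nat.add_mul_div_left _ _ (show 0 < 2 * R by omega),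
    Nat.add_mul_mod_self_left, Nat.mod_eq_of_lt hp, Nat.mod_eq_of_lt hp', Nat.div_eq_of_lt hp,
    Nat.div_eq_of_lt hp', Nat.zero_add] at e1 e2
  exact ⟨e1, e2⟩

theorem portLayer_eq (R u r : ℕ) :
    portLayer R u r = 2 * R * r + (2 * r + if r < u then 1 else 0) := by
  rw [portLayer]; ring

theorem portLayer_pos_lt {R u r : ℕ} (hr : r < R) : (2 * r + if r < u then 1 else 0) < 2 * R := by
  split_ifs <;> omega

/-- The vertex with number `k` of the port layer of row `r`, in block `u`. -/
def port (R s u r k : ℕ) : ℕ := slot s (portLayer R u r) k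

theorem port_lt {R s L u r k : ℕ} (hL : 2 * R * R * s ≤ L) (hr : r < R) (hk : k < s) :
    port R s u r k < L := by
  refine slot_lt hL ?_ hk
  rw [portLayer_eq]
  exact row_lt hr (portLayer_pos_lt hr)

theorem port_inj {R s u r r' k k' : ℕ} (hr : r < R) (hr' : r' < R) (hk : k < s) (hk' : k' < s)
    (h : port R s u r k = port R s u r' k') : r = r' ∧ k = k' := by
  obtain ⟨h1, h2⟩ := slot_inj hk hk' h
  rw [portLayer_eq, portLayer_eq] at h1
  exact ⟨(row_inj (portLayer_pos_lt hr) (portLayer_pos_lt hr') h1).1, h2⟩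

theorem ncard_layers_le {s L : ℕ} (S : Finset ℕ) (hs : 0 < s) (N : Set (Fin L))
    (hN : ∀ j ∈ N, (j : ℕ) / s ∈ S) : N.ncard ≤ S.card * s := by
  classical
  have h := Set.ncard_le_ncard_of_injOn (s := N) (t := (S ×ˢ Finset.range s : Finset (ℕ × ℕ)))
    (fun j => ((j : ℕ) / s, (j : ℕ) % s)) (fun j hj => by
      simp only [Finset.coe_product, Set.mem_prod, Finset.mem_coe, Finset.mem_range]
      exact ⟨hN j hj, Nat.mod_lt _ hs⟩) (fun i _ j _ h => by
      simp only [Prod.mk.injEq] at h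
      ext
      rw [← Nat.div_add_mod (i : ℕ) s, h.1, h.2, Nat.div_add_mod])
  rwa [Set.ncard_coe_finset, Finset.card_product, Finset.card_range] at h

theorem ncard_gadget_le {R s L : ℕ} (hs : 0 < s) (i : Fin L) :
    ((gadget R s L).neighborSet i).ncard ≤ 3 * s := by
  classical
  refine (ncard_layers_le {(i : ℕ) / s + 1, (i : ℕ) / s - 1,
    2 * (R * ((i : ℕ) / s / 2 % R) + (i : ℕ) / s / 2 / R) + (1 - (i : ℕ) / s % 2)} hs _
    fun j hj => ?_).trans
    (Nat.mul_le_mul_right s Finset.card_le_three)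
  simp only [Finset.mem_insert, Finset.mem_singleton]
  exact LayerAdj.eq_or hj

theorem ncard_gadget_port_le {R s L u r k : ℕ} (hr : r < R) (hk : k < s) (i : Fin L)
    (hi : (i : ℕ) = port R s u r k) : ((gadget R s L).neighborSet i).ncard ≤ 2 * s := by
  classical
  refine (ncard_layers_le {portLayer R u r + 1, portLayer R u r - 1} (by omega) _
    fun j hj => ?_).trans (Nat.mul_le_mul_right s Finset.card_le_two)
  simp only [Finset.mem_insert, Finset.mem_singleton]
  refine LayerAdj.eq_or_of_port hr ?_
  have h : LayerAdj R ((i : ℕ) / s) (j / s) := hj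
  rwa [hi, port, slot_div hk] at h

section

variable {R s L q : ℕ}

/-- Non-constant configurations of the gadget are rare: the rows form one long path, which carries
`s` spanning trees, one through each number `k < s`, in which every vertex hangs on vertex `k` of
the previous layer. -/
theorem gadget_sum_nonconst_le [NeZero q] (hs : 0 < s) (hL : 2 * s ≤ L) {w : ℝ} (hw : 0 ≤ w)
    (F : Finset (Fin L → Fin q)) (hF : ∀ τ ∈ F, ∃ x y, τ x ≠ τ y) :
    ∑ τ ∈ F, Real.exp (-w * viol (gadget R s L) τ) ≤
      s * (q * ((1 + q * Real.exp (-w * s)) ^ L - 1)) := by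
  have hbound : ∀ (j : Fin s) (x : Fin L), ((x : ℕ) / s - 1) * s + j < L := by
    intro j x
    have h1 := Nat.div_mul_le_self (x : ℕ) s
    rcases Nat.eq_zero_or_pos ((x : ℕ) / s) with h0 | h0
    · rw [h0]; omega
    · obtain ⟨m, hm⟩ : ∃ m, (x : ℕ) / s = m + 1 := ⟨_, (Nat.sub_add_cancel h0).symm⟩
      rw [hm, Nat.succ_mul] at h1
      rw [hm, Nat.add_sub_cancel]
      omega
  set root : Fin s → Fin L := fun j => ⟨j, by omega⟩ with hroot
  set par : Fin s → Fin L → Fin L := fun j x =>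
    if (x : ℕ) / s = 0 then if x = root j then x else ⟨slot s 1 j, by simp only [slot]; omega⟩
    else ⟨slot s ((x : ℕ) / s - 1) j, hbound j x⟩ with hpar
  set rank : Fin s → Fin L → ℕ := fun j x =>
    if (x : ℕ) / s = 0 then if x = root j then 0 else 2 else (x : ℕ) / s with hrank
  have root_div : ∀ j : Fin s, ((root j : Fin L) : ℕ) / s = 0 := fun j => Nat.div_eq_of_lt j.2
  have := sum_nonconst_le hs (gadget R s L) root par rank ?_ ?_ ?_ hw F hF
  · simpa using this
  · intro j
    simp only [hpar, root_div, if_true]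
  · intro j x hx
    by_cases h0 : (x : ℕ) / s = 0
    · simp only [hpar, hrank, h0, hx, if_true, if_false, slot_div j.2, one_ne_zero]
      refine ⟨by norm_num, ?_⟩
      change LayerAdj R (slot s 1 j / s) (x / s)
      rw [slot_div j.2, h0]
      exact Or.inr (Or.inl rfl)
    · simp only [hpar, hrank, h0, if_false, slot_div j.2]
      constructor
      · split_ifs with h1 h2
        · exact Nat.pos_of_ne_zero h0
        · refine absurd ?_ h2
          ext
          simp [slot, h1, hroot]
        · omega
      · change LayerAdj R (slot s ((x : ℕ) / s - 1) j / s) (x / s)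
        rw [slot_div j.2]
        exact Or.inl (Nat.sub_add_cancel (Nat.pos_of_ne_zero h0))
  · intro j j' x hx hx' h
    by_cases h0 : (x : ℕ) / s = 0
    · simp only [hpar, h0, hx, hx', if_true, if_false, Fin.mk.injEq] at h
      exact Fin.ext (slot_inj j.2 j'.2 h).2
    · simp only [hpar, h0, if_false] at h
      exact Fin.ext (slot_inj j.2 j'.2 (Fin.mk.inj_iff.1 h)).2

open Classical in
/-- The gadget has large conductance between its ports: any two rows are joined by `s ^ 2` chord
edges, so that the number of pairs of ports with different spins is controlled by the violated
row edges and chord edges. Averaging over the ports yields a spin from which few ports differ. -/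
theorem exists_spin_of_ports (hR : 0 < R) (hs : 0 < s) (hL : 2 * R * R * s ≤ L)
    (τ : Fin L → Fin q) (u : ℕ) : ∃ c, (Finset.univ.filter fun x : Fin R × Fin s =>
      τ ⟨port R s u x.1 x.2, port_lt hL x.1.2 x.2.2⟩ ≠ c).card ≤ 3 * viol (gadget R s L) τ := by
  set X := Fin R × Fin s with hX
  -- position `p` of row `x.1`, with number `x.2`
  let v : X → Fin (2 * R) → Fin L := fun x p =>
    ⟨slot s (2 * R * x.1 + p) x.2, slot_lt hL (row_lt x.1.2 p.2) x.2.2⟩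
  have v_inj : ∀ {x y : X} {p p' : Fin (2 * R)}, v x p = v y p' → x = y ∧ p = p' := by
    intro x y p p' h
    obtain ⟨h1, h2⟩ := slot_inj x.2.2 y.2.2 (Fin.mk.inj_iff.1 h)
    obtain ⟨h3, h4⟩ := row_inj p.2 p'.2 h1
    exact ⟨Prod.ext (Fin.ext h3) (Fin.ext h2), Fin.ext h4⟩
  have v_adj : ∀ (x y : X) (p p' : Fin (2 * R)), LayerAdj R (2 * R * x.1 + p) (2 * R * y.1 + p') →
      (gadget R s L).Adj (v x p) (v y p') := by
    intro x y p p' h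
    change LayerAdj R (slot s _ _ / s) (slot s _ _ / s)
    rwa [slot_div x.2.2, slot_div y.2.2]
  -- violated edges of a row
  let V : X → Finset (Fin (2 * R - 1)) := fun x => Finset.univ.filter fun p =>
    τ (v x ⟨p, by omega⟩) ≠ τ (v x ⟨p + 1, by omega⟩)
  have hV : ∑ x, (V x).card ≤ viol (gadget R s L) τ := by
    rw [← Finset.card_sigma]
    refine card_le_viol _ (fun p => (v p.1 ⟨p.2, by omega⟩, v p.1 ⟨p.2 + 1, by omega⟩)) ?_ ?_
    · rintro ⟨x, p⟩ h
      simp only [V, Finset.mem_sigma, Finset.mem_univ, Finset.mem_filter, true_and] at h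
      exact ⟨v_adj _ _ _ _ (Or.inl (add_assoc _ _ _)), h⟩
    · rintro ⟨x, p⟩ - ⟨y, p'⟩ - h
      obtain ⟨rfl, h2⟩ := v_inj (Prod.mk.inj h).1
      simp only [Fin.mk.injEq] at h2
      rw [Fin.ext h2]
  have hVrow : ∀ x (p p' : Fin (2 * R)), (V x).card = 0 → τ (v x p) = τ (v x p') := by
    intro x p p' h
    rw [Finset.card_eq_zero, Finset.filter_eq_empty_iff] at h
    have h0 : ∀ m (hm : m < 2 * R), τ (v x ⟨m, hm⟩) = τ (v x ⟨0, by omega⟩) := by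
      intro m
      induction m with
      | zero => intro _; rfl
      | succ m ih =>
        intro hm
        have := h (Finset.mem_univ (⟨m, by omega⟩ : Fin (2 * R - 1)))
        rw [not_not] at this
        rw [← this, ih (by omega)]
    rw [h0 p p.2, h0 p' p'.2]
  -- the chord between two rows, or an edge in the middle of a row if they are the same
  let f : X → X → Fin (2 * R) := fun x y =>
    ⟨2 * y.1 + if (y.1 : ℕ) < x.1 then 1 else 0, by split_ifs <;> omega⟩
  let g : X → X → Fin (2 * R) := fun x y =>
    ⟨2 * x.1 + if (x.1 : ℕ) ≤ y.1 then 1 else 0, by split_ifs <;> omega⟩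
  let C : Finset (X × X) := Finset.univ.filter fun z =>
    τ (v z.1 (f z.1 z.2)) ≠ τ (v z.2 (g z.1 z.2))
  have hC : C.card ≤ viol (gadget R s L) τ := by
    refine card_le_viol _ (fun z => (v z.1 (f z.1 z.2), v z.2 (g z.1 z.2))) ?_ ?_
    · rintro ⟨x, y⟩ h
      simp only [C, Finset.mem_univ, Finset.mem_filter, true_and] at h
      refine ⟨v_adj _ _ _ _ ?_, h⟩
      simp only [f, g]
      rcases lt_trichotomy (x.1 : ℕ) y.1 with hlt | heq | hlt
      · refine Or.inr (Or.inr (Or.inl ⟨x.1, y.1, hlt, y.1.2, ?_, ?_⟩))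
        · rw [if_neg hlt.not_gt]; ring
        · rw [if_pos hlt.le]; ring
      · refine Or.inl ?_
        rw [heq, if_neg (lt_irrefl _), if_pos le_rfl]
        ring
      · refine Or.inr (Or.inr (Or.inr ⟨y.1, x.1, hlt, x.1.2, ?_, ?_⟩))
        · rw [if_neg hlt.not_ge]; ring
        · rw [if_pos hlt]; ring
    · rintro ⟨x, y⟩ - ⟨x', y'⟩ - h
      obtain ⟨h1, h2⟩ := Prod.mk.inj h
      exact Prod.ext (v_inj h1).1 (v_inj h2).1
  -- the ports
  let P : X → Fin L := fun x => ⟨port R s u x.1 x.2, port_lt hL x.1.2 x.2.2⟩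
  have hP : ∀ x, ∃ p, P x = v x p := fun x => ⟨⟨_, portLayer_pos_lt (u := u) x.1.2⟩, by
    simp only [P, v, port, portLayer_eq]⟩
  let E : X → X → ℕ := fun x y => if τ (P x) ≠ τ (P y) then 1 else 0
  have hE : ∀ x y, E x y ≤ (V x).card + (V y).card + if (x, y) ∈ C then 1 else 0 := by
    intro x y
    by_contra! hlt
    have hE1 : E x y ≤ 1 := by simp only [E]; split_ifs <;> simp
    have h1 : (V x).card = 0 := by omega
    have h2 : (V y).card = 0 := by omega
    have h3 : (x, y) ∉ C := fun h => by rw [if_pos h] at hlt; omega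
    have h4 : E x y ≠ 0 := by omega
    simp only [E, ne_eq, ite_eq_right_iff, one_ne_zero, imp_false, not_not] at h4
    obtain ⟨p, hp⟩ := hP x
    obtain ⟨p', hp'⟩ := hP y
    refine h4 ?_
    simp only [C, Finset.mem_filter, Finset.mem_univ, true_and, not_not] at h3
    rw [hp, hp', hVrow x p (f x y) h1, h3, hVrow y p' (g x y) h2]
  have hcard : Fintype.card X = R * s := by simp [hX]
  have hRs : 0 < R * s := Nat.mul_pos hR hs
  have htotal : ∑ y, ∑ x, E x y ≤ ∑ _y : X, 3 * viol (gadget R s L) τ := by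
    calc ∑ y, ∑ x, E x y
        ≤ ∑ y, ∑ x, ((V x).card + (V y).card + if (x, y) ∈ C then 1 else 0) :=
          Finset.sum_le_sum fun y _ => Finset.sum_le_sum fun x _ => hE x y
      _ = R * s * ∑ x, (V x).card + R * s * ∑ x, (V x).card + C.card := by
          simp only [Finset.sum_add_distrib, Finset.sum_const, Finset.card_univ, hcard, smul_eq_mul,
            ← Finset.mul_sum]
          congr 1
          rw [Finset.sum_comm,
            ← Fintype.sum_prod_type' (f := fun x y => if (x, y) ∈ C then 1 else 0)]
          simp
      _ ≤ R * s * viol (gadget R s L) τ + R * s * viol (gadget R s L) τ +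
            R * s * viol (gadget R s L) τ := by
          gcongr
          exact hC.trans (Nat.le_mul_of_pos_left _ hRs)
      _ = ∑ _y : X, 3 * viol (gadget R s L) τ := by
          rw [Finset.sum_const, Finset.card_univ, hcard, smul_eq_mul]
          ring
  obtain ⟨y, -, hy⟩ := Finset.exists_le_of_sum_le
    (⟨(⟨0, hR⟩, ⟨0, hs⟩), Finset.mem_univ _⟩ : (Finset.univ : Finset X).Nonempty) htotal
  refine ⟨τ (P y), le_trans (le_of_eq ?_) hy⟩
  simp only [E, Finset.card_filter]
  rfl

end

namespace PottsModel

/-! ### Blockwise constant configurations -/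

variable {n N q : ℕ}

theorem gibbs_toReal [NeZero q] (M : PottsModel n q) (σ : Fin n → Fin q) :
    (M.gibbs σ).toReal = M.weight σ / M.partitionFunction := by
  rw [gibbs, PMF.ofFintype_apply, ENNReal.toReal_ofReal]
  exact div_nonneg (M.weight_pos σ).le M.partitionFunction_pos.le

/-- `M'` approximates the blow-up of `M` along `u`: the weights of the blockwise constant
configurations are proportional to those of `M`, and all other configurations together have relative
weight at most `δ`. -/
structure Approximates (M : PottsModel n q) (u : Fin N → Fin n) (M' : PottsModel N q)
    (δ : ℝ) : Prop where
  surj : Function.Surjective u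
  weight : ∃ κ : ℝ, 0 < κ ∧ (∀ σ, M'.weight (fun x => σ (u x)) = κ * M.weight σ) ∧
    M'.partitionFunction ≤ (1 + δ) * (κ * M.partitionFunction)

namespace Approximates

variable {M : PottsModel n q} {u : Fin N → Fin n} {M' : PottsModel N q} {δ : ℝ}

theorem injective (h : M.Approximates u M' δ) :
    Function.Injective fun (σ : Fin n → Fin q) (x : Fin N) => σ (u x) :=
  h.surj.injective_comp_right

variable [NeZero q]

/-- The conditional probability of a blockwise constant configuration. -/
theorem exists_ratio (h : M.Approximates u M' δ) : ∃ θ : ℝ, 0 ≤ θ ∧ θ ≤ 1 ∧ 1 - θ ≤ δ ∧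
    ∀ σ, (M'.gibbs fun x => σ (u x)).toReal = θ * (M.gibbs σ).toReal := by
  obtain ⟨κ, hκ, hw, hZ⟩ := h.weight
  have hZ' := M'.partitionFunction_pos
  have hZM := M.partitionFunction_pos
  have hle : κ * M.partitionFunction ≤ M'.partitionFunction := by
    have h1 : κ * M.partitionFunction = ∑ σ : Fin n → Fin q, M'.weight fun x => σ (u x) := by
      rw [partitionFunction, Finset.mul_sum]
      exact Finset.sum_congr rfl fun σ _ => (hw σ).symm
    rw [h1]
    have h2 := Finset.sum_map Finset.univ ⟨_, h.injective (q := q)⟩ M'.weight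
    simp only [Function.Embedding.coeFn_mk] at h2
    rw [← h2]
    exact Finset.sum_le_univ_sum_of_nonneg fun σ => (M'.weight_pos σ).le
  refine ⟨κ * M.partitionFunction / M'.partitionFunction, by positivity, ?_, ?_, fun σ => ?_⟩
  · rwa [div_le_one hZ']
  · have hpos : 0 < κ * M.partitionFunction := by positivity
    rw [one_sub_div hZ'.ne', div_le_iff₀ hZ']
    nlinarith
  · rw [gibbs_toReal, gibbs_toReal, hw]
    field_simp

theorem sum_tsub_le (h : M.Approximates u M' δ) :
    ∑ σ', (M'.gibbs σ' - (M.gibbs.map fun σ x => σ (u x)) σ') ≤ ENNReal.ofReal δ := by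
  classical
  obtain ⟨θ, h0, h1, hδ, hθ⟩ := h.exists_ratio
  set b : (Fin n → Fin q) → Fin N → Fin q := fun σ x => σ (u x) with hb
  have hmap : ∀ σ, M.gibbs σ ≤ (M.gibbs.map b) (b σ) := by
    intro σ
    rw [PMF.map_apply]
    refine le_trans (le_of_eq ?_) (ENNReal.le_tsum σ)
    simp
  have hin : ∀ σ, M'.gibbs (b σ) ≤ (M.gibbs.map b) (b σ) := by
    intro σ
    refine le_trans ?_ (hmap σ)
    rw [← ENNReal.toReal_le_toReal (PMF.apply_ne_top _ _) (PMF.apply_ne_top _ _)]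
    exact (hθ σ).le.trans (mul_le_of_le_one_left ENNReal.toReal_nonneg h1)
  set B : Finset (Fin N → Fin q) := Finset.univ.map ⟨b, h.injective⟩ with hB
  have hsplit : ∀ σ', M'.gibbs σ' - (M.gibbs.map b) σ' ≤ if σ' ∈ B then 0 else M'.gibbs σ' := by
    intro σ'
    split_ifs with hσ
    · obtain ⟨σ, -, rfl⟩ := Finset.mem_map.1 hσ
      exact (tsub_eq_zero_of_le (hin σ)).le
    · exact tsub_le_self
  refine (Finset.sum_le_sum fun σ' _ => hsplit σ').trans ?_
  have hne : ∑ σ', (if σ' ∈ B then 0 else M'.gibbs σ') ≠ ⊤ := by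
    refine (ENNReal.sum_lt_top.2 fun σ' _ => ?_).ne
    split_ifs
    · exact ENNReal.zero_lt_top
    · exact (PMF.apply_ne_top _ _).lt_top
  refine ENNReal.le_ofReal_iff_toReal_le hne (by linarith) |>.2 (le_trans (le_of_eq ?_) hδ)
  have hsum1 : ∀ {m} (K : PottsModel m q), ∑ σ, (K.gibbs σ).toReal = 1 := by
    intro m K
    simp only [gibbs_toReal, ← Finset.sum_div]
    exact div_self K.partitionFunction_pos.ne'
  have hBsum : ∑ σ' ∈ B, (M'.gibbs σ').toReal = θ := by
    rw [hB, Finset.sum_map]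
    simp only [Function.Embedding.coeFn_mk, hb, hθ, ← Finset.mul_sum, hsum1, mul_one]
  rw [ENNReal.toReal_sum fun σ' _ => by
    split_ifs
    · exact ENNReal.zero_ne_top
    · exact PMF.apply_ne_top _ _]
  have : ∀ σ', (if σ' ∈ B then 0 else M'.gibbs σ').toReal =
      (M'.gibbs σ').toReal - if σ' ∈ B then (M'.gibbs σ').toReal else 0 := by
    intro σ'
    split_ifs <;> simp
  simp only [this, Finset.sum_sub_distrib, hsum1, Finset.sum_ite_mem, Finset.univ_inter, hBsum]

theorem tvDist_sub_le {M₁ M₂ : PottsModel n q} {M₁' M₂' : PottsModel N q}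
    (h₁ : M₁.Approximates u M₁' δ) (h₂ : M₂.Approximates u M₂' δ) :
    tvDist M₁.gibbs M₂.gibbs - δ ≤ tvDist M₁'.gibbs M₂'.gibbs := by
  classical
  obtain ⟨θ₁, -, h11, hδ1, hθ1⟩ := h₁.exists_ratio
  obtain ⟨θ₂, -, h21, hδ2, hθ2⟩ := h₂.exists_ratio
  have hsum1 : ∀ {m} (K : PottsModel m q), ∑ σ, (K.gibbs σ).toReal = 1 := by
    intro m K
    simp only [gibbs_toReal, ← Finset.sum_div]
    exact div_self K.partitionFunction_pos.ne'
  have hpt : ∀ σ, |(M₁.gibbs σ).toReal - (M₂.gibbs σ).toReal| ≤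
      |(M₁'.gibbs fun x => σ (u x)).toReal - (M₂'.gibbs fun x => σ (u x)).toReal| +
        ((1 - θ₁) * (M₁.gibbs σ).toReal + (1 - θ₂) * (M₂.gibbs σ).toReal) := by
    intro σ
    rw [hθ1, hθ2]
    have e1 : 0 ≤ (1 - θ₁) * (M₁.gibbs σ).toReal :=
      mul_nonneg (by linarith) ENNReal.toReal_nonneg
    have e2 : 0 ≤ (1 - θ₂) * (M₂.gibbs σ).toReal :=
      mul_nonneg (by linarith) ENNReal.toReal_nonneg
    have e3 := le_abs_self (θ₁ * (M₁.gibbs σ).toReal - θ₂ * (M₂.gibbs σ).toReal)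
    have e4 := neg_abs_le (θ₁ * (M₁.gibbs σ).toReal - θ₂ * (M₂.gibbs σ).toReal)
    rw [abs_le]
    constructor <;> nlinarith
  have h1 := Finset.sum_le_sum fun σ (_ : σ ∈ Finset.univ) => hpt σ
  rw [Finset.sum_add_distrib, Finset.sum_add_distrib, ← Finset.mul_sum, ← Finset.mul_sum, hsum1,
    hsum1] at h1
  have h2 := Finset.sum_map Finset.univ ⟨_, h₁.injective (q := q)⟩
    fun σ' => |(M₁'.gibbs σ').toReal - (M₂'.gibbs σ').toReal|
  simp only [Function.Embedding.coeFn_mk] at h2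
  rw [← h2] at h1
  have h3 := Finset.sum_le_univ_sum_of_nonneg
    (s := Finset.univ.map ⟨_, h₁.injective (q := q)⟩)
    fun σ' => abs_nonneg ((M₁'.gibbs σ').toReal - (M₂'.gibbs σ').toReal)
  simp only [tvDist]
  linarith

end Approximates

end PottsModel

/-! ### The blown-up model -/

/-- Vertex `i` of block `u` is joined to vertex `j` of block `v` by the `k`-th link between them. -/
def PortsMatch (R s u v i j : ℕ) : Prop := ∃ k < s, i = port R s u v k ∧ j = port R s v u k

theorem PortsMatch.symm {R s u v i j : ℕ} (h : PortsMatch R s u v i j) : PortsMatch R s v u j i :=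
  let ⟨k, hk, h1, h2⟩ := h
  ⟨k, hk, h2, h1⟩

/-- Vertex `i` is a port of block `u`. -/
def IsPort (R s u i : ℕ) : Prop := ∃ r < R, ∃ k < s, i = port R s u r k

namespace PottsModel

variable {n q : ℕ}

open Classical in
/-- Every vertex of `M` is replaced by a copy of the gadget, with edge weight `w`; every edge of
`M` is replaced by `s` links between ports, which share its weight; and the external field of a
vertex is shared by the ports of its gadget. -/
def blowUp (M : PottsModel n q) (R s L : ℕ) (w : ℝ) : PottsModel (n * L) q where
  graph :=
    { Adj := fun x y => (x.divNat = y.divNat ∧ (gadget R s L).Adj x.modNat y.modNat) ∨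
        (M.graph.Adj x.divNat y.divNat ∧ PortsMatch R s x.divNat y.divNat x.modNat y.modNat)
      symm := ⟨fun _ _ h => h.imp (fun h => ⟨h.1.symm, h.2.symm⟩) fun h => ⟨h.1.symm, h.2.symm⟩⟩
      loopless := ⟨fun _ h => h.elim (fun h => (gadget R s L).irrefl h.2)
        fun h => M.graph.irrefl h.1⟩ }
  edgeWeight e := Sym2.lift ⟨fun x y : Fin (n * L) =>
    if x.divNat = y.divNat then w else M.coup x.divNat y.divNat / s, fun x y => by
      simp only [eq_comm (a := x.divNat), M.coup_comm x.divNat]⟩ e.1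
  field x c := if IsPort R s x.divNat x.modNat then M.field x.divNat c / (R * s : ℕ) else 0

variable (M : PottsModel n q) (R s L : ℕ) (w : ℝ)

theorem blowUp_adj (x y : Fin (n * L)) : (M.blowUp R s L w).graph.Adj x y ↔
    (x.divNat = y.divNat ∧ (gadget R s L).Adj x.modNat y.modNat) ∨
      (M.graph.Adj x.divNat y.divNat ∧ PortsMatch R s x.divNat y.divNat x.modNat y.modNat) :=
  Iff.rfl

open Classical in
theorem blowUp_coup (x y : Fin (n * L)) : (M.blowUp R s L w).coup x y =
    (if x.divNat = y.divNat ∧ (gadget R s L).Adj x.modNat y.modNat then w else 0) +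
    (if PortsMatch R s x.divNat y.divNat x.modNat y.modNat then M.coup x.divNat y.divNat / s
      else 0) := by
  have hw : ∀ h : (M.blowUp R s L w).graph.Adj x y, (M.blowUp R s L w).edgeWeight ⟨s(x, y), h⟩ =
      if x.divNat = y.divNat then w else M.coup x.divNat y.divNat / s := fun h => by
    simp only [blowUp, Sym2.lift_mk]
  rw [coup]
  by_cases h : (M.blowUp R s L w).graph.Adj x y
  · rw [dif_pos h, hw]
    by_cases hd : x.divNat = y.divNat
    · have h' : (gadget R s L).Adj x.modNat y.modNat := by
        rcases h with h | h
        · exact h.2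
        · exact absurd (hd ▸ h.1) (M.graph.irrefl)
      simp [hd, h', coup_self]
    · have h' : PortsMatch R s x.divNat y.divNat x.modNat y.modNat := by
        rcases h with h | h
        · exact absurd h.1 hd
        · exact h.2
      rw [if_neg hd, if_neg fun h => hd h.1, if_pos h', zero_add]
  · rw [dif_neg h, if_neg fun h' => h (Or.inl h'), zero_add]
    split_ifs with h'
    · rw [coup, dif_neg fun h'' => h (Or.inr ⟨h'', h'⟩), zero_div]
    · rfl

/-! ### Membership in the restricted family -/

theorem abs_coup_le {β : ℝ} (hβ : 0 ≤ β) (hM : ∀ e, |M.edgeWeight e| ≤ β) (u v : Fin n) :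
    |M.coup u v| ≤ β := by
  rw [coup]
  split_ifs
  · exact hM _
  · rwa [abs_zero]

variable {M R s L w}

theorem blowUp_degree_le (hs : 0 < s) (hnR : n ≤ R) (x : Fin (n * L)) :
    ((M.blowUp R s L w).graph.neighborSet x).ncard ≤ 3 * s := by
  classical
  set I : Set (Fin (n * L)) :=
    {y | x.divNat = y.divNat ∧ (gadget R s L).Adj x.modNat y.modNat} with hI
  set J : Set (Fin (n * L)) :=
    {y | M.graph.Adj x.divNat y.divNat ∧ PortsMatch R s x.divNat y.divNat x.modNat y.modNat} with hJ
  have hunion : (M.blowUp R s L w).graph.neighborSet x = I ∪ J := rfl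
  have hext : ∀ {y y' : Fin (n * L)}, y.divNat = y'.divNat → y.modNat = y'.modNat → y = y' :=
    fun h1 h2 => finProdFinEquiv.symm.injective (Prod.ext h1 h2)
  have hIle : I.ncard ≤ ((gadget R s L).neighborSet x.modNat).ncard :=
    Set.ncard_le_ncard_of_injOn (fun y => y.modNat) (fun y hy => hy.2)
      (fun y hy y' hy' h => hext (hy.1.symm.trans hy'.1) h)
  rw [hunion]
  refine (Set.ncard_union_le I J).trans ?_
  rcases J.eq_empty_or_nonempty with h0 | ⟨y, hy1, k, hk, hy2, hy3⟩
  · rw [h0, Set.ncard_empty, add_zero]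
    exact hIle.trans (ncard_gadget_le hs _)
  · have hJle : J.ncard ≤ 1 := by
      rw [Set.ncard_le_one]
      have huniq : ∀ y' ∈ J, y' = y := by
        rintro y' ⟨h1, k', hk', h2, h3⟩
        obtain ⟨e1, e2⟩ := port_inj (y'.divNat.2.trans_le hnR) (y.divNat.2.trans_le hnR) hk' hk
          (h2.symm.trans hy2)
        have e3 : y'.divNat = y.divNat := Fin.ext e1
        refine hext e3 (Fin.ext ?_)
        rw [h3, hy3, e2, e3]
      intro a ha b hb
      rw [huniq a ha, huniq b hb]
    have h2 := ncard_gadget_port_le (y.divNat.2.trans_le hnR) hk x.modNat hy2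
    omega

theorem blowUp_isBipartite : (M.blowUp R s L w).graph.IsBipartite := by
  refine ⟨SimpleGraph.Coloring.mk
    (fun x => (⟨(x.modNat : ℕ) / s % 2, Nat.mod_lt _ two_pos⟩ : Fin 2)) ?_⟩
  rintro x y (⟨-, h⟩ | ⟨h, k, hk, h1, h2⟩) heq
  · exact LayerAdj.parity h (Fin.mk.inj_iff.1 heq)
  · have heq' := Fin.mk.inj_iff.1 heq
    rw [h1, h2, port, port, slot_div hk, slot_div hk, portLayer, portLayer] at heq'
    have : (x.divNat : ℕ) ≠ y.divNat := fun h' => h.ne (Fin.ext h')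
    split_ifs at heq' <;> omega

theorem blowUp_abs_edgeWeight_le {β b : ℝ} (hβ : 0 ≤ β) (hM : ∀ e, |M.edgeWeight e| ≤ β)
    (hw : |w| ≤ b) (hb : β / s ≤ b) (e : (M.blowUp R s L w).graph.edgeSet) :
    |(M.blowUp R s L w).edgeWeight e| ≤ b := by
  obtain ⟨e, he⟩ := e
  induction e with | _ x y
  simp only [blowUp, Sym2.lift_mk]
  split_ifs
  · exact hw
  · rw [abs_div, Nat.abs_cast]
    refine le_trans ?_ hb
    gcongr
    exact M.abs_coup_le hβ hM _ _

theorem blowUp_isFerromagnetic (hM : M.IsFerromagnetic) (hw : 0 < w) (hs : 0 < s) :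
    (M.blowUp R s L w).IsFerromagnetic := by
  rintro ⟨e, he⟩
  induction e with | _ x y
  simp only [blowUp, Sym2.lift_mk]
  split_ifs with h
  · exact hw
  · rcases he with he | he
    · exact absurd he.1 h
    · rw [coup, dif_pos he.1]
      have := hM ⟨s(x.divNat, y.divNat), he.1⟩
      positivity

theorem blowUp_isVertexMonochromatic {h b : ℝ} (hM : M.IsVertexMonochromatic h)
    (hb : h / (R * s : ℕ) ≤ b) (hb0 : 0 ≤ b) : (M.blowUp R s L w).IsVertexMonochromatic b := by
  refine ⟨fun x c => ?_, fun x => ?_⟩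
  · simp only [blowUp]
    split_ifs
    · rw [abs_div, Nat.abs_cast]
      refine le_trans ?_ hb
      gcongr
      exact hM.1 _ _
    · rwa [abs_zero]
  · refine (Set.ncard_le_ncard (fun c hc => ?_) (Set.toFinite _)).trans (hM.2 x.divNat)
    rw [Set.mem_ofPred_eq] at hc ⊢
    intro h0
    refine hc ?_
    simp only [blowUp, h0, zero_div, ite_self]

/-! ### The energy of the blown-up model -/

variable (M)

/-- The vertex with number `k` of the port of block `u` in row `r`. -/
def portFin (hL : 2 * R * R * s ≤ L) (u : ℕ) (x : Fin R × Fin s) : Fin L :=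
  ⟨port R s u x.1 x.2, port_lt hL x.1.2 x.2.2⟩

theorem portFin_injective (hL : 2 * R * R * s ≤ L) (u : ℕ) :
    Function.Injective (portFin hL u) := fun x y h => by
  obtain ⟨h1, h2⟩ := port_inj x.1.2 y.1.2 x.2.2 y.2.2 (Fin.mk.inj_iff.1 h)
  exact Prod.ext (Fin.ext h1) (Fin.ext h2)

/-- The number of ordered adjacent pairs of a graph. -/
def pairs {Γ : Type*} [Fintype Γ] (H : SimpleGraph Γ) : ℕ :=
  open Classical in (Finset.univ.filter fun p : Γ × Γ => H.Adj p.1 p.2).card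

/-- The part of the energy of the blown-up model that stems from `M`, where `τ u` is the
configuration of block `u`. -/
def linkEnergy (hL : 2 * R * R * s ≤ L) (hnR : n ≤ R) (τ : Fin n → Fin L → Fin q) : ℝ :=
  1 / 2 * (∑ u, ∑ v, ∑ k : Fin s,
    if τ u (portFin hL u (Fin.castLE hnR v, k)) = τ v (portFin hL v (Fin.castLE hnR u, k)) then
      M.coup u v / s else 0) +
  ∑ u, ∑ x, M.field u (τ u (portFin hL u x)) / (R * s : ℕ)

open Classical in
theorem sum_portsMatch (hL : 2 * R * R * s ≤ L) (hnR : n ≤ R) (u v : Fin n)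
    (f : Fin L → Fin L → ℝ) :
    (∑ i : Fin L, ∑ j : Fin L, if PortsMatch R s u v i j then f i j else 0) =
      ∑ k : Fin s, f (portFin hL u (Fin.castLE hnR v, k)) (portFin hL v (Fin.castLE hnR u, k)) := by
  have hinj : Function.Injective fun k : Fin s =>
      (portFin hL u (Fin.castLE hnR v, k), portFin hL v (Fin.castLE hnR u, k)) := fun k k' h =>
    (Prod.mk.inj (portFin_injective hL u (Prod.mk.inj h).1)).2
  rw [← Finset.sum_product', Finset.univ_product_univ, ← Finset.sum_filter]
  have himg : (Finset.univ.filter fun p : Fin L × Fin L => PortsMatch R s u v p.1 p.2) =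
      Finset.univ.image fun k : Fin s =>
        (portFin hL u (Fin.castLE hnR v, k), portFin hL v (Fin.castLE hnR u, k)) := by
    ext p
    simp only [Finset.mem_filter, Finset.mem_univ, true_and, Finset.mem_image]
    constructor
    · rintro ⟨k, hk, h1, h2⟩
      exact ⟨⟨k, hk⟩, Prod.ext (Fin.ext h1.symm) (Fin.ext h2.symm)⟩
    · rintro ⟨k, rfl⟩
      exact ⟨k, k.2, rfl, rfl⟩
  rw [himg, Finset.sum_image hinj.injOn]

open Classical in
theorem sum_isPort (hL : 2 * R * R * s ≤ L) (u : ℕ) (f : Fin L → ℝ) :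
    (∑ i : Fin L, if IsPort R s u i then f i else 0) = ∑ x, f (portFin hL u x) := by
  rw [← Finset.sum_filter]
  have himg : (Finset.univ.filter fun i : Fin L => IsPort R s u i) =
      Finset.univ.image (portFin hL u) := by
    ext i
    simp only [Finset.mem_filter, Finset.mem_univ, true_and, Finset.mem_image]
    constructor
    · rintro ⟨r, hr, k, hk, h1⟩
      exact ⟨(⟨r, hr⟩, ⟨k, hk⟩), Fin.ext h1.symm⟩
    · rintro ⟨x, rfl⟩
      exact ⟨x.1, x.1.2, x.2, x.2.2, rfl⟩
  rw [himg, Finset.sum_image (portFin_injective hL u).injOn]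

open Classical in
theorem sum_agree {Γ : Type*} [Fintype Γ] (H : SimpleGraph Γ) (τ : Γ → Fin q) (w : ℝ) :
    (∑ i, ∑ j, if τ i = τ j then if H.Adj i j then w else 0 else 0) =
      w * (pairs H - viol H τ) := by
  have h1 : ((Finset.univ.filter fun p : Γ × Γ => H.Adj p.1 p.2 ∧ τ p.1 = τ p.2).card : ℝ) +
      viol H τ = pairs H := by
    rw [viol, pairs]
    norm_cast
    rw [← Finset.card_filter_add_card_filter_not (fun p : Γ × Γ => τ p.1 = τ p.2)
      (s := Finset.univ.filter fun p : Γ × Γ => H.Adj p.1 p.2), Finset.filter_filter,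
      Finset.filter_filter]
  rw [← h1, add_sub_cancel_right, ← Finset.sum_product', Finset.univ_product_univ, mul_comm,
    ← nsmul_eq_mul, ← Finset.sum_const, Finset.sum_filter]
  refine Finset.sum_congr rfl fun p _ => ?_
  by_cases h : τ p.1 = τ p.2 <;> by_cases h' : H.Adj p.1 p.2 <;> simp [h, h']

/-- The configurations of the blocks. -/
def blocks (σ : Fin (n * L) → Fin q) (u : Fin n) (i : Fin L) : Fin q := σ (finProdFinEquiv (u, i))

theorem blowUp_energy (hL : 2 * R * R * s ≤ L) (hnR : n ≤ R) (w : ℝ) (σ : Fin (n * L) → Fin q) :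
    (M.blowUp R s L w).energy σ =
      w / 2 * ∑ u, ((pairs (gadget R s L) : ℝ) - viol (gadget R s L) (blocks σ u)) +
        M.linkEnergy hL hnR (blocks σ) := by
  classical
  have hdiv : ∀ (u : Fin n) (i : Fin L), (finProdFinEquiv (u, i)).divNat = u := fun u i =>
    congrArg Prod.fst (finProdFinEquiv.symm_apply_apply (u, i))
  have hmod : ∀ (u : Fin n) (i : Fin L), (finProdFinEquiv (u, i)).modNat = i := fun u i =>
    congrArg Prod.snd (finProdFinEquiv.symm_apply_apply (u, i))
  have hsum : ∀ f : Fin (n * L) → ℝ, ∑ x, f x = ∑ u, ∑ i, f (finProdFinEquiv (u, i)) := fun f => by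
    rw [← finProdFinEquiv.sum_comp, Fintype.sum_prod_type]
  have hfield : ∑ x, (M.blowUp R s L w).field x (σ x) =
      ∑ u, ∑ x, M.field u (blocks σ u (portFin hL u x)) / (R * s : ℕ) := by
    rw [hsum]
    refine Finset.sum_congr rfl fun u _ => ?_
    simp only [blowUp, hdiv, hmod]
    exact sum_isPort hL u fun i => M.field u (blocks σ u i) / (R * s : ℕ)
  have hpair : (∑ x, ∑ y, if σ x = σ y then (M.blowUp R s L w).coup x y else 0) =
      ∑ u, w * ((pairs (gadget R s L) : ℝ) - viol (gadget R s L) (blocks σ u)) +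
      ∑ u, ∑ v, ∑ k : Fin s,
        if blocks σ u (portFin hL u (Fin.castLE hnR v, k)) =
          blocks σ v (portFin hL v (Fin.castLE hnR u, k)) then M.coup u v / s else 0 := by
    have h1 : ∀ u : Fin n, (∑ i, ∑ v, ∑ j, if blocks σ u i = blocks σ v j then
        (if u = v ∧ (gadget R s L).Adj i j then w else 0) +
        (if PortsMatch R s u v i j then M.coup u v / s else 0) else 0) =
        w * ((pairs (gadget R s L) : ℝ) - viol (gadget R s L) (blocks σ u)) +
        ∑ v, ∑ k : Fin s,
        if blocks σ u (portFin hL u (Fin.castLE hnR v, k)) =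
          blocks σ v (portFin hL v (Fin.castLE hnR u, k)) then M.coup u v / s else 0 := by
      intro u
      rw [Finset.sum_comm]
      have h2 : ∀ v, (∑ i, ∑ j, if blocks σ u i = blocks σ v j then
          (if u = v ∧ (gadget R s L).Adj i j then w else 0) +
          (if PortsMatch R s u v i j then M.coup u v / s else 0) else 0) =
          (if u = v then w * ((pairs (gadget R s L) : ℝ) - viol (gadget R s L) (blocks σ u))
            else 0) +
          ∑ k : Fin s, if blocks σ u (portFin hL u (Fin.castLE hnR v, k)) =
          blocks σ v (portFin hL v (Fin.castLE hnR u, k)) then M.coup u v / s else 0 := by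
        intro v
        rw [← sum_portsMatch hL hnR u v fun i j =>
          if blocks σ u i = blocks σ v j then M.coup u v / s else 0]
        have h3 : (if u = v then w * ((pairs (gadget R s L) : ℝ) -
            viol (gadget R s L) (blocks σ u)) else 0) =
            ∑ i, ∑ j, if blocks σ u i = blocks σ v j then
              if u = v ∧ (gadget R s L).Adj i j then w else 0 else 0 := by
          by_cases huv : u = v
          · subst huv
            simp only [if_true, true_and]
            exact (sum_agree _ _ _).symm
          · simp [huv]
        rw [h3, ← Finset.sum_add_distrib]
        refine Finset.sum_congr rfl fun i _ => ?_
        rw [← Finset.sum_add_distrib]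
        refine Finset.sum_congr rfl fun j _ => ?_
        split_ifs <;> simp
      rw [Finset.sum_congr rfl fun v _ => h2 v, Finset.sum_add_distrib]
      simp
    rw [hsum, ← Finset.sum_add_distrib]
    refine Finset.sum_congr rfl fun u _ => ?_
    rw [← h1]
    refine Finset.sum_congr rfl fun i _ => ?_
    rw [hsum]
    refine Finset.sum_congr rfl fun v _ => Finset.sum_congr rfl fun j _ => ?_
    rw [blowUp_coup, hdiv, hdiv, hmod, hmod]
    rfl
  rw [energy, hfield, hpair, linkEnergy, ← Finset.mul_sum]
  ring

theorem linkEnergy_const (hL : 2 * R * R * s ≤ L) (hnR : n ≤ R) (hR : 0 < R) (hs : 0 < s)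
    (c : Fin n → Fin q) : M.linkEnergy hL hnR (fun u _ => c u) = M.energy c := by
  have h1 : (s : ℝ) ≠ 0 := by positivity
  have h2 : (R : ℝ) ≠ 0 := by positivity
  rw [linkEnergy, energy]
  congr 2
  · refine Finset.sum_congr rfl fun u _ => Finset.sum_congr rfl fun v _ => ?_
    split_ifs <;> simp
    field_simp
  · funext u
    simp only [Finset.sum_const, Finset.card_univ, Fintype.card_prod, Fintype.card_fin,
      nsmul_eq_mul]
    push_cast
    field_simp

open Classical in
/-- Replacing the spins of a block by a single spin changes the energy of the links by at most a
constant times the number of ports whose spins change. -/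
theorem linkEnergy_le (hL : 2 * R * R * s ≤ L) (hnR : n ≤ R) (hR : 0 < R) (hs : 0 < s) {β h : ℝ}
    (hβ : ∀ u v, |M.coup u v| ≤ β) (hh : ∀ u i, |M.field u i| ≤ h) (hβ0 : 0 ≤ β) (hh0 : 0 ≤ h)
    (τ : Fin n → Fin L → Fin q) (c : Fin n → Fin q) :
    M.linkEnergy hL hnR τ ≤ M.energy c + (β + 2 * h) / s *
      ∑ u, ((Finset.univ.filter fun x => τ u (portFin hL u x) ≠ c u).card : ℝ) := by
  have hs' : (0 : ℝ) < s := by positivity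
  have hR' : (1 : ℝ) ≤ R := by exact_mod_cast hR
  -- `d u x` says whether port `x` of block `u` differs from the spin of the block
  set d : Fin n → Fin R × Fin s → ℝ := fun u x => if τ u (portFin hL u x) ≠ c u then 1 else 0
    with hd
  have hd0 : ∀ u x, 0 ≤ d u x := fun u x => by simp only [hd]; split_ifs <;> norm_num
  have hcard : ∀ u, ((Finset.univ.filter fun x => τ u (portFin hL u x) ≠ c u).card : ℝ) =
      ∑ x, d u x := fun u => by
    rw [Finset.card_filter]
    push_cast
    rfl
  have hedge : ∀ u v k, (if τ u (portFin hL u (Fin.castLE hnR v, k)) =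
      τ v (portFin hL v (Fin.castLE hnR u, k)) then M.coup u v / s else 0) ≤
      (if c u = c v then M.coup u v / s else 0) +
        β / s * (d u (Fin.castLE hnR v, k) + d v (Fin.castLE hnR u, k)) := by
    intro u v k
    have hc1 : M.coup u v / s ≤ β / s := by gcongr; exact (abs_le.1 (hβ u v)).2
    have hc2 : -(β / s) ≤ M.coup u v / s := by
      rw [← neg_div]; gcongr; exact (abs_le.1 (hβ u v)).1
    have hb : 0 ≤ β / s := by positivity
    by_cases h1 : τ u (portFin hL u (Fin.castLE hnR v, k)) = c u
    · by_cases h2 : τ v (portFin hL v (Fin.castLE hnR u, k)) = c v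
      · simp [hd, h1, h2]
      · have e : d u (Fin.castLE hnR v, k) + d v (Fin.castLE hnR u, k) = 1 := by simp [hd, h1, h2]
        rw [e]
        split_ifs <;> linarith
    · have e : 1 ≤ d u (Fin.castLE hnR v, k) + d v (Fin.castLE hnR u, k) := by
        have := hd0 v (Fin.castLE hnR u, k)
        have h3 : d u (Fin.castLE hnR v, k) = 1 := by simp [hd, h1]
        linarith
      have := mul_le_mul_of_nonneg_left e hb
      split_ifs <;> linarith
  have hfield : ∀ u x, M.field u (τ u (portFin hL u x)) / (R * s : ℕ) ≤
      M.field u (c u) / (R * s : ℕ) + 2 * h / s * d u x := by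
    intro u x
    by_cases h1 : τ u (portFin hL u x) = c u
    · simp [hd, h1]
    · have e : d u x = 1 := by simp [hd, h1]
      have e1 := (abs_le.1 (hh u (τ u (portFin hL u x)))).2
      have e2 := (abs_le.1 (hh u (c u))).1
      rw [e, mul_one, ← sub_le_iff_le_add', ← sub_div]
      push_cast
      calc (M.field u (τ u (portFin hL u x)) - M.field u (c u)) / (R * s) ≤ 2 * h / (R * s) := by
            gcongr; linarith
        _ ≤ 2 * h / s := by
            gcongr
            exact le_mul_of_one_le_left hs'.le hR'
  have hrow : ∀ u : Fin n, ∑ v : Fin n, ∑ k, d u (Fin.castLE hnR v, k) ≤ ∑ x, d u x := by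
    intro u
    rw [Fintype.sum_prod_type]
    refine le_trans (le_of_eq ?_) (Finset.sum_le_univ_sum_of_nonneg
      (s := Finset.univ.map (Fin.castLEEmb hnR))
      fun r => Finset.sum_nonneg fun k _ => hd0 u (r, k))
    rw [Finset.sum_map]
    rfl
  have h1 : M.linkEnergy hL hnR τ ≤ M.linkEnergy hL hnR (fun u _ => c u) +
      (1 / 2 * (∑ u, ∑ v, ∑ k : Fin s,
        β / s * (d u (Fin.castLE hnR v, k) + d v (Fin.castLE hnR u, k))) +
      ∑ u, ∑ x, 2 * h / s * d u x) := by
    have e1 := Finset.sum_le_sum fun u (_ : u ∈ Finset.univ) =>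
      Finset.sum_le_sum fun v (_ : v ∈ Finset.univ) =>
      Finset.sum_le_sum fun k (_ : k ∈ Finset.univ) => hedge u v k
    have e2 := Finset.sum_le_sum fun u (_ : u ∈ Finset.univ) =>
      Finset.sum_le_sum fun x (_ : x ∈ Finset.univ) => hfield u x
    simp only [Finset.sum_add_distrib] at e1 e2
    simp only [linkEnergy, mul_add, Finset.sum_add_distrib] at e1 e2 ⊢
    linarith
  rw [linkEnergy_const M hL hnR hR hs] at h1
  refine h1.trans ?_
  have e1 : ∑ u, ∑ v, ∑ k : Fin s,
      β / s * (d u (Fin.castLE hnR v, k) + d v (Fin.castLE hnR u, k)) =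
      2 * (β / s * ∑ u, ∑ v : Fin n, ∑ k, d u (Fin.castLE hnR v, k)) := by
    simp only [← Finset.mul_sum, Finset.sum_add_distrib]
    rw [Finset.sum_comm (f := fun u v => ∑ k, d v (Fin.castLE hnR u, k))]
    ring
  have e2 : ∑ u, ∑ v : Fin n, ∑ k, d u (Fin.castLE hnR v, k) ≤ ∑ u, ∑ x, d u x :=
    Finset.sum_le_sum fun u _ => hrow u
  have e3 : β / s * ∑ u, ∑ v : Fin n, ∑ k, d u (Fin.castLE hnR v, k) ≤
      β / s * ∑ u, ∑ x, d u x := by gcongr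
  rw [e1]
  simp only [hcard, ← Finset.mul_sum]
  rw [add_div, add_mul]
  linarith

end PottsModel

/-! ### The Gibbs distribution of the blown-up model -/

namespace PottsModel

variable {n q R s L : ℕ}

/-- A configuration is the same as a family of configurations of the blocks. -/
def blocksEquiv (n q L : ℕ) : (Fin (n * L) → Fin q) ≃ (Fin n → Fin L → Fin q) where
  toFun := blocks
  invFun τ x := τ x.divNat x.modNat
  left_inv σ := by
    funext x
    exact congrArg σ (finProdFinEquiv.apply_symm_apply x)
  right_inv τ := by
    funext u i
    have := finProdFinEquiv.symm_apply_apply (u, i)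
    exact congrArg₂ τ (congrArg Prod.fst this) (congrArg Prod.snd this)

theorem viol_const {Γ : Type*} [Fintype Γ] (H : SimpleGraph Γ) (a : Fin q) :
    viol H (fun _ => a) = 0 := by
  simp [viol]

/-- The configurations of a block whose ports mostly have spin `a` have total weight at most that of
the constant configuration and of the non-constant ones. -/
theorem sum_fiber_le [NeZero q] (hR : 0 < R) (hs : 0 < s) (hL : 2 * R * R * s ≤ L)
    (hL' : 2 * s ≤ L) {w : ℝ} (hw : 0 ≤ w) (u : ℕ) (c : (Fin L → Fin q) → Fin q)
    (hc : ∀ t, (Finset.univ.filter fun x => t (portFin hL u x) ≠ c t).card ≤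
      3 * viol (gadget R s L) t) (a : Fin q) :
    ∑ t ∈ Finset.univ.filter (fun t => c t = a), Real.exp (-w * viol (gadget R s L) t) ≤
      1 + s * (q * ((1 + q * Real.exp (-w * s)) ^ L - 1)) := by
  classical
  rw [← Finset.sum_filter_add_sum_filter_not _ fun t : Fin L → Fin q => ∀ x y, t x = t y]
  refine add_le_add ?_ (gadget_sum_nonconst_le hs hL' hw _ fun t ht => ?_)
  · have hsub : (Finset.univ.filter fun t => c t = a).filter
        (fun t : Fin L → Fin q => ∀ x y, t x = t y) ⊆ {fun _ => a} := by
      intro t ht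
      simp only [Finset.mem_filter, Finset.mem_univ, true_and] at ht
      obtain ⟨h1, h2⟩ := ht
      have hconst : t = fun _ => t (portFin hL u (⟨0, hR⟩, ⟨0, hs⟩)) := funext fun x => h2 _ _
      have h3 := hc t
      rw [show viol (gadget R s L) t = 0 by rw [hconst, viol_const], mul_zero, Nat.le_zero,
        Finset.card_eq_zero, Finset.filter_eq_empty_iff] at h3
      have h4 := not_not.1 (h3 (Finset.mem_univ (⟨0, hR⟩, ⟨0, hs⟩)))
      rw [Finset.mem_singleton, hconst, h4, h1]
    refine (Finset.sum_le_sum_of_subset_of_nonneg hsub fun _ _ _ => (Real.exp_pos _).le).trans ?_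
    rw [Finset.sum_singleton, viol_const]
    simp
  · have := (Finset.mem_filter.1 ht).2
    push Not at this
    exact this

open Classical in
theorem blowUp_partitionFunction (M : PottsModel n q) (hnR : n ≤ R) (hL : 2 * R * R * s ≤ L)
    (w : ℝ) :
    (M.blowUp R s L w).partitionFunction = ∑ τ : Fin n → Fin L → Fin q,
      Real.exp (w / 2 * ∑ u, ((pairs (gadget R s L) : ℝ) - viol (gadget R s L) (τ u)) +
        M.linkEnergy hL hnR τ) := by
  rw [← (blocksEquiv n q L).sum_comp, partitionFunction]
  refine Finset.sum_congr rfl fun σ _ => ?_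
  rw [weight_eq_exp_energy, blowUp_energy M hL hnR]
  rfl

open Classical in
/-- Half of the energy lost inside the gadgets pays for the ports that deviate from the spin of
their block. -/
theorem exp_blowUp_energy_le (M : PottsModel n q) (hR : 0 < R) (hs : 0 < s) (hnR : n ≤ R)
    (hL : 2 * R * R * s ≤ L) {β h w : ℝ} (hβ0 : 0 ≤ β) (hh0 : 0 ≤ h)
    (hβ : ∀ u v, |M.coup u v| ≤ β) (hh : ∀ u i, |M.field u i| ≤ h)
    (hw : 12 * (β + 2 * h) ≤ w * s) (τ : Fin n → Fin L → Fin q) (c : Fin n → Fin q)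
    (hc : ∀ u, (Finset.univ.filter fun x => τ u (portFin hL u x) ≠ c u).card ≤
      3 * viol (gadget R s L) (τ u)) :
    Real.exp (w / 2 * ∑ u, ((pairs (gadget R s L) : ℝ) - viol (gadget R s L) (τ u)) +
        M.linkEnergy hL hnR τ) ≤
      Real.exp (w / 2 * (n * pairs (gadget R s L))) * (M.weight c *
        ∏ u, Real.exp (-(w / 4) * viol (gadget R s L) (τ u))) := by
  have hs' : (0 : ℝ) < s := by positivity
  have h1 := M.linkEnergy_le hL hnR hR hs hβ hh hβ0 hh0 τ c
  have h2 : ∑ u : Fin n, ((Finset.univ.filter fun x =>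
      τ u (portFin hL u x) ≠ c u).card : ℝ) ≤ 3 * ∑ u, (viol (gadget R s L) (τ u) : ℝ) := by
    rw [Finset.mul_sum]
    refine Finset.sum_le_sum fun u _ => ?_
    exact_mod_cast hc u
  have h3 : (0 : ℝ) ≤ ∑ u, (viol (gadget R s L) (τ u) : ℝ) :=
    Finset.sum_nonneg fun _ _ => Nat.cast_nonneg _
  have h4 : (β + 2 * h) / s ≤ w / 12 := by
    rw [div_le_div_iff₀ hs' (by norm_num)]
    linarith
  have h5 := mul_le_mul_of_nonneg_left h2 (show 0 ≤ (β + 2 * h) / s by positivity)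
  have h6 := mul_le_mul_of_nonneg_right h4 (mul_nonneg (by norm_num : (0 : ℝ) ≤ 3) h3)
  rw [weight_eq_exp_energy, ← Real.exp_sum, ← Real.exp_add, ← Real.exp_add, Real.exp_le_exp,
    ← Finset.mul_sum, Finset.sum_sub_distrib, Finset.sum_const, Finset.card_univ, Fintype.card_fin,
    nsmul_eq_mul]
  linarith

theorem sum_weight_comp (M : PottsModel n q) {α : Type*} [Fintype α] [DecidableEq α]
    (c : Fin n → α → Fin q) (g : α → ℝ) :
    ∑ τ : Fin n → α, M.weight (fun u => c u (τ u)) * ∏ u, g (τ u) =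
      ∑ a, M.weight a * ∏ u, ∑ t ∈ Finset.univ.filter (fun t => c u t = a u), g t := by
  rw [← Finset.sum_fiberwise Finset.univ fun (τ : Fin n → α) u => c u (τ u)]
  refine Finset.sum_congr rfl fun a _ => ?_
  rw [Finset.prod_univ_sum, Finset.mul_sum]
  refine Finset.sum_congr ?_ fun τ hτ => ?_
  · ext τ
    simp [funext_iff]
  · simp only [Fintype.mem_piFinset, Finset.mem_filter, Finset.mem_univ, true_and] at hτ
    rw [show (fun u : Fin n => c u (τ u)) = a from funext hτ]

/-- If the gadgets are strong enough, then the blown-up model approximates the original one. -/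
theorem blowUp_approximates [NeZero q] (M : PottsModel n q) (hR : 0 < R) (hs : 0 < s) (hnR : n ≤ R)
    (hL : 2 * R * R * s ≤ L) (hL' : 2 * s ≤ L) {β h w : ℝ} (hβ0 : 0 ≤ β) (hh0 : 0 ≤ h)
    (hβ : ∀ e, |M.edgeWeight e| ≤ β) (hh : ∀ u i, |M.field u i| ≤ h)
    (hw : 12 * (β + 2 * h) ≤ w * s) :
    M.Approximates (fun x => x.divNat) (M.blowUp R s L w)
      ((1 + s * (q * ((1 + q * Real.exp (-(w / 4) * s)) ^ L - 1))) ^ n - 1) := by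
  classical
  have hs' : (0 : ℝ) < s := by positivity
  have hw0 : 0 ≤ w / 4 := by
    by_contra! hneg
    nlinarith
  refine ⟨fun u => ⟨finProdFinEquiv (u, ⟨0, by omega⟩),
    congrArg Prod.fst (finProdFinEquiv.symm_apply_apply _)⟩,
    Real.exp (w / 2 * (n * pairs (gadget R s L))), Real.exp_pos _, fun σ => ?_, ?_⟩
  · have hblocks : blocks (fun x : Fin (n * L) => σ x.divNat) = fun u (_ : Fin L) => σ u := by
      funext u i
      exact congrArg σ (congrArg Prod.fst (finProdFinEquiv.symm_apply_apply (u, i)))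
    rw [weight_eq_exp_energy, weight_eq_exp_energy, blowUp_energy M hL hnR, ← Real.exp_add,
      hblocks, linkEnergy_const M hL hnR hR hs]
    simp only [viol_const, Nat.cast_zero, sub_zero, Finset.sum_const, Finset.card_univ,
      Fintype.card_fin, nsmul_eq_mul]
  · choose c hc using fun (u : ℕ) (t : Fin L → Fin q) => exists_spin_of_ports hR hs hL t u
    rw [blowUp_partitionFunction M hnR hL]
    refine (Finset.sum_le_sum fun τ _ => exp_blowUp_energy_le M hR hs hnR hL hβ0 hh0
      (M.abs_coup_le hβ0 hβ) hh hw τ (fun u => c u (τ u)) fun u => hc u (τ u)).trans ?_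
    rw [← Finset.mul_sum, sum_weight_comp M (fun u t => c u t) fun t =>
      Real.exp (-(w / 4) * viol (gadget R s L) t), add_sub_cancel]
    refine (mul_le_mul_of_nonneg_left ?_ (Real.exp_pos _).le).trans (mul_left_comm _ _ _).le
    rw [partitionFunction, Finset.mul_sum]
    refine Finset.sum_le_sum fun a _ => ?_
    rw [mul_comm]
    refine mul_le_mul_of_nonneg_right ?_ (M.weight_pos a).le
    refine (Finset.prod_le_prod (fun u _ => Finset.sum_nonneg fun t _ => (Real.exp_pos _).le)
      fun (u : Fin n) _ => sum_fiber_le hR hs hL hL' hw0 u (c u) (hc u) (a u)).trans ?_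
    rw [Finset.prod_const, Finset.card_univ, Fintype.card_fin]

end PottsModel

namespace RealRAM

/-! ### The memory that holds the blown-up model -/

variable {n q : ℕ}

open Classical in
/-- The data that describe `M.blowUp R s L (lam / s)` in terms of `M`. The pairs that are not linked
refer to the pair `(0, 0)`, where the adjacency matrix and the edge weights of `M` vanish. -/
def blowUpAdvice (n R s L lam T : ℕ) : Advice where
  size := n * L
  inner x y := if x / L = y / L ∧ LayerAdj R (x % L / s) (y % L / s) then 1 else 0
  left x y := if PortsMatch R s (x / L) (y / L) (x % L) (y % L) then x / L else 0
  right x y := if PortsMatch R s (x / L) (y / L) (x % L) (y % L) then y / L else 0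
  block x := x / L
  flag x := if IsPort R s (x / L) (x % L) then 1 else 0
  width := s
  strength := lam
  spread := R * s
  time := T

theorem blowUpAdvice_le {n R s L lam T b : ℕ} (hsize : n * L ≤ b) (hs : s ≤ b) (hlam : lam ≤ b)
    (hRs : R * s ≤ b) (hT : T ≤ b) (hb : 1 ≤ b) {i k : ℕ} (hi : i < n * L) (hk : k < n * L) :
    (blowUpAdvice n R s L lam T).inner i k ≤ b ∧ (blowUpAdvice n R s L lam T).left i k ≤ b ∧
      (blowUpAdvice n R s L lam T).right i k ≤ b ∧ (blowUpAdvice n R s L lam T).rows i k ≤ b := by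
  have h1 := Nat.div_le_self i L
  have h2 := Nat.div_le_self k L
  refine ⟨?_, ?_, ?_, ?_⟩
  · simp only [blowUpAdvice]
    split_ifs <;> omega
  · simp only [blowUpAdvice]
    split_ifs <;> omega
  · simp only [blowUpAdvice]
    split_ifs <;> omega
  · simp only [Advice.rows, blowUpAdvice]
    split_ifs <;> omega

open Classical in
theorem input_nat_one (M : PottsModel n q) (u v : Fin n) :
    (input M).nat 1 u v = if M.graph.Adj u v then 1 else 0 := by
  simp [input]

theorem input_real_zero (M : PottsModel n q) (u v : Fin n) :
    (input M).real 0 u v = M.coup u v := by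
  simp only [input, if_true, PottsModel.coup]
  by_cases h : M.graph.Adj u v
  · rw [dif_pos h, dif_pos ⟨u.2, v.2, h⟩]
  · rw [dif_neg h, dif_neg fun h' => h h'.2.2]

theorem input_real_one (M : PottsModel n q) (u : Fin n) (c : ℕ) :
    (input M).real 1 u c = if h : c < q then M.field u ⟨c, h⟩ else 0 := by
  simp [input]

theorem input_nat_one_zero (M : PottsModel n q) : (input M).nat 1 0 0 = 0 := by
  simp [input]

theorem input_real_zero_zero (M : PottsModel n q) : (input M).real 0 0 0 = 0 := by
  simp [input]

theorem input_nat_zero (M : PottsModel n q) (i j : ℕ) :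
    (input M).nat 0 i j = if i = 0 ∧ j = 0 then n else 0 := by
  simp [input]

theorem input_nat_eq_zero (M : PottsModel n q) {a i j : ℕ}
    (h : a ≠ 0 ∧ ¬ (a = 1 ∧ i < n ∧ j < n)) : (input M).nat a i j = 0 := by
  simp only [input]
  rw [if_neg fun h' => h.1 h'.1, if_neg]
  rintro ⟨h1, h2, h3, -⟩
  exact h.2 ⟨h1, h2, h3⟩

theorem input_real_eq_zero (M : PottsModel n q) {a i j : ℕ}
    (h : ¬ (a = 0 ∧ i < n ∧ j < n) ∧ ¬ (a = 1 ∧ i < n ∧ j < q)) : (input M).real a i j = 0 := by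
  simp only [input]
  split_ifs with h1 h2 h3 h4
  · exact absurd ⟨h1, h2.1, h2.2.1⟩ h.1
  · rfl
  · exact absurd ⟨h3, h4⟩ h.2
  · rfl
  · rfl

theorem input_blowUp (M : PottsModel n q) {R s L lam T : ℕ} (hq : q ≤ n * L) :
    input (M.blowUp R s L (lam / s)) = (blowUpAdvice n R s L lam T).expand (input M) := by
  classical
  set M' := M.blowUp R s L ((lam : ℝ) / s) with hM'
  have hnat : (input M').nat = ((blowUpAdvice n R s L lam T).expand (input M)).nat := by
    funext a i j
    simp only [Advice.expand]
    by_cases h0 : a = 0 ∧ i = 0 ∧ j = 0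
    · obtain ⟨rfl, rfl, rfl⟩ := h0
      simp [input_nat_zero, blowUpAdvice]
    rw [if_neg h0]
    by_cases h1 : a = 1 ∧ i < n * L ∧ j < n * L
    · rw [if_pos (show a = 1 ∧ i < (blowUpAdvice n R s L lam T).size ∧
        j < (blowUpAdvice n R s L lam T).size from h1)]
      obtain ⟨rfl, hi, hj⟩ := h1
      have h2 := input_nat_one M' ⟨i, hi⟩ ⟨j, hj⟩
      set x : Fin (n * L) := ⟨i, hi⟩
      set y : Fin (n * L) := ⟨j, hj⟩
      rw [h2, PottsModel.blowUp_adj]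
      have hx : (x.divNat : ℕ) = i / L := rfl
      have hy : (y.divNat : ℕ) = j / L := rfl
      have hx' : (x.modNat : ℕ) = i % L := rfl
      have hy' : (y.modNat : ℕ) = j % L := rfl
      have hval : (input M).nat 1 ((blowUpAdvice n R s L lam T).left i j)
          ((blowUpAdvice n R s L lam T).right i j) =
          if M.graph.Adj x.divNat y.divNat ∧ PortsMatch R s x.divNat y.divNat x.modNat y.modNat
          then 1 else 0 := by
        simp only [blowUpAdvice, ← hx, ← hy, ← hx', ← hy']
        by_cases hp : PortsMatch R s x.divNat y.divNat x.modNat y.modNat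
        · simp only [hp, if_true, and_true, input_nat_one]
        · simp only [hp, if_false, and_false, input_nat_one_zero]
      rw [hval]
      have hin : (blowUpAdvice n R s L lam T).inner i j =
          if x.divNat = y.divNat ∧ (gadget R s L).Adj x.modNat y.modNat then 1 else 0 := by
        simp only [blowUpAdvice, Fin.ext_iff, ← hx, ← hy]
        rfl
      rw [hin]
      by_cases hd : x.divNat = y.divNat
      · have : ¬ M.graph.Adj x.divNat y.divNat := hd ▸ M.graph.irrefl
        simp only [this, false_and, or_false, if_false, add_zero]
      · simp only [hd, false_and, false_or, if_false, zero_add]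
    · rw [if_neg (show ¬ (a = 1 ∧ i < (blowUpAdvice n R s L lam T).size ∧
        j < (blowUpAdvice n R s L lam T).size) from h1)]
      by_cases ha : a = 0
      · subst ha
        rw [input_nat_zero, if_neg fun h => h0 ⟨rfl, h⟩]
      · exact input_nat_eq_zero _ ⟨ha, h1⟩
  have hreal : (input M').real = ((blowUpAdvice n R s L lam T).expand (input M)).real := by
    funext a i j
    simp only [Advice.expand]
    by_cases h1 : a = 0 ∧ i < n * L ∧ j < n * L
    · rw [if_pos (show a = 0 ∧ i < (blowUpAdvice n R s L lam T).size ∧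
        j < (blowUpAdvice n R s L lam T).size from h1)]
      obtain ⟨rfl, hi, hj⟩ := h1
      have h2 := input_real_zero M' ⟨i, hi⟩ ⟨j, hj⟩
      set x : Fin (n * L) := ⟨i, hi⟩
      set y : Fin (n * L) := ⟨j, hj⟩
      rw [h2, PottsModel.blowUp_coup]
      have hx : (x.divNat : ℕ) = i / L := rfl
      have hy : (y.divNat : ℕ) = j / L := rfl
      have hx' : (x.modNat : ℕ) = i % L := rfl
      have hy' : (y.modNat : ℕ) = j % L := rfl
      congr 1
      · have hin : (blowUpAdvice n R s L lam T).inner i j =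
            if x.divNat = y.divNat ∧ (gadget R s L).Adj x.modNat y.modNat then 1 else 0 := by
          simp only [blowUpAdvice, Fin.ext_iff, ← hx, ← hy]
          rfl
        rw [hin]
        split_ifs <;> simp [blowUpAdvice]
      · simp only [blowUpAdvice, ← hx, ← hy, ← hx', ← hy']
        by_cases hp : PortsMatch R s x.divNat y.divNat x.modNat y.modNat
        · simp only [hp, if_true, input_real_zero]
        · simp only [hp, if_false, input_real_zero_zero, zero_div]
    rw [if_neg (show ¬ (a = 0 ∧ i < (blowUpAdvice n R s L lam T).size ∧
        j < (blowUpAdvice n R s L lam T).size) from h1)]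
    by_cases h2 : a = 1 ∧ i < n * L ∧ j < n * L
    · rw [if_pos (show a = 1 ∧ i < (blowUpAdvice n R s L lam T).size ∧
        j < (blowUpAdvice n R s L lam T).size from h2)]
      obtain ⟨rfl, hi, hj⟩ := h2
      have h3 := input_real_one M' ⟨i, hi⟩ j
      set x : Fin (n * L) := ⟨i, hi⟩
      have h4 := input_real_one M x.divNat j
      rw [h3]
      change _ = (blowUpAdvice n R s L lam T).flag i * (input M).real 1 (x.divNat : ℕ) j / _
      rw [h4]
      have hfl : (blowUpAdvice n R s L lam T).flag i =
          if IsPort R s x.divNat x.modNat then 1 else 0 := rfl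
      rw [hfl]
      by_cases hc : j < q
      · rw [dif_pos hc, dif_pos hc, hM']
        simp only [PottsModel.blowUp, blowUpAdvice]
        split_ifs <;> simp
      · rw [dif_neg hc, dif_neg hc, mul_zero, zero_div]
    · rw [if_neg (show ¬ (a = 1 ∧ i < (blowUpAdvice n R s L lam T).size ∧
        j < (blowUpAdvice n R s L lam T).size) from h2)]
      exact input_real_eq_zero _ ⟨h1, fun h => h2 ⟨h.1, h.2.1, h.2.2.trans_le hq⟩⟩
  calc input M' = ⟨(input M').nat, (input M').real⟩ := rfl
    _ = _ := by rw [hnat, hreal]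

/-! ### Testing the blown-up models -/

/-- A tester for the blown-up models keeps almost all of its success probability if the samples are
the blow-ups of samples of the original model. -/
theorem haltProb_of_isIdentityTester [NeZero q] {N T : ℕ} {u : Fin N → Fin n}
    {M₁ M₂ : PottsModel n q} {M₁' M₂' : PottsModel N q} {δ ε ε' : ℝ} {P : Program}
    {𝓜 : Set (PottsModel N q)} (hP : IsIdentityTester P ε' T 𝓜) (h₁ : M₁.Approximates u M₁' δ)
    (h₂ : M₂.Approximates u M₂' δ) (hM₁ : M₁' ∈ 𝓜) (hM₂ : M₂' ∈ 𝓜) (hδ : δ ≤ ε' - ε)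
    (hT : T * δ ≤ 1 / 20) :
    (M₁.gibbs = M₂.gibbs → 7 / 10 ≤ haltProb (M₂.gibbs.map fun σ x => σ (u x))
      {s | s.nat 2 0 0 = true.toNat} T ⟨[P], input M₁'⟩) ∧
    (1 - ε ≤ tvDist M₁.gibbs M₂.gibbs → 7 / 10 ≤ haltProb (M₂.gibbs.map fun σ x => σ (u x))
      {s | s.nat 2 0 0 = false.toNat} T ⟨[P], input M₁'⟩) := by
  have key : ∀ {a b : ℝ≥0∞}, 3 / 4 ≤ a → a ≤ b + T * ENNReal.ofReal δ → 7 / 10 ≤ b := by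
    intro a b h1 h2
    have h3 : (T : ℝ≥0∞) * ENNReal.ofReal δ ≤ 1 / 20 := by
      rw [← ENNReal.ofReal_natCast, ← ENNReal.ofReal_mul (Nat.cast_nonneg _)]
      refine (ENNReal.ofReal_le_ofReal hT).trans (le_of_eq ?_)
      rw [ENNReal.ofReal_div_of_pos (by norm_num)]
      norm_num
    have h4 : (7 / 10 : ℝ≥0∞) + 1 / 20 = 3 / 4 := by
      rw [← ENNReal.toReal_eq_toReal_iff' (by finiteness) (by finiteness),
        ENNReal.toReal_add (by finiteness) (by finiteness)]
      norm_num
    have h5 : (7 / 10 : ℝ≥0∞) + 1 / 20 ≤ b + 1 / 20 := by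
      rw [h4]
      exact h1.trans (h2.trans (by gcongr))
    exact (ENNReal.add_le_add_iff_right (by finiteness)).1 h5
  constructor
  · intro heq
    have h1 := (hP M₁' hM₁ M₁' hM₁).1 rfl
    rw [answerProb_eq] at h1
    rw [← heq]
    exact key h1 (haltProb_le_add _ _ h₁.sum_tsub_le _ _ _)
  · intro htv
    have h1 := (hP M₁' hM₁ M₂' hM₂).2 (by linarith [h₁.tvDist_sub_le h₂])
    rw [answerProb_eq] at h1
    exact key h1 (haltProb_le_add _ _ h₂.sum_tsub_le _ _ _)

end RealRAM

/-! ### Parameters -/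

theorem eval_le_eval_one_mul_pow (p : Polynomial ℕ) {N : ℕ} (hN : 1 ≤ N) :
    p.eval N ≤ p.eval 1 * N ^ p.natDegree := by
  rw [Polynomial.eval_eq_sum_range, Polynomial.eval_eq_sum_range, Finset.sum_mul]
  refine Finset.sum_le_sum fun i hi => ?_
  rw [one_pow, mul_one]
  exact Nat.mul_le_mul_left _ (Nat.pow_le_pow_right hN (Nat.lt_succ_iff.1 (Finset.mem_range.1 hi)))

theorem one_add_pow_sub_one_le {y : ℝ} (hy : 0 ≤ y) {m : ℕ} (h : m * y ≤ 1) :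
    (1 + y) ^ m - 1 ≤ 2 * (m * y) := by
  have h0 : 0 ≤ m * y := by positivity
  have h1 : (1 + y) ^ m ≤ Real.exp (m * y) := by
    rw [Real.exp_nat_mul]
    exact pow_le_pow_left₀ (by linarith) (by linarith [Real.add_one_le_exp y]) _
  have h2 := Real.abs_exp_sub_one_le (x := m * y) (by rwa [abs_of_nonneg h0])
  rw [abs_of_nonneg h0] at h2
  linarith [le_abs_self (Real.exp (m * y) - 1)]

theorem blowUp_error_le {n q s L : ℕ} (hn : 0 < n) (hq : 0 < q) (hs : 0 < s) (hL : 0 < L)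
    (hsN : s ≤ n * L) {e : ℝ} (he : 0 ≤ e) (h : 4 * q ^ 2 * ((n * L : ℕ) : ℝ) ^ 2 * e ≤ 1) :
    (1 + s * (q * ((1 + q * e) ^ L - 1))) ^ n - 1 ≤ 4 * q ^ 2 * ((n * L : ℕ) : ℝ) ^ 2 * e := by
  have hn' : (1 : ℝ) ≤ n := by exact_mod_cast hn
  have hq' : (1 : ℝ) ≤ q := by exact_mod_cast hq
  have hL' : (1 : ℝ) ≤ L := by exact_mod_cast hL
  have hsN' : (s : ℝ) ≤ n * L := by exact_mod_cast hsN
  push_cast at h ⊢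
  have h1 : L * (q * e) ≤ 1 := by
    refine le_trans ?_ h
    have : 1 * 1 ≤ (4 * (q : ℝ)) * (n ^ 2 * L) := by
      gcongr
      · linarith
      · exact one_le_mul_of_one_le_of_one_le (one_le_pow₀ hn') hL'
    calc L * (q * e) = (1 * 1) * (L * (q * e)) := by ring
      _ ≤ ((4 * (q : ℝ)) * (n ^ 2 * L)) * (L * (q * e)) := by gcongr
      _ = _ := by ring
  have h2 := one_add_pow_sub_one_le (mul_nonneg (Nat.cast_nonneg q) he) h1
  have h3 : 0 ≤ (1 + q * e) ^ L - 1 := by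
    rw [sub_nonneg]
    exact one_le_pow₀ (by linarith [mul_nonneg (Nat.cast_nonneg (α := ℝ) q) he])
  have h4 : (s : ℝ) * (q * ((1 + q * e) ^ L - 1)) ≤ n * L * (q * (2 * (L * (q * e)))) := by
    gcongr
  have h5 : n * (n * L * (q * (2 * (L * (q * e))))) = 4 * q ^ 2 * (n * L) ^ 2 * e / 2 := by ring
  have h6 := one_add_pow_sub_one_le (m := n)
    (show (0 : ℝ) ≤ n * L * (q * (2 * (L * (q * e)))) by positivity) (by rw [h5]; linarith)
  refine le_trans ?_ (h6.trans (by rw [h5]; linarith))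
  have h7 : 0 ≤ (s : ℝ) * (q * ((1 + q * e) ^ L - 1)) := by positivity
  gcongr

/-- The strength of the gadgets can be chosen as an integer that is small enough to be counted, and
large enough to make up for any polynomial in the size. -/
theorem exists_strength {n₀ : ℕ} {d s : ℕ → ℕ} {b : ℕ → ℝ} (hd : ∀ n ≥ n₀, 0 < d n)
    (hs : ∀ n ≥ n₀, d n ≤ 5 * s n)
    (hlim : Tendsto (fun n : ℕ => b n * d n / Real.log n) atTop atTop) (p : Polynomial ℕ) (q : ℕ)
    (A : ℝ) {η : ℝ} (hη : 0 < η) :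
    ∃ lam : ℕ → ℕ, (∀ N, lam N ≤ N) ∧ ∀ᶠ N in atTop, A ≤ lam N ∧ (lam N : ℝ) ≤ b N * s N ∧
      4 * q ^ 2 * (N : ℝ) ^ 2 * Real.exp (-(lam N / 4)) * (20 * p.eval N + 1) ≤ η := by
  refine ⟨fun N => ⌊min (b N * s N) N⌋₊,
    fun N => Nat.floor_le_of_le (min_le_right _ _), ?_⟩
  set lam : ℕ → ℕ := fun N => ⌊min (b N * s N) N⌋₊ with hlam
  have hlog : Tendsto (fun N : ℕ => Real.log N) atTop atTop :=
    Real.tendsto_log_atTop.comp tendsto_natCast_atTop_atTop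
  have hbs : ∀ C : ℝ, 0 ≤ C → ∀ᶠ N : ℕ in atTop, C * Real.log N ≤ b N * s N := by
    intro C hC
    filter_upwards [hlim.eventually_ge_atTop (5 * C), hlog.eventually_gt_atTop 0,
      eventually_ge_atTop n₀] with N h1 h2 h3
    rw [le_div_iff₀ h2] at h1
    have h4 : (0 : ℝ) < d N := by exact_mod_cast hd N h3
    have h5 : (d N : ℝ) ≤ 5 * s N := by exact_mod_cast hs N h3
    have h6 : 0 ≤ b N := by
      by_contra! h
      have : 0 ≤ 5 * C * Real.log N := by positivity
      nlinarith
    nlinarith [mul_le_mul_of_nonneg_left h5 h6]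
  have hN : ∀ C : ℝ, 0 < C → ∀ᶠ N : ℕ in atTop, C * Real.log N ≤ N := by
    intro C hC
    have h := (Real.isLittleO_log_id_atTop.comp_tendsto
      (tendsto_natCast_atTop_atTop (R := ℝ))).bound (inv_pos.2 hC)
    filter_upwards [h] with N h1
    simp only [Function.comp_apply, id_eq, Real.norm_eq_abs, Nat.abs_cast] at h1
    have h2 := mul_le_mul_of_nonneg_left ((le_abs_self _).trans h1) hC.le
    rwa [mul_inv_cancel_left₀ hC.ne'] at h2
  have hC : ∀ C : ℝ, 0 ≤ C → ∀ᶠ N : ℕ in atTop, C * Real.log N ≤ lam N := by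
    intro C hC
    filter_upwards [hbs (C + 1) (by linarith), hN (C + 1) (by linarith),
      hlog.eventually_ge_atTop 1] with N h1 h2 h3
    have h4 := (Nat.lt_floor_add_one (min (b N * s N) N)).le
    have h5 := le_min h1 h2
    simp only [hlam]
    linarith
  filter_upwards [hC 1 zero_le_one, hlog.eventually_ge_atTop A, hbs 0 le_rfl,
    hC (4 * (p.natDegree + 3)) (by positivity), eventually_ge_atTop 1,
    tendsto_natCast_atTop_atTop.eventually_ge_atTop (4 * (q : ℝ) ^ 2 * (20 * p.eval 1 + 1) / η)]
    with N h1 h2 h3 h4 h5 h6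
  refine ⟨by linarith, ?_, ?_⟩
  · refine (Nat.floor_le (le_min (by linarith) (Nat.cast_nonneg N))).trans (min_le_left _ _)
  · have hN0 : (1 : ℝ) ≤ N := by exact_mod_cast h5
    have hp : ((p.eval N : ℕ) : ℝ) ≤ (p.eval 1 : ℕ) * (N : ℝ) ^ p.natDegree := by
      exact_mod_cast eval_le_eval_one_mul_pow p h5
    have hp' : (20 * p.eval N + 1 : ℝ) ≤ (20 * p.eval 1 + 1) * (N : ℝ) ^ p.natDegree := by
      have := one_le_pow₀ (n := p.natDegree) hN0
      linarith
    have hexp : Real.exp (-(lam N / 4)) * (N : ℝ) ^ (p.natDegree + 3) ≤ 1 := by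
      rw [← Real.exp_log (show (0 : ℝ) < N by linarith), ← Real.exp_nat_mul,
        ← Real.exp_add, ← Real.exp_zero,
        Real.exp_le_exp]
      push_cast
      linarith
    rw [div_le_iff₀ hη] at h6
    have h7 : N * (4 * q ^ 2 * (N : ℝ) ^ 2 * Real.exp (-(lam N / 4)) * (20 * p.eval N + 1)) ≤
        N * η := by
      calc N * (4 * q ^ 2 * (N : ℝ) ^ 2 * Real.exp (-(lam N / 4)) * (20 * p.eval N + 1))
          ≤ N * (4 * q ^ 2 * (N : ℝ) ^ 2 * Real.exp (-(lam N / 4)) *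
            ((20 * p.eval 1 + 1) * (N : ℝ) ^ p.natDegree)) := by gcongr
        _ = (4 * q ^ 2 * (20 * p.eval 1 + 1)) *
            (Real.exp (-(lam N / 4)) * (N : ℝ) ^ (p.natDegree + 3)) := by ring
        _ ≤ (4 * q ^ 2 * (20 * p.eval 1 + 1)) * 1 := by gcongr
        _ ≤ N * η := by linarith
    exact le_of_mul_le_mul_left h7 (by linarith)

/-- The gadgets have room for all rows: the size of the blown-up model is at most `R ^ (K + 1)`, so
that `3 s ≤ R ^ ((K + 1) (1 - ρ)) ≤ R ^ (K - 2)`. -/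
theorem gadget_room {ρ : ℝ} (hρ0 : 0 < ρ) (hρ1 : ρ < 1) {K n R s d : ℕ} (hK : 3 / ρ ≤ K)
    (hn : n ≤ R) (hs : 3 * s ≤ d) (hd : (d : ℝ) ≤ ((n * R ^ K : ℕ) : ℝ) ^ (1 - ρ)) (hR : 1 ≤ R) :
    2 * R * R * s ≤ R ^ K := by
  have hR' : (1 : ℝ) ≤ R := by exact_mod_cast hR
  have hK' : 3 ≤ ρ * K := by rwa [div_le_iff₀' hρ0] at hK
  have hK2 : 2 ≤ K := by
    have : (2 : ℝ) ≤ K := by nlinarith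
    exact_mod_cast this
  have h1 : ((n * R ^ K : ℕ) : ℝ) ≤ (R : ℝ) ^ ((K + 1 : ℕ) : ℝ) := by
    rw [Real.rpow_natCast, pow_succ']
    push_cast
    gcongr
  have h2 : (d : ℝ) ≤ (R : ℝ) ^ (K - 2 : ℕ) := by
    refine hd.trans ((Real.rpow_le_rpow (Nat.cast_nonneg _) h1 (by linarith)).trans ?_)
    rw [← Real.rpow_mul (by linarith), ← Real.rpow_natCast]
    refine Real.rpow_le_rpow_of_exponent_le hR' ?_
    push_cast [hK2]
    nlinarith
  have h3 : d ≤ R ^ (K - 2) := by exact_mod_cast h2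
  calc 2 * R * R * s ≤ R * R * (3 * s) := by nlinarith [Nat.zero_le (R * R * s)]
    _ ≤ R * R * R ^ (K - 2) := Nat.mul_le_mul_left _ (hs.trans h3)
    _ = R ^ K := by rw [← pow_two, ← pow_add, Nat.add_sub_cancel' hK2]

/-- The number of ports of a gadget is at least the power `1 / (K + 1)` of the size of the blown-up
model. -/
theorem div_ports_le {h : ℝ} (hh : 0 ≤ h) {n R s K : ℕ} (hn : 0 < n) (hnR : n ≤ R) (hs : 0 < s) :
    h / (R * s : ℕ) ≤ h * ((n * R ^ K : ℕ) : ℝ) ^ (-(1 / (K + 1 : ℝ))) := by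
  have hR : (1 : ℝ) ≤ R := by exact_mod_cast hn.trans_le hnR
  have hs' : (1 : ℝ) ≤ s := by exact_mod_cast hs
  have hN : (0 : ℝ) < (n * R ^ K : ℕ) := by
    have : (0 : ℝ) < n := by exact_mod_cast hn
    push_cast
    positivity
  have h1 : ((n * R ^ K : ℕ) : ℝ) ≤ (R : ℝ) ^ (K + 1 : ℕ) := by
    rw [pow_succ']
    push_cast
    gcongr
  have h2 : ((n * R ^ K : ℕ) : ℝ) ^ (1 / (K + 1 : ℝ)) ≤ R := by
    refine (Real.rpow_le_rpow hN.le h1 (by positivity)).trans (le_of_eq ?_)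
    have := Real.pow_rpow_inv_natCast (show (0 : ℝ) ≤ R by linarith) (Nat.succ_ne_zero K)
    rwa [Nat.cast_succ, inv_eq_one_div] at this
  rw [div_eq_mul_inv, Real.rpow_neg hN.le]
  refine mul_le_mul_of_nonneg_left (inv_anti₀ (Real.rpow_pos_of_pos hN _) (h2.trans ?_)) hh
  push_cast
  exact le_mul_of_one_le_right (by linarith) hs'

/-! ### The reduction -/

open RealRAM PottsModel in
/-- A tester for bipartite models of small degree yields a tester for all models. The proposition
`F` decides whether the models are required to be ferromagnetic. -/
theorem hasPolyTimeTester_of_bipartite {q : ℕ} [NeZero q] {ρ : ℝ} (hρ0 : 0 < ρ) (hρ1 : ρ < 1)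
    {β h ε ε' : ℝ} (hβ : 0 ≤ β) (hh : 0 ≤ h) (hε : ε < ε') {K : ℕ} (hK : 3 / ρ ≤ K) {n₀ : ℕ}
    {d : ℕ → ℕ} {β' h' : ℕ → ℝ} (hd : ∀ n ≥ n₀, 3 ≤ d n ∧ (d n : ℝ) ≤ (n : ℝ) ^ (1 - ρ))
    (hlim : Tendsto (fun n : ℕ => β' n * d n / Real.log n) atTop atTop)
    (hfield : ∀ n ≥ n₀, h * (n : ℝ) ^ (-(1 / (K + 1 : ℝ))) ≤ h' n) (F : Prop)
    (htest : HasPolyTimeTester ε' n₀ fun n =>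
      {M ∈ pottsBipMono q n (d n) (β' n) (h' n) | F → M.IsFerromagnetic}) :
    HasPolyTimeTester ε 3 fun n => {M ∈ pottsMono q n n β h | F → M.IsFerromagnetic} := by
  obtain ⟨P, p, hP⟩ := htest
  have hdn : ∀ n ≥ n₀, d n ≤ n := by
    intro n hn
    obtain ⟨h3, h4⟩ := hd n hn
    have hn1 : (1 : ℝ) ≤ n := by
      have : n ≠ 0 := by
        rintro rfl
        rw [Nat.cast_zero, Real.zero_rpow (by linarith)] at h4
        have : d 0 ≤ 0 := by exact_mod_cast h4
        omega
      exact_mod_cast Nat.one_le_iff_ne_zero.2 this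
    have h5 := h4.trans (Real.rpow_le_rpow_of_exponent_le hn1 (show 1 - ρ ≤ 1 by linarith))
    rw [Real.rpow_one] at h5
    exact_mod_cast h5
  obtain ⟨s, hsN, hs⟩ : ∃ s : ℕ → ℕ, (∀ n, s n ≤ n) ∧
      ∀ n ≥ n₀, 0 < s n ∧ 3 * s n ≤ d n ∧ d n ≤ 5 * s n := by
    refine ⟨fun n => min (d n / 3) n, fun n => min_le_right _ _, fun n hn => ?_⟩
    have h1 := (hd n hn).1
    have h2 := hdn n hn
    simp only
    omega
  obtain ⟨lam, hlamN, hlam⟩ := exists_strength (s := s)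
    (fun n hn => (by have := (hd n hn).1; omega)) (fun n hn => (hs n hn).2.2) hlim p q
    (12 * (β + 2 * h) + β + 1) (show 0 < min (ε' - ε) 1 from lt_min (by linarith) one_pos)
  obtain ⟨N₀, hN₀⟩ := eventually_atTop.1 (hlam.and (eventually_ge_atTop (n₀ + q + 5)))
  have hN₀1 : N₀ + 1 ≥ 1 := Nat.le_add_left 1 N₀
  -- the number of rows and the size of the blown-up model; the summand `N₀ + 1` ensures that the
  -- asymptotic estimates hold for all `n`
  set R : ℕ → ℕ := fun n => n + (N₀ + 1) with hR
  set N : ℕ → ℕ := fun n => n * R n ^ K with hN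
  set NX : Polynomial ℕ := Polynomial.X * (Polynomial.X + Polynomial.C (N₀ + 1)) ^ K with hNX
  have hNXeval : ∀ n, NX.eval n = N n := fun n => by simp [hNX, hN, hR]
  obtain ⟨Q, r, hQ⟩ := exists_simulating_program P
    (fun n => blowUpAdvice n (R n) (s (N n)) (R n ^ K) (lam (N n)) (p.eval (N n)))
    (NX + (Polynomial.X + Polynomial.C (N₀ + 1)) * NX + p.comp NX + 1)
    (fun n => by
      simp only [Polynomial.eval_add, Polynomial.eval_mul, Polynomial.eval_comp, hNXeval]
      exact le_add_right (le_add_right (le_add_right le_rfl)))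
    (fun n => by
      simp only [Polynomial.eval_add, Polynomial.eval_mul, Polynomial.eval_comp, hNXeval]
      exact le_add_right (le_add_left le_rfl))
    (fun n i hi k hk => by
      have h1 : (NX + (Polynomial.X + Polynomial.C (N₀ + 1)) * NX + p.comp NX + 1).eval n =
          N n + R n * N n + p.eval (N n) + 1 := by
        simp [Polynomial.eval_add, Polynomial.eval_mul, Polynomial.eval_comp, hNXeval, hR]
      have h2 := hsN (N n)
      have h3 := hlamN (N n)
      have h4 : R n * s (N n) ≤ R n * N n := Nat.mul_le_mul_left _ h2
      have h5 : n * R n ^ K = N n := rfl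
      rw [h1]
      refine blowUpAdvice_le ?_ ?_ ?_ ?_ ?_ ?_ hi hk <;> omega)
  refine ⟨Q, r, fun n hn => ?_⟩
  -- the parameters for models on `n` vertices
  have hRn : n ≤ R n := Nat.le_add_right _ _
  have hR0 : 0 < R n := by simp only [hR]; omega
  have hK0 : K ≠ 0 := by
    rintro rfl
    have : 0 < 3 / ρ := by positivity
    rw [Nat.cast_zero] at hK
    linarith
  have hRL : R n ≤ R n ^ K := Nat.le_self_pow hK0 _
  have hNR : R n ≤ N n := hRL.trans (Nat.le_mul_of_pos_left _ (by omega))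
  obtain ⟨⟨hA, hlams, herr⟩, hNq⟩ := hN₀ (N n) (by simp only [hR] at hNR; omega)
  obtain ⟨hs0, hsd, -⟩ := hs (N n) (by omega)
  have hs0' : (0 : ℝ) < s (N n) := by exact_mod_cast hs0
  have hroom : 2 * R n * R n * s (N n) ≤ R n ^ K :=
    gadget_room hρ0 hρ1 hK hRn hsd (hd (N n) (by omega)).2 hR0
  have hroom' : 2 * s (N n) ≤ R n ^ K := by
    refine le_trans ?_ hroom
    rw [mul_assoc 2]
    have : 1 ≤ R n * R n := Nat.mul_pos hR0 hR0
    nlinarith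
  have hq0 : 0 < q := Nat.pos_of_ne_zero (NeZero.ne q)
  set w : ℝ := lam (N n) / s (N n) with hw
  have hws : w * s (N n) = lam (N n) := div_mul_cancel₀ _ hs0'.ne'
  have hw0 : 0 < w := div_pos (by linarith) hs0'
  have hwβ : w ≤ β' (N n) := by rwa [hw, div_le_iff₀ hs0']
  set E : ℝ := 4 * q ^ 2 * (N n : ℝ) ^ 2 * Real.exp (-(lam (N n) / 4)) with hE
  have hE0 : 0 ≤ E := by positivity
  have hT0 : (0 : ℝ) ≤ p.eval (N n) := Nat.cast_nonneg _
  have hE1 : E ≤ min (ε' - ε) 1 := by nlinarith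
  have hE2 : p.eval (N n) * E ≤ 1 / 20 := by
    have := herr.trans (min_le_right _ _)
    nlinarith
  have hδ : (1 + s (N n) * (q * ((1 + q * Real.exp (-(w / 4) * s (N n))) ^ (R n ^ K) - 1))) ^ n -
      1 ≤ E := by
    have h1 : -(w / 4) * s (N n) = -(lam (N n) / 4) := by rw [← hws]; ring
    rw [h1]
    exact blowUp_error_le (by omega) hq0 hs0 (by omega) (hsN _) (Real.exp_pos _).le
      (hE1.trans (min_le_right _ _))
  have hmem : ∀ M ∈ {M ∈ pottsMono q n n β h | F → M.IsFerromagnetic},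
      M.blowUp (R n) (s (N n)) (R n ^ K) w ∈
        {M ∈ pottsBipMono q (N n) (d (N n)) (β' (N n)) (h' (N n)) | F → M.IsFerromagnetic} := by
    rintro M ⟨⟨⟨-, hM1, hM2⟩, hM3⟩, hM4⟩
    have h1 : h / (R n * s (N n) : ℕ) ≤ h' (N n) :=
      (div_ports_le hh (by omega) hRn hs0).trans (hfield (N n) (by omega))
    have h2 : 0 ≤ h' (N n) := le_trans (by positivity) h1
    have h3 := blowUp_isVertexMonochromatic (R := R n) (s := s (N n)) (L := R n ^ K) (w := w)
      hM3 h1 h2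
    refine ⟨⟨⟨⟨fun x => (blowUp_degree_le hs0 hRn x).trans hsd, ?_, h3.1⟩, h3⟩,
      blowUp_isBipartite⟩, fun hF => blowUp_isFerromagnetic (hM4 hF) hw0 hs0⟩
    refine blowUp_abs_edgeWeight_le hβ hM1 (by rwa [abs_of_pos hw0]) ?_
    rw [div_le_iff₀ hs0']
    linarith
  have happrox : ∀ M ∈ {M ∈ pottsMono q n n β h | F → M.IsFerromagnetic},
      M.Approximates (fun x => x.divNat) (M.blowUp (R n) (s (N n)) (R n ^ K) w) E := by
    rintro M ⟨⟨⟨-, hM1, hM2⟩, -⟩, -⟩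
    obtain ⟨hsurj, κ, hκ, hκ1, hκ2⟩ := M.blowUp_approximates hR0 hs0 hRn hroom hroom' hβ hh hM1 hM2
      (w := w) (by rw [hws]; linarith)
    refine ⟨hsurj, κ, hκ, hκ1, hκ2.trans ?_⟩
    have := M.partitionFunction_pos
    gcongr
  intro M hM M' hM'
  have key := haltProb_of_isIdentityTester (ε := ε) (hP (N n) (by omega)) (happrox M hM)
    (happrox M' hM') (hmem M hM) (hmem M' hM') (hE1.trans (min_le_left _ _)) hE2
  rw [input_blowUp M (T := p.eval (N n)) (show q ≤ n * R n ^ K from by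
    have : n * R n ^ K = N n := rfl
    omega)] at key
  exact ⟨fun heq => hQ n q M M'.gibbs (fun x => x.divNat) (fun x => rfl) (by
      change 5 ≤ N n
      omega) true (key.1 heq),
    fun htv => hQ n q M M'.gibbs (fun x => x.divNat) (fun x => rfl) (by
      change 5 ≤ N n
      omega) false (key.2 htv)⟩

end

theorem mainTheorem5 (q : ℕ) [q.AtLeastTwo] (ρ : ℝ) (hρ : ρ ∈ Set.Ioo (0 : ℝ) 1)
    (β h ε : ℝ) (hβ : 0 ≤ β) (hh : 0 ≤ h) :
    (¬ HasPolyTimeTester ε 3 (fun n => pottsMono q n n β h) →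
      ∃ c ∈ Set.Ioo (0 : ℝ) 1, ∀ ε' > ε, ∀ (n₀ : ℕ) (d : ℕ → ℕ) (β' h' : ℕ → ℝ),
        (∀ n ≥ n₀, 3 ≤ d n ∧ (d n : ℝ) ≤ (n : ℝ) ^ (1 - ρ)) →
        Tendsto (fun n : ℕ => β' n * d n / Real.log n) atTop atTop →
        (∀ n ≥ n₀, h * (n : ℝ) ^ (-c) ≤ h' n) →
        ¬ HasPolyTimeTester ε' n₀ (fun n => pottsBipMono q n (d n) (β' n) (h' n))) ∧
    (¬ HasPolyTimeTester ε 3 (fun n => ferroPottsMono q n n β h) →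
      ∃ c ∈ Set.Ioo (0 : ℝ) 1, ∀ ε' > ε, ∀ (n₀ : ℕ) (d : ℕ → ℕ) (β' h' : ℕ → ℝ),
        (∀ n ≥ n₀, 3 ≤ d n ∧ (d n : ℝ) ≤ (n : ℝ) ^ (1 - ρ)) →
        Tendsto (fun n : ℕ => β' n * d n / Real.log n) atTop atTop →
        (∀ n ≥ n₀, h * (n : ℝ) ^ (-c) ≤ h' n) →
        ¬ HasPolyTimeTester ε' n₀ (fun n => ferroPottsBipMono q n (d n) (β' n) (h' n))) := by
  obtain ⟨hρ0, hρ1⟩ := hρ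
  have hK : 3 / ρ ≤ (⌈3 / ρ⌉₊ : ℝ) := Nat.le_ceil _
  have hc : 1 / ((⌈3 / ρ⌉₊ : ℝ) + 1) ∈ Set.Ioo (0 : ℝ) 1 := by
    have : 0 < 3 / ρ := by positivity
    exact ⟨by positivity, (div_lt_one (by positivity)).2 (by linarith)⟩
  constructor
  · refine fun hno => ⟨_, hc, fun ε' hε n₀ d β' h' hd hlim hfield htest => hno ?_⟩
    have := hasPolyTimeTester_of_bipartite hρ0 hρ1 hβ hh hε hK hd hlim hfield False
      (by simpa using htest)
    simpa using this
  · exact fun hno => ⟨_, hc, fun ε' hε n₀ d β' h' hd hlim hfield htest => hno <| by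
      have := hasPolyTimeTester_of_bipartite hρ0 hρ1 hβ hh hε hK hd hlim hfield True
        (by simpa [ferroPottsBipMono] using htest)
      simpa [ferroPottsMono] using this⟩
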